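/- \textbf{Setting.} A \emph{configuration} is a set $\mu$ of points $(t,s)\in\mathbb{R}^d\times(0,\infty)$ ($t$ is a location, $s$ its score), identified with a counting measure, with at most one point over each location and with finitely many points in $B\times(\varepsilon,\infty)$ for all bounded $B\subset\mathbb{R}^d$ and $\varepsilon>0$. Let $\mathcal N$ be the set of configurations and $\mathcal N_{10}\subset\mathcal N$ the set of those that have finitely many points in $B\times(0,\infty)$ for all bounded $B$. Both carry the $\sigma$-algebra generated by $\mu\mapsto\mu(B)$, $B$ Borel; $\mathcal N$ carries the vague topology, the smallest one for which $\mu\mapsto\mu(f)=\sum_{(t,s)\in\mu}f(t,s)$ is continuous for every bounded continuous $f$ supported in some $B\times(\varepsilon,\infty)$ with $B$ bounded and $\varepsilon>0$. Write $\mu'$ for the set of locations of $\mu$, $\mu(t)$ for the score at $t\in\mu'$ (and $\mu(t)=0$ if $t\notin\mu'$), $\varphi_z\mu=\{(t-z,s):(t,s)\in\mu\}$ and $T_{v,u}\mu=\{(t/v,s/u):(t,s)\in\mu\}$. Let $\mathcal N_g$ be the space of locally finite subsets of $\mathbb{R}^d$, with the $\sigma$-algebra generated by the counts of points in Borel sets.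 A marked point process $X$ (a random element of $\mathcal N_{10}$) is \emph{stationary} if $\varphi_zX\overset{d}{=}X$ for all $z$; when it has finite intensity $\lambda>0$, a random element $\tilde X$ of $\mathcal N_{10}$ is a \emph{Palm version} of $X$ if $\mathbb{E}\sum_{(t,s)\in X}h(t,\varphi_tX)=\lambda\int_{\mathbb{R}^d}\mathbb{E}[h(t,\tilde X)]\,dt$ for all measurable $h\ge0$. Let $r:(0,\infty)\to(0,\infty)$ be regularly varying at infinity with index $\beta\in\mathbb{R}$. A random element $Y$ of $\mathcal N$ is a \emph{tail configuration} of $X$ with respect to $r$ if $Y(\{0\}\times(1,\infty))=1$ a.s.\ and, with $\xi=\tilde X(0)$, the conditional law of $T_{r(u),u}\tilde X$ given $\xi>u$ converges weakly to the law of $Y$ as $u\to\infty$ for the vague topology; its \emph{spectral part} is $\Theta=T_{\eta^\beta,\eta}Y$ with $\eta=Y(0)$. \textbf{Model.} Let $\zeta>0$ be a random variable with law $m$ whose tail is regularly varying: $\mathbb{P}(\zeta>uy)/\mathbb{P}(\zeta>u)\to y^{-\alpha}$ as $u\to\infty$ for all $y>0$, with $\alpha>0$. Let $P$ be a Poisson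 process on $\mathbb{R}^d\times(0,\infty)$ with intensity measure $\mathrm{Leb}\otimes m$ (a unit rate stationary Poisson process with independent marks of law $m$), and let $\tilde P=P+\delta_{(0,\zeta_0)}$, where $\zeta_0$ has law $m$ and is independent of $P$. Let $\Phi:\mathbb{R}^d\times\mathcal N_g\to\mathcal N_g$ be measurable, such that for all $A\in\mathcal N_g$ and $t\in A$ the set $\Phi(t,A)$ is a finite subset of $A$ containing $t$, and $\Phi(t-x,A-x)=\Phi(t,A)-x$ for all $x\in\mathbb{R}^d$. Let $w:\mathbb{R}^d\to[0,\infty)$ be measurable and bounded with $w(0)>0$. For $\mu\in\mathcal N_{10}$ put $$\psi(t,\mu)=\max_{x\in\Phi(t,\mu')}w(x-t)\,\mu(x)\quad(t\in\mu'),\qquad \Psi(\mu)=\{(t,\psi(t,\mu)):t\in\mu'\},$$ and let $X=\Psi(P)$, $\tilde X=\Psi(\tilde P)$, $\xi=\tilde X(0)$, $\tilde\Phi(t)=\Phi(t,\tilde P')$ and $\tilde N(0)=\#\tilde\Phi(0)$. \textbf{Theorem.} Assume $\mathbb{E}[\tilde N(0)]<\infty$. (i) With $\kappa:=\mathbb{E}\big[\sum_{t\in\tilde\Phi(0)}w(t)^\alpha\big]$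 one has $\kappa\in(0,\infty)$ and $$\lim_{u\to\infty}\frac{\mathbb{P}(\xi>u)}{\mathbb{P}(\zeta>u)}=\kappa .$$ In particular, the tail of $\xi$ is regularly varying with index $\alpha$. (ii) The process $X$ is stationary with Palm version $\tilde X$. It has a tail configuration with respect to the constant scaling function $r\equiv1$ (with $\beta=0$), and the spectral part $\Theta$ of any such tail configuration satisfies $$\mathbb{E}[h(\Theta)]=\kappa^{-1}\,\mathbb{E}\Big[\sum_{x\in\tilde\Phi(0)}h\Big(\Big\{\Big(t,\tfrac{w(x-t)}{w(x)}\Big):t\in\tilde P',\ x\in\tilde\Phi(t)\Big\}\Big)\,w(x)^\alpha\Big]$$ for all measurable $h:\mathcal N\to[0,\infty]$, where the summand for $x$ is $0$ if $w(x)=0$, and points $(t,0)$ with score $0$ are dropped from the set. -/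

import Mathlib

open MeasureTheory ProbabilityTheory Filter Topology Set
open scoped ENNReal NNReal BoundedContinuousFunction

namespace TailConf

/-- Locations: `ℝ^d` with the Euclidean norm. -/
abbrev Pos (d : ℕ) := EuclideanSpace ℝ (Fin d)

/-! ### Configurations of points -/

/-- Simple locally finite point measures on `ℝ^d`, represented by their sets of atoms. -/
@[ext] structure PointSet (d : ℕ) where
  pts : Set (Pos d)
  finite_bdd : ∀ R : ℝ, {t ∈ pts | ‖t‖ ≤ R}.Finite

/-- Simple counting measures on `ℝ^d × (0,∞)` (at most one atom over each location) which are finite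
on every set `B × (ε,∞)` with `B` bounded and `ε > 0`, represented by their sets of atoms
`(t, s)` (location, score). -/
@[ext] structure Config (d : ℕ) where
  atoms : Set (Pos d × ℝ)
  pos : ∀ p ∈ atoms, 0 < p.2
  simple : ∀ p ∈ atoms, ∀ q ∈ atoms, p.1 = q.1 → p = q
  finite_bdd : ∀ R ε : ℝ, 0 < ε → {p ∈ atoms | ‖p.1‖ ≤ R ∧ ε < p.2}.Finite

/-- The configurations which have finitely many points in every `B × (0,∞)` with `B` bounded. -/
abbrev MarkedConfig (d : ℕ) :=
  {μ : Config d // ∀ R : ℝ, {p ∈ μ.atoms | ‖p.1‖ ≤ R}.Finite}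

variable {d : ℕ}

/-- The counting measure with the given atoms. -/
noncomputable def PointSet.toMeasure (A : PointSet d) : Measure (Pos d) :=
  Measure.sum fun t : A.pts => Measure.dirac (t : Pos d)

/-- The counting measure with the given atoms. -/
noncomputable def Config.toMeasure (μ : Config d) : Measure (Pos d × ℝ) :=
  Measure.sum fun p : μ.atoms => Measure.dirac (p : Pos d × ℝ)

/-- The σ-algebra generated by the evaluations `A ↦ A(B)`, `B` Borel. -/
noncomputable instance : MeasurableSpace (PointSet d) :=
  MeasurableSpace.comap PointSet.toMeasure inferInstance

/-- The σ-algebra generated by the evaluations `μ ↦ μ(B)`, `B` Borel. -/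
noncomputable instance : MeasurableSpace (Config d) :=
  MeasurableSpace.comap Config.toMeasure inferInstance

/-- Bounded continuous functions on `ℝ^d × (0,∞)` whose support lies in some `B × (ε,∞)` with `B`
bounded and `ε > 0`. They are written as functions on `ℝ^d × ℝ`: because of the support condition,
extension by zero is a bijection onto the functions below. -/
def IsTestFunction (f : Pos d × ℝ → ℝ) : Prop :=
  Continuous f ∧ (∃ C : ℝ, ∀ p, |f p| ≤ C) ∧
    ∃ R ε : ℝ, 0 < ε ∧ ∀ p, f p ≠ 0 → ‖p.1‖ ≤ R ∧ ε < p.2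

/-- The vague topology: the smallest one for which all `μ ↦ μ(f)`, `f` a test function, are
continuous. (The sums have finitely many nonzero terms.) -/
noncomputable instance : TopologicalSpace (Config d) :=
  ⨅ f : {f : Pos d × ℝ → ℝ // IsTestFunction f},
    TopologicalSpace.induced (fun μ : Config d => ∑' p : μ.atoms, f.1 p) inferInstance

open Classical in
/-- `μ(t)`: the score of `μ` at the location `t`, and `0` if there is no point at `t`. -/
noncomputable def Config.score (μ : Config d) (t : Pos d) : ℝ :=
  if h : ∃ s, (t, s) ∈ μ.atoms then h.choose else 0

/-- The projection to `ℝ^d`. -/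
def MarkedConfig.ground (μ : MarkedConfig d) : PointSet d where
  pts := Prod.fst '' μ.1.atoms
  finite_bdd R := by
    refine ((μ.2 R).image Prod.fst).subset ?_
    rintro _ ⟨⟨p, hp, rfl⟩, hR⟩
    exact ⟨p, ⟨hp, hR⟩, rfl⟩

/-- The shift `φ_z`, moving every point `t` to `t - z`. -/
def PointSet.shift (z : Pos d) (A : PointSet d) : PointSet d where
  pts := (fun t => t - z) '' A.pts
  finite_bdd R := by
    refine ((A.finite_bdd (R + ‖z‖)).image (fun t => t - z)).subset ?_
    rintro _ ⟨⟨t, ht, rfl⟩, hR⟩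
    refine ⟨t, ⟨ht, ?_⟩, rfl⟩
    have := norm_le_norm_sub_add t z
    have hR' : ‖t - z‖ ≤ R := hR
    linarith

/-- The shift `φ_z`, moving every point `(t, s)` to `(t - z, s)`. -/
def MarkedConfig.shift (z : Pos d) (μ : MarkedConfig d) : MarkedConfig d :=
  have hfin : ∀ R : ℝ,
      {p ∈ (fun p : Pos d × ℝ => (p.1 - z, p.2)) '' μ.1.atoms | ‖p.1‖ ≤ R}.Finite := by
    intro R
    refine ((μ.2 (R + ‖z‖)).image (fun p : Pos d × ℝ => (p.1 - z, p.2))).subset ?_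
    rintro _ ⟨⟨p, hp, rfl⟩, hR⟩
    refine ⟨p, ⟨hp, ?_⟩, rfl⟩
    have := norm_le_norm_sub_add p.1 z
    have hR' : ‖p.1 - z‖ ≤ R := hR
    linarith
  ⟨{ atoms := (fun p : Pos d × ℝ => (p.1 - z, p.2)) '' μ.1.atoms
     pos := by rintro _ ⟨p, hp, rfl⟩; exact μ.1.pos p hp
     simple := by
       rintro _ ⟨p, hp, rfl⟩ _ ⟨q, hq, rfl⟩ h
       have h' : p.1 = q.1 := by simpa using h
       rw [μ.1.simple p hp q hq h']
     finite_bdd := fun R ε _ => (hfin R).subset fun _ hp => ⟨hp.1, hp.2.1⟩ }, hfin⟩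

/-- The scaling `T_{v,u}`, `v, u > 0`, moving every point `(t, s)` to `(t / v, s / u)`; a point
`p` belongs to the scaled configuration iff `(v p.1, u p.2)` belongs to the original one.
(If `v ≤ 0` or `u ≤ 0` the result is the empty configuration.) -/
def Config.scale (v u : ℝ) (μ : Config d) : Config d where
  atoms := {p | 0 < v ∧ 0 < u ∧ (v • p.1, u * p.2) ∈ μ.atoms}
  pos := by
    rintro p ⟨_, hu, hp⟩
    exact (pos_iff_pos_of_mul_pos (μ.pos _ hp)).1 hu
  simple := by
    rintro p ⟨_, hu, hp⟩ q ⟨_, _, hq⟩ h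
    have h1 := μ.simple _ hp _ hq (by simp [h])
    have h2 : u * p.2 = u * q.2 := congrArg Prod.snd h1
    exact Prod.ext h (mul_left_cancel₀ hu.ne' h2)
  finite_bdd := by
    intro R ε hε
    by_cases hvu : 0 < v ∧ 0 < u
    · obtain ⟨hv, hu⟩ := hvu
      refine Set.Finite.subset (Set.Finite.preimage (f := fun p : Pos d × ℝ => (v • p.1, u * p.2))
        ?_ (μ.finite_bdd (v * R) (u * ε) (mul_pos hu hε))) ?_
      · intro p _ q _ h
        have h1 : v • p.1 = v • q.1 := congrArg Prod.fst h
        have h2 : u * p.2 = u * q.2 := congrArg Prod.snd h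
        exact Prod.ext (smul_right_injective _ hv.ne' h1) (mul_left_cancel₀ hu.ne' h2)
      · rintro p ⟨⟨_, _, hp⟩, hR, hs⟩
        refine ⟨hp, ?_, mul_lt_mul_of_pos_left hs hu⟩
        simp only [norm_smul, Real.norm_eq_abs, abs_of_pos hv]
        exact mul_le_mul_of_nonneg_left hR hv.le
    · refine Set.finite_empty.subset ?_
      rintro p ⟨⟨hv, hu, _⟩, _⟩
      exact hvu ⟨hv, hu⟩

/-- The points of `A` which satisfy `q`. -/
def PointSet.sep (A : PointSet d) (q : Pos d → Prop) : PointSet d where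
  pts := {t ∈ A.pts | q t}
  finite_bdd R := (A.finite_bdd R).subset fun _ ht => ⟨ht.1.1, ht.2⟩

/-- The configuration `{(t, g t) : t ∈ A}`, restricted to positive scores. -/
def ofScores (A : PointSet d) (g : Pos d → ℝ) : MarkedConfig d :=
  have hfin : ∀ R : ℝ, {p ∈ {p : Pos d × ℝ | p.1 ∈ A.pts ∧ p.2 = g p.1 ∧ 0 < p.2} |
      ‖p.1‖ ≤ R}.Finite := by
    intro R
    refine ((A.finite_bdd R).image (fun t => (t, g t))).subset ?_
    rintro ⟨t, s⟩ ⟨⟨ht, hs, _⟩, hR⟩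
    exact ⟨t, ⟨ht, hR⟩, Prod.ext rfl hs.symm⟩
  ⟨{ atoms := {p | p.1 ∈ A.pts ∧ p.2 = g p.1 ∧ 0 < p.2}
     pos := fun _ hp => hp.2.2
     simple := fun p hp q hq h => Prod.ext h (by rw [hp.2.1, hq.2.1, h])
     finite_bdd := fun R ε _ => (hfin R).subset fun _ hp => ⟨hp.1, hp.2.1⟩ }, hfin⟩

/-- `μ + δ_{(0,z)}` for `z > 0`. To obtain a simple configuration in all cases, a point that `μ` may
already have over the location `0` is removed first. -/
def addOrigin (μ : MarkedConfig d) (z : ℝ) : MarkedConfig d :=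
  have hfin : ∀ R : ℝ, {p ∈ {p : Pos d × ℝ | p ∈ μ.1.atoms ∧ p.1 ≠ 0} ∪
      {p | p = (0, z) ∧ 0 < z} | ‖p.1‖ ≤ R}.Finite := by
    intro R
    refine ((μ.2 R).union (Set.finite_singleton ((0 : Pos d), z))).subset ?_
    rintro p ⟨hp | hp, hR⟩
    · exact Or.inl ⟨hp.1, hR⟩
    · exact Or.inr hp.1
  ⟨{ atoms := {p | p ∈ μ.1.atoms ∧ p.1 ≠ 0} ∪ {p | p = (0, z) ∧ 0 < z}
     pos := by
       rintro p (hp | ⟨rfl, hz⟩)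
       · exact μ.1.pos p hp.1
       · exact hz
     simple := by
       rintro p (hp | ⟨rfl, _⟩) q (hq | ⟨rfl, _⟩) h
       · exact μ.1.simple p hp.1 q hq.1 h
       · exact absurd h hp.2
       · exact absurd h.symm hq.2
       · rfl
     finite_bdd := fun R ε _ => (hfin R).subset fun _ hp => ⟨hp.1, hp.2.1⟩ }, hfin⟩

/-! ### Regular variation -/

/-- `f` is (measurable, eventually positive and) regularly varying at infinity with index `ρ`. -/
def IsRegularlyVarying (f : ℝ → ℝ) (ρ : ℝ) : Prop :=
  Measurable f ∧ (∀ᶠ u in atTop, 0 < f u) ∧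
    ∀ y : ℝ, 0 < y → Tendsto (fun u => f (u * y) / f u) atTop (𝓝 (y ^ ρ))

/-! ### Point processes, Palm versions, tail configurations -/

section Processes

variable {Ω Ω' : Type*} [MeasurableSpace Ω] [MeasurableSpace Ω']

/-- `P` is a Poisson process with intensity measure `Λ`: numbers of points are Poisson distributed,
and independent for disjoint sets. -/
structure IsPoissonProcess (Pr : Measure Ω) (P : Ω → MarkedConfig d)
    (Λ : Measure (Pos d × ℝ)) : Prop where
  measurable : Measurable P
  poisson : ∀ B : Set (Pos d × ℝ), MeasurableSet B → Λ B ≠ ∞ → ∀ k : ℕ,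
    Pr {ω | (P ω).1.toMeasure B = k} = poissonMeasure (Λ B).toNNReal {k}
  indep : ∀ (n : ℕ) (B : Fin n → Set (Pos d × ℝ)), (∀ i, MeasurableSet (B i)) →
    Pairwise (fun i j => Disjoint (B i) (B j)) →
    iIndepFun (fun i ω => (P ω).1.toMeasure (B i)) Pr

/-- Stationarity: all shifts of `X` have the same distribution as `X`. -/
def IsStationary (Pr : Measure Ω) (X : Ω → MarkedConfig d) : Prop :=
  ∀ z : Pos d, IdentDistrib (fun ω => (X ω).shift z) X Pr Pr

/-- `X'` (on the probability space `(Ω', Pr')`) is a Palm version of the marked point process `X`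
with finite, positive intensity: the refined Campbell formula holds. -/
def IsPalmVersion (Pr : Measure Ω) (X : Ω → MarkedConfig d)
    (Pr' : Measure Ω') (X' : Ω' → MarkedConfig d) : Prop :=
  AEMeasurable X Pr ∧ AEMeasurable X' Pr' ∧ ∃ lam : ℝ≥0, 0 < lam ∧
    (∀ A : Set (Pos d), MeasurableSet A →
      ∫⁻ ω, (X ω).1.toMeasure (A ×ˢ Set.Ioi 0) ∂Pr = lam * volume A) ∧
    ∀ h : Pos d × MarkedConfig d → ℝ≥0∞, Measurable h →
      ∫⁻ ω, ∑' p : (X ω).1.atoms, h (p.1.1, (X ω).shift p.1.1) ∂Pr =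
        lam * ∫⁻ t : Pos d, ∫⁻ ω, h (t, X' ω) ∂Pr'

/-- The distribution `ν` is that of a tail configuration, with respect to the scaling function `r`
of scaling index `β`, of the stationary marked point process `X` with Palm version `X'`: almost
surely there is exactly one point over the origin with score above `1`, and, conditionally on the
score of `X'` at the origin exceeding `u`, the law of `T_{r(u),u} X'` converges weakly to `ν` as
`u → ∞`, with respect to the vague topology. -/
structure IsTailConfiguration (r : ℝ → ℝ) (β : ℝ) (Pr : Measure Ω) (X : Ω → MarkedConfig d)
    (Pr' : Measure Ω') (X' : Ω' → MarkedConfig d) (ν : Measure (Config d)) : Prop where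
  scaling_pos : ∀ u, 0 < u → 0 < r u
  scaling : IsRegularlyVarying r β
  stationary : IsStationary Pr X
  palm : IsPalmVersion Pr X Pr' X'
  isProbabilityMeasure : IsProbabilityMeasure ν
  origin : ∀ᵐ μ ∂ν, μ.toMeasure ({(0 : Pos d)} ×ˢ Set.Ioi (1 : ℝ)) = 1
  tendsto : ∀ H : Config d →ᵇ ℝ,
    Tendsto (fun u : ℝ =>
        ∫ ω, H ((X' ω).1.scale (r u) u) ∂(ProbabilityTheory.cond Pr' {ω | u < (X' ω).1.score 0}))
      atTop (𝓝 (∫ μ, H μ ∂ν))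

/-- The spectral part `T_{η^β,η} μ` of a configuration `μ`, where `η = μ(0)`. -/
noncomputable def spectral (β : ℝ) (μ : Config d) : Config d :=
  μ.scale (μ.score 0 ^ β) (μ.score 0)

end Processes

/-! ### The moving maxima model -/

/-- `Φ` is a neighborhood function: measurable and shift-equivariant, and for every `t ∈ A` the set
`Φ (t, A)` is a finite subset of `A` which contains `t`. -/
structure IsNeighborhood (Φ : Pos d × PointSet d → PointSet d) : Prop where
  measurable : Measurable Φ
  finite : ∀ (A : PointSet d), ∀ t ∈ A.pts, (Φ (t, A)).pts.Finite
  subset : ∀ (A : PointSet d), ∀ t ∈ A.pts, (Φ (t, A)).pts ⊆ A.pts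
  self_mem : ∀ (A : PointSet d), ∀ t ∈ A.pts, t ∈ (Φ (t, A)).pts
  equivariant : ∀ (A : PointSet d), ∀ t ∈ A.pts, ∀ x : Pos d,
    Φ (t - x, A.shift x) = (Φ (t, A)).shift x

/-- The scoring function `ψ(t, μ) = max_{x ∈ Φ(t, μ')} w(x - t) μ(x)` (for `t ∈ μ'` the maximum is
over a finite nonempty set). -/
noncomputable def movingMaxScore (Φ : Pos d × PointSet d → PointSet d) (w : Pos d → ℝ)
    (μ : MarkedConfig d) (t : Pos d) : ℝ :=
  sSup ((fun x => w (x - t) * μ.1.score x) '' (Φ (t, μ.ground)).pts)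

/-- `Ψ(μ) = ∑_{t ∈ μ'} δ_{(t, ψ(t, μ))}`. -/
noncomputable def movingMaxima (Φ : Pos d × PointSet d → PointSet d) (w : Pos d → ℝ)
    (μ : MarkedConfig d) : MarkedConfig d :=
  ofScores μ.ground (movingMaxScore Φ w μ)

/-- The configuration `{(t, w(x - t) / w(x)) : t ∈ A, x ∈ Φ(t, A)}`, restricted to positive
scores. -/
noncomputable def spectralCluster (Φ : Pos d × PointSet d → PointSet d) (w : Pos d → ℝ)
    (A : PointSet d) (x : Pos d) : Config d :=
  (ofScores (A.sep fun t => x ∈ (Φ (t, A)).pts) fun t => w (x - t) / w x).1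

end TailConf

open TailConf

/-! ### Kernels which are finite on a countable cover -/

/-! The score at the origin is the largest of the weighted scores `w(x) P̃(x)` over the finitely
many `x` in the neighborhood of the origin. Neighborhoods depend on locations only, so once the
locations are known the scores are independent with law `m`. A large maximum is then, in the limit,
caused by a single large score. If it sits at `x`, it has to exceed `u / w(x)`, which costs the
factor `w(x)^α` by regular variation. All other scores vanish after division by `u`, and what
survives is the set of points `t` with `x ∈ Φ(t)`, with scores `w(x - t)` times the large score.

To make this precise, the event that the score at the origin exceeds `u` is split evenly among the
points responsible for it (`share`), so that a functional on this event becomes a sum over points of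
`P̃`. The Mecke equation for `P̃` (`lintegral_sum_addPoint_zero`) pulls one point `(x, s)` out of
the sum. Its score `s` is then integrated against `m`, independently of the location `x` and of the
remaining configuration `Q`, and the pair `(x, Q)` is governed by the fixed measure
`reducedCampbell`. For fixed `(x, Q)` the other scores relevant to the origin are bounded by a
constant; for `u` above it, the integrand is a bounded continuous function of `(s/u, 1/u)` on the
event `s > u / w(x)`, and `tendsto_lintegral_tail` gives the limit, with a Pareto variable `y` in
place of the rescaled score (`tendsto_lintegral_share`). Boundedness of `w` and the finite mean
number of neighbors justify dominated convergence in `(x, Q)` (`tendsto_lintegral_movingMaxima`).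

The functional `1` yields (i), and quotients yield the conditional limit. The limit law is that of a
spectral cluster multiplied by `y`. The cluster has score `1` at the origin, so the limit has score
`y` there, and passing to the spectral part removes `y` again (`spectral_limitCluster`).

Stationarity and the Palm formula follow from the Mecke equation and the equivariance of `Φ`. The
formula has to hold for every tail configuration, so the limit law has to be unique; this holds
because void probabilities determine a law and are limits of expectations of vaguely continuous
functionals (`Config.ext_of_forall_integral_eq`). Void events are also the tool for the Mecke
equation. Measurability of vaguely open sets comes from a countable network (`exists_network`). -/

lemma isSFiniteKernel_of_cover {α β : Type*} [MeasurableSpace α] [MeasurableSpace β]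
    (κ : Kernel α β) (W : ℕ → Set β) (hW : ∀ n, MeasurableSet (W n)) (hU : ⋃ n, W n = univ)
    (hfin : ∀ a n, κ a (W n) ≠ ∞) : IsSFiniteKernel κ := by
  classical
  set D := disjointed W
  have hD : ∀ n, MeasurableSet (D n) := MeasurableSet.disjointed hW
  have hDfin : ∀ a n, κ a (D n) ≠ ∞ := fun a n =>
    ne_top_of_le_ne_top (hfin a n) (measure_mono (disjointed_subset W n))
  -- The mass of a piece is finite for each `a` but not bounded in `a`. Sorting the parameters by
  -- the integer part `k` of the mass makes it at most `k + 1` on each class.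
  have hA : ∀ n k, MeasurableSet {a | ⌊(κ a (D n)).toReal⌋₊ = k} := fun n k =>
    ((κ.measurable_coe (hD n)).ennreal_toReal.nat_floor) (measurableSet_singleton k)
  let η : ℕ × ℕ → Kernel α β := fun q => Kernel.piecewise (hA q.1 q.2) (κ.restrict (hD q.1)) 0
  have hη : ∀ q, IsFiniteKernel (η q) := fun q => by
    refine ⟨⟨q.2 + 1, by finiteness, fun a => ?_⟩⟩
    simp only [η, Kernel.piecewise_apply]
    split_ifs with h
    · rw [Kernel.restrict_apply, Measure.restrict_apply_univ,
        ← ENNReal.ofReal_toReal (hDfin a q.1)]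
      have h' : ⌊(κ a (D q.1)).toReal⌋₊ = q.2 := h
      have : (κ a (D q.1)).toReal ≤ q.2 + 1 := by
        rw [← h']; exact (Nat.lt_floor_add_one _).le
      calc ENNReal.ofReal _ ≤ ENNReal.ofReal (q.2 + 1) := ENNReal.ofReal_le_ofReal this
        _ = q.2 + 1 := by
          rw [ENNReal.ofReal_add (by positivity) zero_le_one]; simp
    · simp
  have : κ = Kernel.sum η := by
    ext a s hs
    rw [Kernel.sum_apply' _ _ hs, ENNReal.tsum_prod (f := fun n k => η (n, k) a s)]
    have h1 : ∀ n, ∑' k, η (n, k) a s = κ a (s ∩ D n) := by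
      intro n
      rw [tsum_eq_single ⌊(κ a (D n)).toReal⌋₊]
      · simp [η, Kernel.piecewise_apply, Kernel.restrict_apply, Measure.restrict_apply hs]
      · intro k hk
        have : ¬ ⌊(κ a (D n)).toReal⌋₊ = k := fun h => hk h.symm
        simp [η, Kernel.piecewise_apply, this]
    simp_rw [h1]
    rw [← measure_iUnion, ← inter_iUnion, iUnion_disjointed, hU, inter_univ]
    · exact fun i j hij => ((disjoint_disjointed W hij).mono inter_subset_right inter_subset_right)
    · exact fun n => hs.inter (hD n)
  rw [this]
  infer_instance

/-! ### Counting measures -/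

namespace TailConf

variable {d : ℕ}

/-- An increasing sequence of open sets on which all configurations are finite. -/
def window (d n : ℕ) : Set (Pos d × ℝ) := {p | ‖p.1‖ < n + 1 ∧ 1 / ((n : ℝ) + 1) < p.2}

lemma isOpen_window (n : ℕ) : IsOpen (window d n) :=
  IsOpen.inter (isOpen_lt (f := fun p : Pos d × ℝ => ‖p.1‖) (by fun_prop) (by fun_prop))
    (isOpen_lt (g := fun p : Pos d × ℝ => p.2) (by fun_prop) (by fun_prop))

lemma window_mono : Monotone (window d) := by
  intro m n h p hp
  have : (m : ℝ) ≤ n := by exact_mod_cast h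
  exact ⟨hp.1.trans_le (by linarith),
    (one_div_le_one_div_of_le (by positivity) (by linarith)).trans_lt hp.2⟩

lemma exists_subset_window (R ε : ℝ) (hε : 0 < ε) :
    ∃ n, {p : Pos d × ℝ | ‖p.1‖ ≤ R ∧ ε < p.2} ⊆ window d n := by
  obtain ⟨n, hn⟩ := exists_nat_gt (max R (1 / ε))
  refine ⟨n, fun p hp => ⟨?_, ?_⟩⟩
  · have := (le_max_left R (1 / ε)).trans_lt hn
    linarith [hp.1]
  · have := (le_max_right R (1 / ε)).trans_lt hn
    have h2 : 1 / ((n : ℝ) + 1) ≤ ε := by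
      rw [div_le_iff₀ (by positivity)]
      rw [div_lt_iff₀ hε] at this
      nlinarith
    exact h2.trans_lt hp.2

lemma exists_mem_window (p : Pos d × ℝ) (hp : 0 < p.2) : ∃ n, p ∈ window d n := by
  obtain ⟨n, hn⟩ := exists_subset_window (d := d) ‖p.1‖ (p.2 / 2) (by positivity)
  exact ⟨n, hn ⟨le_rfl, by linarith⟩⟩

lemma pos_of_mem_window {n : ℕ} {p : Pos d × ℝ} (hp : p ∈ window d n) : 0 < p.2 :=
  lt_trans (by positivity) hp.2

/-- A countable cover by sets on which all configurations are finite. -/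
def cover (d n : ℕ) : Set (Pos d × ℝ) := window d n ∪ {p | p.2 ≤ 0}

lemma measurableSet_cover (n : ℕ) : MeasurableSet (cover d n) :=
  (isOpen_window n).measurableSet.union (measurableSet_le (by fun_prop) (by fun_prop))

lemma iUnion_cover : ⋃ n, cover d n = univ := by
  refine eq_univ_of_forall fun p => mem_iUnion.2 ?_
  rcases le_or_gt p.2 0 with h | h
  · exact ⟨0, Or.inr h⟩
  · obtain ⟨n, hn⟩ := exists_mem_window p h
    exact ⟨n, Or.inl hn⟩

lemma Config.lintegral_toMeasure (μ : Config d) (f : Pos d × ℝ → ℝ≥0∞) :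
    ∫⁻ p, f p ∂μ.toMeasure = ∑' p : μ.atoms, f p := by
  simp [Config.toMeasure, lintegral_sum_measure]

lemma PointSet.lintegral_toMeasure (A : PointSet d) (f : Pos d → ℝ≥0∞) :
    ∫⁻ p, f p ∂A.toMeasure = ∑' p : A.pts, f p := by
  simp [PointSet.toMeasure, lintegral_sum_measure]

lemma Config.toMeasure_apply (μ : Config d) {B : Set (Pos d × ℝ)} (hB : MeasurableSet B) :
    μ.toMeasure B = (μ.atoms ∩ B).encard := by
  rw [← lintegral_indicator_one hB, μ.lintegral_toMeasure, ← ENNReal.tsum_set_one,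
    tsum_subtype (μ.atoms ∩ B) (fun _ => 1),
    tsum_subtype μ.atoms (B.indicator 1)]
  refine tsum_congr fun p => ?_
  rw [inter_comm, ← indicator_indicator]
  by_cases h : p ∈ μ.atoms <;> by_cases h' : p ∈ B <;> simp [h, h']

lemma PointSet.toMeasure_apply (A : PointSet d) {B : Set (Pos d)} (hB : MeasurableSet B) :
    A.toMeasure B = (A.pts ∩ B).encard := by
  rw [← lintegral_indicator_one hB, A.lintegral_toMeasure, ← ENNReal.tsum_set_one,
    tsum_subtype (A.pts ∩ B) (fun _ => 1),
    tsum_subtype A.pts (B.indicator 1)]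
  refine tsum_congr fun p => ?_
  rw [inter_comm, ← indicator_indicator]
  by_cases h : p ∈ A.pts <;> by_cases h' : p ∈ B <;> simp [h, h']

lemma Config.toMeasure_eq_zero (μ : Config d) {B : Set (Pos d × ℝ)} (hB : MeasurableSet B) :
    μ.toMeasure B = 0 ↔ ∀ p ∈ μ.atoms, p ∉ B := by
  rw [μ.toMeasure_apply hB]
  simp only [ENat.toENNReal_eq_zero, encard_eq_zero, eq_empty_iff_forall_notMem, mem_inter_iff,
    not_and]

lemma Config.finite_window (μ : Config d) (n : ℕ) : (μ.atoms ∩ window d n).Finite :=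
  (μ.finite_bdd (n + 1) (1 / (n + 1)) (by positivity)).subset
    fun _ hp => ⟨hp.1, hp.2.1.le, hp.2.2⟩

lemma Config.toMeasure_cover (μ : Config d) (n : ℕ) : μ.toMeasure (cover d n) ≠ ∞ := by
  rw [μ.toMeasure_apply (measurableSet_cover n)]
  simp only [ne_eq, ENat.toENNReal_eq_top, encard_eq_top_iff, not_infinite]
  refine (μ.finite_window n).subset fun p hp => ⟨hp.1, hp.2.resolve_right ?_⟩
  exact not_le.2 (μ.pos p hp.1)

lemma Config.measurable_toMeasure : Measurable (Config.toMeasure (d := d)) :=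
  comap_measurable _

lemma PointSet.measurable_toMeasure : Measurable (PointSet.toMeasure (d := d)) :=
  comap_measurable _

lemma measurable_config_iff {α : Type*} [MeasurableSpace α] {f : α → Config d} :
    Measurable f ↔ ∀ B, MeasurableSet B → Measurable fun a => (f a).toMeasure B := by
  rw [measurable_comap_iff, Measure.measurable_measure]; rfl

lemma measurable_pointSet_iff {α : Type*} [MeasurableSpace α] {f : α → PointSet d} :
    Measurable f ↔ ∀ B, MeasurableSet B → Measurable fun a => (f a).toMeasure B := by
  rw [measurable_comap_iff, Measure.measurable_measure]; rfl

lemma measurable_markedConfig_iff {α : Type*} [MeasurableSpace α] {f : α → MarkedConfig d} :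
    Measurable f ↔ ∀ B, MeasurableSet B → Measurable fun a => (f a).1.toMeasure B := by
  rw [← measurable_config_iff]
  exact ⟨fun h => measurable_subtype_coe.comp h, fun h => h.subtype_mk⟩

/-- The counting measures of configurations as a kernel. -/
noncomputable def atomKernel (d : ℕ) : Kernel (Config d) (Pos d × ℝ) :=
  ⟨Config.toMeasure, Config.measurable_toMeasure⟩

/-- The counting measures of point sets as a kernel. -/
noncomputable def ptsKernel (d : ℕ) : Kernel (PointSet d) (Pos d) :=
  ⟨PointSet.toMeasure, PointSet.measurable_toMeasure⟩

instance : IsSFiniteKernel (atomKernel d) :=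
  isSFiniteKernel_of_cover _ (cover d) measurableSet_cover iUnion_cover
    fun μ n => μ.toMeasure_cover n

instance : IsSFiniteKernel (ptsKernel d) := by
  refine isSFiniteKernel_of_cover _ (fun n : ℕ => Metric.closedBall 0 n)
    (fun n => measurableSet_closedBall) (Metric.iUnion_closedBall_nat 0) fun A n => ?_
  change A.toMeasure _ ≠ ∞
  rw [A.toMeasure_apply measurableSet_closedBall]
  simp only [ne_eq, ENat.toENNReal_eq_top, encard_eq_top_iff, not_infinite]
  exact (A.finite_bdd n).subset fun t ht => ⟨ht.1, by simpa using ht.2⟩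

instance (μ : Config d) : SFinite μ.toMeasure :=
  inferInstanceAs (SFinite (atomKernel d μ))

lemma measurable_lintegral_config {α : Type*} [MeasurableSpace α] {f : α → Pos d × ℝ → ℝ≥0∞}
    (hf : Measurable (Function.uncurry f)) {g : α → Config d} (hg : Measurable g) :
    Measurable fun a => ∫⁻ p, f a p ∂(g a).toMeasure :=
  Measurable.lintegral_kernel_prod_right (κ := (atomKernel d).comap g hg) hf

lemma measurable_lintegral_pointSet {α : Type*} [MeasurableSpace α] {f : α → Pos d → ℝ≥0∞}
    (hf : Measurable (Function.uncurry f)) {g : α → PointSet d} (hg : Measurable g) :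
    Measurable fun a => ∫⁻ p, f a p ∂(g a).toMeasure :=
  Measurable.lintegral_kernel_prod_right (κ := (ptsKernel d).comap g hg) hf

lemma Config.lintegral_eq_zero (μ : Config d) (f : Pos d × ℝ → ℝ≥0∞) :
    ∫⁻ p, f p ∂μ.toMeasure = 0 ↔ ∀ p ∈ μ.atoms, f p = 0 := by
  rw [μ.lintegral_toMeasure, ENNReal.tsum_eq_zero]
  simp

lemma PointSet.lintegral_eq_zero (μ : PointSet d) (f : Pos d → ℝ≥0∞) :
    ∫⁻ p, f p ∂μ.toMeasure = 0 ↔ ∀ p ∈ μ.pts, f p = 0 := by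
  rw [μ.lintegral_toMeasure, ENNReal.tsum_eq_zero]
  simp

/-- `{a | ∃ p ∈ g a, (a, p) ∈ E}` is measurable. -/
lemma measurableSet_exists_atom {α : Type*} [MeasurableSpace α] {E : Set (α × (Pos d × ℝ))}
    (hE : MeasurableSet E) {g : α → Config d} (hg : Measurable g) :
    MeasurableSet {a | ∃ p ∈ (g a).atoms, (a, p) ∈ E} := by
  -- Existence of an atom in the section of `E` means that the number of such atoms is nonzero. This
  -- number is an integral against an s-finite kernel, hence measurable, and no projection theorem
  -- is needed.
  have h := measurable_lintegral_config (f := fun a p => E.indicator 1 (a, p))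
    (measurable_one.indicator hE) hg (measurableSet_singleton 0).compl
  convert h using 1
  ext a
  simp [Config.lintegral_eq_zero]

lemma measurableSet_exists_pt {α : Type*} [MeasurableSpace α] {E : Set (α × Pos d)}
    (hE : MeasurableSet E) {g : α → PointSet d} (hg : Measurable g) :
    MeasurableSet {a | ∃ p ∈ (g a).pts, (a, p) ∈ E} := by
  have h := measurable_lintegral_pointSet (f := fun a p => E.indicator 1 (a, p))
    (measurable_one.indicator hE) hg (measurableSet_singleton 0).compl
  convert h using 1
  ext a
  simp [PointSet.lintegral_eq_zero]

lemma measurableSet_mem_pts {α : Type*} [MeasurableSpace α] {x : α → Pos d} (hx : Measurable x)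
    {g : α → PointSet d} (hg : Measurable g) : MeasurableSet {a | x a ∈ (g a).pts} := by
  convert measurableSet_exists_pt (E := {q | q.2 = x q.1})
    (measurableSet_eq_fun (by fun_prop) (by fun_prop)) hg using 1
  ext a
  simp

end TailConf

namespace TailConf

variable {d : ℕ}

/-! ### Void events determine the law of a configuration -/

open TopologicalSpace in
lemma nonempty_countableBasis (X : Type*) [TopologicalSpace X] [SecondCountableTopology X]
    [Nonempty X] : Nonempty (countableBasis X) := by
  obtain ⟨s, hs, -⟩ := (isBasis_countableBasis X).exists_subset_of_mem_open
    (mem_univ (Classical.arbitrary X)) isOpen_univ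
  exact ⟨⟨s, hs⟩⟩

open TopologicalSpace in
-- Atoms are distinct points of a Hausdorff space, so `k` of them can be enclosed in disjoint basic
-- open subsets of `U`. There are only countably many finite families of basic sets, hence the
-- counts of an open set are obtained from void events by countable operations.
lemma Config.natCast_le_toMeasure_iff (μ : Config d) {U : Set (Pos d × ℝ)} (hU : IsOpen U) (k : ℕ) :
    (k : ℝ≥0∞) ≤ μ.toMeasure U ↔ ∃ t : Finset (countableBasis (Pos d × ℝ)),
      (t.card = k ∧ (t : Set (countableBasis (Pos d × ℝ))).PairwiseDisjoint Subtype.val ∧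
        ∀ s ∈ t, (s : Set (Pos d × ℝ)) ⊆ U) ∧ ∀ s ∈ t, μ.toMeasure s ≠ 0 := by
  classical
  have hbo : ∀ s : countableBasis (Pos d × ℝ), IsOpen (s : Set (Pos d × ℝ)) :=
    fun s => isOpen_of_mem_countableBasis s.2
  rw [μ.toMeasure_apply hU.measurableSet]
  constructor
  · intro h
    have h' : (k : ℕ∞) ≤ (μ.atoms ∩ U).encard := by exact_mod_cast h
    obtain ⟨S, hS, hSk⟩ := exists_subset_encard_eq h'
    have hSf : S.Finite := finite_of_encard_eq_coe hSk
    obtain ⟨O, hO, hdisj⟩ := hSf.t2_separation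
    have hb : ∀ p : Pos d × ℝ, ∃ s : countableBasis (Pos d × ℝ), p ∈ S →
        p ∈ (s : Set (Pos d × ℝ)) ∧ (s : Set (Pos d × ℝ)) ⊆ O p ∩ U := by
      intro p
      by_cases hp : p ∈ S
      · obtain ⟨s, hs, hps, hsO⟩ := (isBasis_countableBasis (Pos d × ℝ)).exists_subset_of_mem_open
          (show p ∈ O p ∩ U from ⟨(hO p).1, (hS hp).2⟩) ((hO p).2.inter hU)
        exact ⟨⟨s, hs⟩, fun _ => ⟨hps, hsO⟩⟩
      · exact ⟨(nonempty_countableBasis _).some, fun h => absurd h hp⟩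
    choose b hb using hb
    have hinj : InjOn b (hSf.toFinset : Set (Pos d × ℝ)) := by
      intro p hp q hq hpq
      simp only [Finite.coe_toFinset] at hp hq
      by_contra hne
      exact disjoint_left.1 (hdisj hp hq hne) ((hb p hp).2 (hb p hp).1).1
        ((hb q hq).2 (hpq ▸ (hb p hp).1)).1
    refine ⟨hSf.toFinset.image b, ⟨?_, ?_, ?_⟩, ?_⟩
    · rw [Finset.card_image_of_injOn hinj]
      have := encard_coe_eq_coe_finsetCard hSf.toFinset
      rw [Finite.coe_toFinset, hSk] at this
      exact_mod_cast this.symm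
    · intro s hs r hr hsr
      simp only [Finset.coe_image, Finite.coe_toFinset, mem_image] at hs hr
      obtain ⟨p, hp, rfl⟩ := hs
      obtain ⟨q, hq, rfl⟩ := hr
      exact (hdisj hp hq fun h => hsr (by rw [h])).mono
        ((hb p hp).2.trans inter_subset_left) ((hb q hq).2.trans inter_subset_left)
    · intro s hs
      simp only [Finset.mem_image, Finite.mem_toFinset] at hs
      obtain ⟨p, hp, rfl⟩ := hs
      exact (hb p hp).2.trans inter_subset_right
    · intro s hs
      simp only [Finset.mem_image, Finite.mem_toFinset] at hs
      obtain ⟨p, hp, rfl⟩ := hs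
      rw [ne_eq, μ.toMeasure_eq_zero (hbo _).measurableSet]
      push Not
      exact ⟨p, (hS hp).1, (hb p hp).1⟩
  · rintro ⟨t, ⟨rfl, hdisj, hsub⟩, hne⟩
    have : ∀ s : countableBasis (Pos d × ℝ), ∃ p, s ∈ t → p ∈ μ.atoms ∧ p ∈ (s : Set (Pos d × ℝ)) := by
      intro s
      by_cases hs : s ∈ t
      · have := hne s hs
        rw [ne_eq, μ.toMeasure_eq_zero (hbo _).measurableSet] at this
        push Not at this
        obtain ⟨p, hp⟩ := this
        exact ⟨p, fun _ => hp⟩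
      · exact ⟨0, fun h => absurd h hs⟩
    choose p hp using this
    have hinj : InjOn p (t : Set (countableBasis (Pos d × ℝ))) := by
      intro s hs r hr h
      by_contra hne
      exact disjoint_left.1 (hdisj hs hr hne) (hp s hs).2 (h ▸ (hp r hr).2)
    have h1 : (p '' (t : Set (countableBasis (Pos d × ℝ)))).encard ≤ (μ.atoms ∩ U).encard := by
      refine encard_le_encard ?_
      rintro _ ⟨s, hs, rfl⟩
      exact ⟨(hp s hs).1, hsub s hs (hp s hs).2⟩
    rw [hinj.encard_image, encard_coe_eq_coe_finsetCard] at h1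
    exact_mod_cast h1

open TopologicalSpace in
/-- Measurability of a random configuration can be tested on void events. -/
lemma measurable_of_void {α : Type*} [MeasurableSpace α] {f : α → Config d}
    (h : ∀ U, IsOpen U → (∃ n, U ⊆ window d n) → MeasurableSet {a | (f a).toMeasure U = 0}) :
    Measurable f := by
  have hopen : ∀ U, IsOpen U → (∃ n, U ⊆ window d n) →
      Measurable fun a => (f a).toMeasure U := by
    intro U hU hn
    have hk : ∀ k : ℕ, MeasurableSet {a | (k : ℝ≥0∞) ≤ (f a).toMeasure U} := by
      intro k
      simp_rw [Config.natCast_le_toMeasure_iff _ hU, ofPred_exists]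
      refine MeasurableSet.iUnion fun t => ?_
      by_cases ht : t.card = k ∧ (t : Set (countableBasis (Pos d × ℝ))).PairwiseDisjoint
          Subtype.val ∧ ∀ s ∈ t, (s : Set (Pos d × ℝ)) ⊆ U
      · have : {a | (t.card = k ∧ (t : Set (countableBasis (Pos d × ℝ))).PairwiseDisjoint
            Subtype.val ∧ ∀ s ∈ t, (s : Set (Pos d × ℝ)) ⊆ U) ∧
            ∀ s ∈ t, (f a).toMeasure s ≠ 0} = ⋂ s ∈ t, {a | (f a).toMeasure s = 0}ᶜ := by
          ext a
          simpa only [mem_iInter, mem_compl_iff, mem_ofPred_eq, ne_eq] using and_iff_right ht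
        rw [this]
        refine MeasurableSet.biInter t.countable_toSet fun s hs => ?_
        exact (h s (isOpen_of_mem_countableBasis s.2)
          (hn.imp fun n hn => (ht.2.2 s hs).trans hn)).compl
      · simp only [ht, false_and]
        exact MeasurableSet.const _
    -- Counts in `U` are finite since `U` lies in a window. The level `∞` is therefore never
    -- reached, and a finite level `c` may be replaced by the integer `⌈c⌉₊`.
    refine measurable_of_Ici fun c => ?_
    obtain ⟨n, hn⟩ := hn
    have hfin : ∀ a, (f a).toMeasure U ≠ ∞ := fun a =>
      ne_top_of_le_ne_top ((f a).toMeasure_cover n) (measure_mono (hn.trans subset_union_left))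
    induction c with
    | top =>
      convert MeasurableSet.empty
      ext a
      simpa using hfin a
    | coe c =>
      convert hk ⌈c⌉₊ using 1
      ext a
      have : ∃ j : ℕ, (f a).toMeasure U = j := by
        have h1 := hfin a
        rw [(f a).toMeasure_apply hU.measurableSet] at h1 ⊢
        rw [ne_eq, ENat.toENNReal_eq_top] at h1
        obtain ⟨j, hj⟩ := ENat.ne_top_iff_exists.1 h1
        exact ⟨j, by rw [← hj, ENat.toENNReal_coe]⟩
      obtain ⟨j, hj⟩ := this
      simp only [mem_preimage, mem_Ici, mem_ofPred_eq, hj, Nat.cast_le, Nat.ceil_le]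
      exact_mod_cast Iff.rfl
  -- Restriction to a window produces finite measures, for which the π-system of open sets suffices.
  have hrest : ∀ n, Measurable fun a => (f a).toMeasure.restrict (window d n) := by
    intro n
    have : ∀ a, IsFiniteMeasure ((f a).toMeasure.restrict (window d n)) := fun a =>
      ⟨by
        rw [Measure.restrict_apply_univ]
        exact (ne_top_of_le_ne_top ((f a).toMeasure_cover n)
          (measure_mono subset_union_left)).lt_top⟩
    refine Measurable.measure_of_isPiSystem (BorelSpace.measurable_eq (α := Pos d × ℝ))
      isPiSystem_isOpen (fun U (hU : IsOpen U) => ?_) ?_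
    · simp_rw [Measure.restrict_apply hU.measurableSet]
      exact hopen _ (hU.inter (isOpen_window n)) ⟨n, inter_subset_right⟩
    · simp only [Measure.restrict_apply_univ]
      exact hopen _ (isOpen_window n) ⟨n, subset_rfl⟩
  rw [measurable_config_iff]
  intro B hB
  -- Atoms have positive scores, so every atom lies in some window and nothing is lost in the
  -- supremum.
  have : ∀ a, (f a).toMeasure B = ⨆ n, (f a).toMeasure.restrict (window d n) B := by
    intro a
    have hmono : Monotone fun n => B ∩ window d n :=
      fun m n h => inter_subset_inter_right _ (window_mono h)
    simp_rw [Measure.restrict_apply hB]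
    rw [← hmono.measure_iUnion, ← inter_iUnion, (f a).toMeasure_apply hB, (f a).toMeasure_apply
      (hB.inter (MeasurableSet.iUnion fun n => (isOpen_window n).measurableSet))]
    congr 2
    ext p
    constructor
    · exact fun hp => ⟨hp.1, hp.2, mem_iUnion.2 (exists_mem_window p ((f a).pos p hp.1))⟩
    · exact fun hp => ⟨hp.1, hp.2.1⟩
  simp_rw [this]
  exact Measurable.iSup fun n => (Measure.measurable_measure.1 (hrest n)) B hB

/-- The void events of small open sets. -/
def voidEvents (d : ℕ) : Set (Set (Config d)) :=
  {V | ∃ U, IsOpen U ∧ (∃ n, U ⊆ window d n) ∧ V = {μ | μ.toMeasure U = 0}}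

lemma isPiSystem_voidEvents : IsPiSystem (voidEvents d) := by
  rintro _ ⟨U, hU, ⟨n, hn⟩, rfl⟩ _ ⟨U', hU', ⟨n', hn'⟩, rfl⟩ _
  refine ⟨U ∪ U', hU.union hU', ⟨max n n', union_subset (hn.trans (window_mono (le_max_left _ _)))
    (hn'.trans (window_mono (le_max_right _ _)))⟩, ?_⟩
  ext μ
  simp [measure_union_null_iff]

/-- For the nontrivial inclusion, `measurable_of_void` is applied to the identity map whose source
carries the σ-algebra generated by the void events. -/
lemma generateFrom_voidEvents :
    MeasurableSpace.generateFrom (voidEvents d) = (inferInstance : MeasurableSpace (Config d)) := by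
  apply le_antisymm
  · refine MeasurableSpace.generateFrom_le ?_
    rintro _ ⟨U, hU, -, rfl⟩
    exact (measurable_config_iff.1 measurable_id U hU.measurableSet) (measurableSet_singleton 0)
  · have : @Measurable _ _ (MeasurableSpace.generateFrom (voidEvents d)) _ (id : Config d → _) :=
      @measurable_of_void d (Config d) (MeasurableSpace.generateFrom (voidEvents d)) id
        fun U hU hn => MeasurableSpace.measurableSet_generateFrom ⟨U, hU, hn, rfl⟩
    rwa [measurable_iff_comap_le, MeasurableSpace.comap_id] at this

lemma univ_mem_voidEvents : univ ∈ voidEvents d :=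
  ⟨∅, isOpen_empty, ⟨0, empty_subset _⟩, by simp⟩

/-! ### The vague topology -/

lemma Config.tsum_eq_sum (ν : Config d) {ι : Type*} (S : Finset ι) (q : ι → Pos d × ℝ)
    (hq : ∀ p ∈ S, q p ∈ ν.atoms) (hinj : InjOn q S) (f : Pos d × ℝ → ℝ)
    (hf : ∀ r ∈ ν.atoms, f r ≠ 0 → ∃ p ∈ S, q p = r) :
    ∑' r : ν.atoms, f r = ∑ p ∈ S, f (q p) := by
  let g : S → ν.atoms := fun p => ⟨q p, hq p p.2⟩
  have hg : Function.Injective g := fun p p' h =>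
    Subtype.ext (hinj p.2 p'.2 (congrArg Subtype.val h))
  have hsupp : Function.support (fun r : ν.atoms => f r) ⊆ range g := by
    intro r hr
    obtain ⟨p, hp, hpr⟩ := hf r r.2 hr
    exact ⟨⟨p, hp⟩, Subtype.ext hpr⟩
  rw [← hg.tsum_eq hsupp, tsum_fintype]
  exact Finset.sum_coe_sort S fun p => f (q p)

lemma tendsto_config_iff {ι : Type*} {l : Filter ι} {F : ι → Config d} {μ : Config d} :
    Tendsto F l (𝓝 μ) ↔ ∀ f, IsTestFunction f →
      Tendsto (fun i => ∑' p : (F i).atoms, f p.1) l (𝓝 (∑' p : μ.atoms, f p.1)) := by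
  rw [nhds_iInf, tendsto_iInf]
  simp only [nhds_induced, tendsto_comap_iff, Subtype.forall]
  rfl

lemma continuous_tsum_atoms {f : Pos d × ℝ → ℝ} (hf : IsTestFunction f) :
    Continuous fun μ : Config d => ∑' p : μ.atoms, f p :=
  continuous_iff_continuousAt.2 fun _ => tendsto_config_iff.1 tendsto_id f hf

/-- For fixed locations, configurations depend continuously on the scores. -/
lemma tendsto_ofScores {ι : Type*} {l : Filter ι} (A : PointSet d) {g : ι → Pos d → ℝ}
    {g₀ : Pos d → ℝ} (h : ∀ t ∈ A.pts, Tendsto (fun i => g i t) l (𝓝 (g₀ t))) :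
    Tendsto (fun i => (ofScores A (g i)).1) l (𝓝 (ofScores A g₀).1) := by
  rw [tendsto_config_iff]
  rintro f ⟨hfc, -, R, ε, hε, hf⟩
  have hsum : ∀ k : Pos d → ℝ, ∑' p : (ofScores A k).1.atoms, f p =
      ∑ t ∈ (A.finite_bdd R).toFinset with 0 < k t, f (t, k t) := by
    intro k
    refine Config.tsum_eq_sum _ _ (fun t => (t, k t)) ?_ ?_ f ?_
    · intro t ht
      simp only [Finset.mem_filter, Finite.mem_toFinset] at ht
      exact ⟨ht.1.1, rfl, ht.2⟩
    · exact fun t _ t' _ h => congrArg Prod.fst h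
    · rintro ⟨t, s⟩ ⟨ht, hs, hpos⟩ hne
      simp only at ht hs hpos
      subst hs
      exact ⟨t, by simpa using ⟨⟨ht, (hf _ hne).1⟩, hpos⟩, rfl⟩
  -- A test function vanishes at scores below `ε`, so points with nonpositive score may be kept. The
  -- index set no longer depends on `k`, although atoms disappear when their score tends to `0`.
  have hsum' : ∀ k : Pos d → ℝ, ∑' p : (ofScores A k).1.atoms, f p =
      ∑ t ∈ (A.finite_bdd R).toFinset, f (t, k t) := by
    intro k
    rw [hsum, Finset.sum_filter_of_ne]
    intro t _ hne
    exact hε.trans (hf _ hne).2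
  simp_rw [hsum']
  refine tendsto_finsetSum _ fun t ht => ?_
  simp only [Finite.mem_toFinset] at ht
  exact (hfc.tendsto _).comp (tendsto_const_nhds.prodMk_nhds (h t ht.1))

open TopologicalSpace in
/-- A countable network for the vague topology. -/
def network (n : ℕ) (F : Finset (countableBasis (Pos d × ℝ))) : Set (Config d) :=
  {ν | (∀ b ∈ F, ν.toMeasure b = 1) ∧ ν.toMeasure (window d n \ ⋃ b ∈ F, (b : Set _)) = 0}

open TopologicalSpace in
lemma measurableSet_network (n : ℕ) (F : Finset (countableBasis (Pos d × ℝ))) :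
    MeasurableSet (network n F) := by
  have hb : ∀ s : countableBasis (Pos d × ℝ), MeasurableSet (s : Set (Pos d × ℝ)) :=
    fun s => (isOpen_of_mem_countableBasis s.2).measurableSet
  have hm := measurable_config_iff.1 (measurable_id (α := Config d))
  refine MeasurableSet.inter ?_ ?_
  · have : {ν : Config d | ∀ b ∈ F, ν.toMeasure b = 1} =
        ⋂ b ∈ F, {ν | ν.toMeasure b = 1} := by ext; simp
    change MeasurableSet {ν : Config d | ∀ b ∈ F, ν.toMeasure b = 1}
    rw [this]
    exact MeasurableSet.biInter F.countable_toSet fun s _ =>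
      hm _ (hb s) (measurableSet_singleton 1)
  · exact hm _ ((isOpen_window n).measurableSet.diff
      (Finset.measurableSet_biUnion F fun s _ => hb s)) (measurableSet_singleton 0)

open TopologicalSpace in
-- The sets `network n F` need not be open, but they are measurable and countably many, which is
-- enough for open sets to be measurable. A vague neighborhood is controlled by finitely many test
-- functions, all supported in one window. There `μ` has finitely many atoms, and it suffices to
-- prescribe one atom in a small basic set around each of them and none elsewhere in the window.
lemma exists_network {V : Set (Config d)} {μ : Config d} (hV : V ∈ 𝓝 μ) :
    ∃ n F, μ ∈ network n F ∧ network n F ⊆ V := by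
  classical
  rw [nhds_iInf, mem_iInf] at hV
  obtain ⟨I, hI, W, hW, rfl⟩ := hV
  have hWε : ∀ f : I, ∃ ε > 0, ∀ ν : Config d,
      |∑' p : ν.atoms, f.1.1 p - ∑' p : μ.atoms, f.1.1 p| < ε → ν ∈ W f := by
    intro f
    have := hW f
    rw [nhds_induced, mem_comap] at this
    obtain ⟨O, hO, hOW⟩ := this
    obtain ⟨ε, hε, hεO⟩ := Metric.mem_nhds_iff.1 hO
    exact ⟨ε, hε, fun ν hν => hOW (hεO (by simpa [Real.dist_eq] using hν))⟩
  choose ε hε hWε using hWε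
  have : Finite I := hI
  have := Fintype.ofFinite I
  have hn : ∀ f : I, ∃ n, ∀ p, f.1.1 p ≠ 0 → p ∈ window d n := by
    rintro ⟨⟨f, -, -, R, δ, hδ, hf⟩, -⟩
    obtain ⟨n, hn⟩ := exists_subset_window (d := d) R δ hδ
    exact ⟨n, fun p hp => hn (hf p hp)⟩
  choose N hN using hn
  set n := Finset.univ.sup N with hndef
  have hn : ∀ f : I, ∀ p, f.1.1 p ≠ 0 → p ∈ window d n := fun f p hp =>
    window_mono (Finset.le_sup (Finset.mem_univ f)) (hN f p hp)
  set S := (μ.finite_window n).toFinset with hS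
  have hSmem : ∀ p, p ∈ S ↔ p ∈ μ.atoms ∧ p ∈ window d n := by simp [hS]
  obtain ⟨O, hO, hdisj⟩ := S.finite_toSet.t2_separation
  -- The basic set around `p` is so small that each test function varies there by less than its
  -- share of the tolerance `ε f`. The `+ 1` covers the case of no atoms and makes the final
  -- inequality strict.
  have hb : ∀ p : Pos d × ℝ, ∃ s : countableBasis (Pos d × ℝ), p ∈ S →
      p ∈ (s : Set (Pos d × ℝ)) ∧ (s : Set (Pos d × ℝ)) ⊆ O p ∩ window d n ∧
      ∀ f : I, ∀ q ∈ (s : Set (Pos d × ℝ)), |f.1.1 q - f.1.1 p| < ε f / (S.card + 1) := by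
    intro p
    by_cases hp : p ∈ S
    · have hmem : O p ∩ window d n ∩ ⋂ f : I, {q | |f.1.1 q - f.1.1 p| < ε f / (S.card + 1)} ∈ 𝓝 p := by
        refine inter_mem (((hO p).2.inter (isOpen_window n)).mem_nhds
          ⟨(hO p).1, ((hSmem p).1 hp).2⟩) (iInter_mem.2 fun f => ?_)
        refine (isOpen_lt ?_ continuous_const).mem_nhds ?_
        · have := f.1.2.1
          fun_prop
        · have := hε f
          simp only [mem_ofPred_eq, sub_self, abs_zero]
          positivity
      obtain ⟨s, hs, hps, hsO⟩ := (isBasis_countableBasis (Pos d × ℝ)).mem_nhds_iff.1 hmem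
      refine ⟨⟨s, hs⟩, fun _ => ⟨hps, hsO.trans inter_subset_left, fun f q hq => ?_⟩⟩
      exact mem_iInter.1 (hsO hq).2 f
    · exact ⟨(nonempty_countableBasis _).some, fun h => absurd h hp⟩
  choose b hb using hb
  have hbm : ∀ s : countableBasis (Pos d × ℝ), MeasurableSet (s : Set (Pos d × ℝ)) :=
    fun s => (isOpen_of_mem_countableBasis s.2).measurableSet
  have hone : ∀ (ν : Config d) (p), ν.toMeasure (b p) = 1 ↔ ∃ q, ν.atoms ∩ b p = {q} := by
    intro ν p
    rw [ν.toMeasure_apply (hbm _), ← encard_eq_one, ← ENat.toENNReal_one, ENat.toENNReal_inj]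
  have hzero : ∀ ν : Config d, ν.toMeasure (window d n \ ⋃ s ∈ S.image b, (s : Set _)) = 0 ↔
      ∀ r ∈ ν.atoms, r ∈ window d n → ∃ p ∈ S, r ∈ (b p : Set (Pos d × ℝ)) := by
    intro ν
    rw [ν.toMeasure_eq_zero ((isOpen_window n).measurableSet.diff
      (Finset.measurableSet_biUnion _ fun s _ => hbm s))]
    simp only [Set.mem_sdiff, mem_iUnion, Finset.mem_image, not_and, not_not, exists_prop]
    refine forall₃_congr fun r _ _ => ⟨?_, ?_⟩
    · rintro ⟨_, ⟨p, hp, rfl⟩, h⟩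
      exact ⟨p, hp, h⟩
    · rintro ⟨p, hp, h⟩
      exact ⟨_, ⟨p, hp, rfl⟩, h⟩
  refine ⟨n, S.image b, ⟨?_, ?_⟩, ?_⟩
  · intro s hs
    obtain ⟨p, hp, rfl⟩ := Finset.mem_image.1 hs
    refine (hone μ p).2 ⟨p, ?_⟩
    ext r
    simp only [mem_inter_iff, mem_singleton_iff]
    refine ⟨?_, ?_⟩
    · rintro ⟨hr, hrb⟩
      by_contra hne
      have hbp := (hb p hp).2.1 hrb
      exact disjoint_left.1 (hdisj ((hSmem r).2 ⟨hr, hbp.2⟩) hp hne) (hO r).1 hbp.1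
    · rintro rfl
      exact ⟨((hSmem r).1 hp).1, (hb r hp).1⟩
  · rw [hzero]
    exact fun r hr hrn => ⟨r, (hSmem r).2 ⟨hr, hrn⟩, (hb r ((hSmem r).2 ⟨hr, hrn⟩)).1⟩
  · rintro ν ⟨hν1, hν0⟩
    rw [hzero] at hν0
    refine mem_iInter.2 fun f => hWε f ν ?_
    have hq : ∀ p, ∃ q, p ∈ S → ν.atoms ∩ b p = {q} := by
      intro p
      by_cases hp : p ∈ S
      · obtain ⟨q, hq⟩ := (hone ν p).1 (hν1 _ (Finset.mem_image_of_mem b hp))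
        exact ⟨q, fun _ => hq⟩
      · exact ⟨p, fun h => absurd h hp⟩
    choose q hq using hq
    have hqm : ∀ p ∈ S, q p ∈ ν.atoms ∩ b p := fun p hp => by rw [hq p hp]; rfl
    rw [ν.tsum_eq_sum S q (fun p hp => (hqm p hp).1) ?_ f.1.1 ?_,
      μ.tsum_eq_sum S id (fun p hp => ((hSmem p).1 hp).1) (injOn_id _) f.1.1 ?_,
      ← Finset.sum_sub_distrib]
    · calc |∑ p ∈ S, (f.1.1 (q p) - f.1.1 (id p))| ≤ ∑ p ∈ S, |f.1.1 (q p) - f.1.1 (id p)| :=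
            Finset.abs_sum_le_sum_abs _ _
        _ ≤ ∑ p ∈ S, ε f / (S.card + 1) :=
            Finset.sum_le_sum fun p hp => ((hb p hp).2.2 f _ (hqm p hp).2).le
        _ = S.card * (ε f / (S.card + 1)) := by simp
        _ < ε f := by
            have := hε f
            rw [mul_div_assoc', div_lt_iff₀ (by positivity)]
            nlinarith
    · exact fun r hr hne => ⟨r, (hSmem r).2 ⟨hr, hn f r hne⟩, rfl⟩
    · intro p hp p' hp' h
      by_contra hne
      exact disjoint_left.1 (hdisj hp hp' hne) ((hb p hp).2.1 (hqm p hp).2).1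
        ((hb p' hp').2.1 (h ▸ (hqm p' hp').2)).1
    · intro r hr hne
      obtain ⟨p, hp, hrp⟩ := hν0 r hr (hn f r hne)
      have : r ∈ ν.atoms ∩ b p := ⟨hr, hrp⟩
      rw [hq p hp] at this
      exact ⟨p, hp, this.symm⟩

open TopologicalSpace in
-- This makes continuous functionals of configurations measurable, as required in order to integrate
-- them against laws on `Config d`.
instance : OpensMeasurableSpace (Config d) := by
  refine ⟨MeasurableSpace.generateFrom_le fun V hV => ?_⟩
  have : V = ⋃ q : {q : ℕ × Finset (countableBasis (Pos d × ℝ)) // network q.1 q.2 ⊆ V},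
      network q.1.1 q.1.2 := by
    refine Subset.antisymm (fun μ hμ => ?_) (iUnion_subset fun q => q.2)
    obtain ⟨n, F, hmem, hsub⟩ := exists_network (IsOpen.mem_nhds hV hμ)
    exact mem_iUnion.2 ⟨⟨(n, F), hsub⟩, hmem⟩
  rw [this]
  exact MeasurableSet.iUnion fun q => measurableSet_network _ _

end TailConf

namespace TailConf

variable {d : ℕ}

/-! ### Operations on configurations and their measurability -/

/-- `μ + δ_p`, where a point which `μ` may already have over the location of `p` is removed. -/
def addPoint (p : Pos d × ℝ) (μ : MarkedConfig d) : MarkedConfig d :=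
  have hfin : ∀ R : ℝ, {q ∈ {q : Pos d × ℝ | q ∈ μ.1.atoms ∧ q.1 ≠ p.1} ∪
      {q | q = p ∧ 0 < p.2} | ‖q.1‖ ≤ R}.Finite := by
    intro R
    refine ((μ.2 R).union (Set.finite_singleton p)).subset ?_
    rintro q ⟨hq | hq, hR⟩
    · exact Or.inl ⟨hq.1, hR⟩
    · exact Or.inr hq.1
  ⟨{ atoms := {q | q ∈ μ.1.atoms ∧ q.1 ≠ p.1} ∪ {q | q = p ∧ 0 < p.2}
     pos := by
       rintro q (hq | ⟨rfl, hz⟩)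
       · exact μ.1.pos q hq.1
       · exact hz
     simple := by
       rintro q (hq | ⟨rfl, _⟩) r (hr | ⟨rfl, _⟩) h
       · exact μ.1.simple q hq.1 r hr.1 h
       · exact absurd h hq.2
       · exact absurd h.symm hr.2
       · rfl
     finite_bdd := fun R ε _ => (hfin R).subset fun _ hp => ⟨hp.1, hp.2.1⟩ }, hfin⟩

lemma mem_addPoint {p q : Pos d × ℝ} {μ : MarkedConfig d} :
    q ∈ (addPoint p μ).1.atoms ↔ (q ∈ μ.1.atoms ∧ q.1 ≠ p.1) ∨ (q = p ∧ 0 < p.2) := Iff.rfl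

lemma addPoint_comm {p q : Pos d × ℝ} (h : p.1 ≠ q.1) (μ : MarkedConfig d) :
    addPoint p (addPoint q μ) = addPoint q (addPoint p μ) := by
  refine Subtype.ext (Config.ext ?_)
  ext r
  simp only [mem_addPoint]
  constructor
  · rintro (⟨⟨h1, h2⟩ | ⟨rfl, h2⟩, h3⟩ | ⟨rfl, h1⟩)
    · exact Or.inl ⟨Or.inl ⟨h1, h3⟩, h2⟩
    · exact Or.inr ⟨rfl, h2⟩
    · exact Or.inl ⟨Or.inr ⟨rfl, h1⟩, h⟩
  · rintro (⟨⟨h1, h2⟩ | ⟨rfl, h2⟩, h3⟩ | ⟨rfl, h1⟩)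
    · exact Or.inl ⟨Or.inl ⟨h1, h3⟩, h2⟩
    · exact Or.inr ⟨rfl, h2⟩
    · exact Or.inl ⟨Or.inr ⟨rfl, h1⟩, h.symm⟩

/-- This and the analogous lemmas below describe an operation by its effect on integrals against
counting measures. Inserting indicators of Borel sets then gives joint measurability of the
operation through `measurable_lintegral_config`. The last indicator accounts for a nonpositive
score, where no point is added. -/
lemma lintegral_addPoint (p : Pos d × ℝ) (μ : MarkedConfig d) (f : Pos d × ℝ → ℝ≥0∞) :
    ∫⁻ q, f q ∂(addPoint p μ).1.toMeasure =
      ∫⁻ q, {q | q.1 ≠ p.1}.indicator f q ∂μ.1.toMeasure +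
        (Ioi 0).indicator (fun _ => f p) p.2 := by
  rw [Config.lintegral_toMeasure, Config.lintegral_toMeasure]
  have hd : Disjoint {q : Pos d × ℝ | q ∈ μ.1.atoms ∧ q.1 ≠ p.1} {q | q = p ∧ 0 < p.2} := by
    refine disjoint_left.2 ?_
    rintro q ⟨_, hq⟩ ⟨rfl, _⟩
    exact hq rfl
  have h := Summable.tsum_union_disjoint (f := f) hd ENNReal.summable ENNReal.summable
  refine h.trans ?_
  congr 1
  · rw [tsum_subtype μ.1.atoms ({q | q.1 ≠ p.1}.indicator f), indicator_indicator,
      tsum_subtype {q : Pos d × ℝ | q ∈ μ.1.atoms ∧ q.1 ≠ p.1} f]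
    rfl
  · by_cases hp : 0 < p.2
    · have : {q | q = p ∧ 0 < p.2} = {p} := by ext; simp [hp]
      rw [this, tsum_singleton]
      simp [hp]
    · have : {q | q = p ∧ 0 < p.2} = ∅ := by ext; simp [hp]
      rw [this]
      simp [hp]

lemma measurable_addPoint :
    Measurable fun q : (Pos d × ℝ) × MarkedConfig d => addPoint q.1 q.2 := by
  rw [measurable_markedConfig_iff]
  intro B hB
  simp_rw [← lintegral_indicator_one hB, lintegral_addPoint]
  refine Measurable.add ?_ ?_
  · refine measurable_lintegral_config ?_ (measurable_subtype_coe.comp measurable_snd)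
    refine Measurable.indicator (s := {q : ((Pos d × ℝ) × MarkedConfig d) × (Pos d × ℝ) |
      q.2.1 ≠ q.1.1.1}) (f := fun q => B.indicator 1 q.2)
      ((measurable_one.indicator hB).comp measurable_snd) ?_
    exact (measurableSet_eq_fun (by fun_prop) (by fun_prop)).compl
  · refine Measurable.indicator (s := {q : (Pos d × ℝ) × MarkedConfig d | 0 < q.1.2})
      (f := fun q => B.indicator 1 q.1)
      ((measurable_one.indicator hB).comp measurable_fst) ?_
    exact measurableSet_lt (by fun_prop) (by fun_prop)

lemma lintegral_shift (z : Pos d) (μ : MarkedConfig d) (f : Pos d × ℝ → ℝ≥0∞) :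
    ∫⁻ q, f q ∂(μ.shift z).1.toMeasure = ∫⁻ q, f (q.1 - z, q.2) ∂μ.1.toMeasure := by
  rw [Config.lintegral_toMeasure, Config.lintegral_toMeasure]
  refine tsum_image f (g := fun p : Pos d × ℝ => (p.1 - z, p.2)) ?_
  intro p _ q _ h
  simpa [Prod.ext_iff] using h

lemma measurable_shift : Measurable fun q : Pos d × MarkedConfig d => q.2.shift q.1 := by
  rw [measurable_markedConfig_iff]
  intro B hB
  simp_rw [← lintegral_indicator_one hB, lintegral_shift]
  refine measurable_lintegral_config ?_ (measurable_subtype_coe.comp measurable_snd)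
  exact (measurable_one.indicator hB).comp (by fun_prop)

lemma mem_shift {z : Pos d} {μ : MarkedConfig d} {p : Pos d × ℝ} :
    p ∈ (μ.shift z).1.atoms ↔ (p.1 + z, p.2) ∈ μ.1.atoms := by
  constructor
  · rintro ⟨q, hq, rfl⟩
    simpa using hq
  · exact fun h => ⟨_, h, by simp⟩

lemma PointSet.mem_shift {z t : Pos d} {A : PointSet d} : t ∈ (A.shift z).pts ↔ t + z ∈ A.pts := by
  constructor
  · rintro ⟨q, hq, rfl⟩
    simpa using hq
  · exact fun h => ⟨_, h, by simp⟩

lemma addPoint_shift (z : Pos d) (p : Pos d × ℝ) (μ : MarkedConfig d) :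
    (addPoint p μ).shift z = addPoint (p.1 - z, p.2) (μ.shift z) := by
  refine Subtype.ext (Config.ext ?_)
  ext r
  simp only [mem_addPoint, TailConf.mem_shift, Prod.ext_iff, ne_eq, eq_sub_iff_add_eq]

lemma mem_ground {μ : MarkedConfig d} {t : Pos d} :
    t ∈ μ.ground.pts ↔ ∃ s, (t, s) ∈ μ.1.atoms := by
  constructor
  · rintro ⟨p, hp, rfl⟩
    exact ⟨p.2, hp⟩
  · rintro ⟨s, hs⟩
    exact ⟨_, hs, rfl⟩

lemma ground_shift (z : Pos d) (μ : MarkedConfig d) : (μ.shift z).ground = μ.ground.shift z := by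
  refine PointSet.ext ?_
  ext t
  simp only [mem_ground, PointSet.mem_shift, TailConf.mem_shift]

lemma mem_ground_addPoint {p : Pos d × ℝ} {μ : MarkedConfig d} {t : Pos d} (hp : 0 < p.2) :
    t ∈ (addPoint p μ).ground.pts ↔ t ∈ μ.ground.pts ∨ t = p.1 := by
  simp only [mem_ground, mem_addPoint]
  constructor
  · rintro ⟨s, ⟨h, _⟩ | ⟨rfl, _⟩⟩
    · exact Or.inl ⟨s, h⟩
    · exact Or.inr rfl
  · rintro (⟨s, hs⟩ | rfl)
    · by_cases h : t = p.1
      · exact ⟨p.2, Or.inr ⟨by rw [h], hp⟩⟩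
      · exact ⟨s, Or.inl ⟨hs, h⟩⟩
    · exact ⟨p.2, Or.inr ⟨rfl, hp⟩⟩

lemma ground_addPoint_eq {x : Pos d} {s s' : ℝ} {μ : MarkedConfig d} (hs : 0 < s) (hs' : 0 < s') :
    (addPoint (x, s) μ).ground = (addPoint (x, s') μ).ground := by
  refine PointSet.ext ?_
  ext t
  rw [mem_ground_addPoint hs, mem_ground_addPoint hs']

lemma lintegral_ground (μ : MarkedConfig d) (f : Pos d → ℝ≥0∞) :
    ∫⁻ t, f t ∂μ.ground.toMeasure = ∫⁻ p, f p.1 ∂μ.1.toMeasure := by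
  rw [Config.lintegral_toMeasure, PointSet.lintegral_toMeasure]
  exact tsum_image f (g := Prod.fst) fun p hp q hq h => μ.1.simple p hp q hq h

lemma measurable_ground : Measurable (MarkedConfig.ground (d := d)) := by
  rw [measurable_pointSet_iff]
  intro B hB
  simp_rw [← lintegral_indicator_one hB, lintegral_ground]
  refine measurable_lintegral_config ?_ measurable_subtype_coe
  exact (measurable_one.indicator hB).comp (by fun_prop)

lemma Config.score_eq {μ : Config d} {t : Pos d} {s : ℝ} (h : (t, s) ∈ μ.atoms) :
    μ.score t = s := by
  have h' : ∃ s, (t, s) ∈ μ.atoms := ⟨s, h⟩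
  rw [Config.score, dif_pos h']
  exact congrArg Prod.snd (μ.simple _ h'.choose_spec _ h rfl)

lemma Config.score_eq_zero {μ : Config d} {t : Pos d} (h : ∀ s, (t, s) ∉ μ.atoms) :
    μ.score t = 0 := by
  rw [Config.score, dif_neg]
  rintro ⟨s, hs⟩
  exact h s hs

lemma Config.score_nonneg (μ : Config d) (t : Pos d) : 0 ≤ μ.score t := by
  by_cases h : ∃ s, (t, s) ∈ μ.atoms
  · obtain ⟨s, hs⟩ := h
    rw [Config.score_eq hs]
    exact (μ.pos _ hs).le
  · rw [Config.score_eq_zero (by simpa using h)]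

/-- The score is defined by a choice. Since there is at most one atom over `t`, it is also an
integral with at most one nonzero term, and in this form it is visibly measurable. -/
lemma Config.score_eq_lintegral (μ : Config d) (t : Pos d) :
    μ.score t = (∫⁻ p, {p | p.1 = t}.indicator (fun p => ENNReal.ofReal p.2) p
      ∂μ.toMeasure).toReal := by
  rw [Config.lintegral_toMeasure]
  by_cases h : ∃ s, (t, s) ∈ μ.atoms
  · obtain ⟨s, hs⟩ := h
    rw [Config.score_eq hs, tsum_eq_single ⟨(t, s), hs⟩]
    · have := (μ.pos _ hs).le
      simp [ENNReal.toReal_ofReal this]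
    · rintro ⟨p, hp⟩ hne
      refine indicator_of_notMem (s := {p : Pos d × ℝ | p.1 = t}) (fun hpt : p.1 = t => hne ?_) _
      exact Subtype.ext (μ.simple _ hp _ hs hpt)
  · rw [Config.score_eq_zero (by simpa using h)]
    have : ∀ p : μ.atoms, {p : Pos d × ℝ | p.1 = t}.indicator
        (fun p => ENNReal.ofReal p.2) p.1 = 0 := by
      rintro ⟨p, hp⟩
      refine indicator_of_notMem (s := {p : Pos d × ℝ | p.1 = t})
        (fun hpt : p.1 = t => h ⟨p.2, ?_⟩) _
      rwa [← hpt]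
    simp [this]

lemma measurable_score : Measurable fun q : Config d × Pos d => q.1.score q.2 := by
  simp_rw [Config.score_eq_lintegral]
  refine Measurable.ennreal_toReal ?_
  refine measurable_lintegral_config ?_ measurable_fst
  refine Measurable.indicator (s := {q : (Config d × Pos d) × (Pos d × ℝ) | q.2.1 = q.1.2})
    (f := fun q => ENNReal.ofReal q.2.2) (by fun_prop) ?_
  exact measurableSet_eq_fun (by fun_prop) (by fun_prop)

lemma lintegral_ofScores (A : PointSet d) (g : Pos d → ℝ) (f : Pos d × ℝ → ℝ≥0∞) :
    ∫⁻ q, f q ∂(ofScores A g).1.toMeasure =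
      ∫⁻ t, {t | 0 < g t}.indicator (fun t => f (t, g t)) t ∂A.toMeasure := by
  rw [Config.lintegral_toMeasure, PointSet.lintegral_toMeasure]
  have : (ofScores A g).1.atoms = (fun t => (t, g t)) '' (A.pts ∩ {t | 0 < g t}) := by
    ext ⟨t, s⟩
    constructor
    · rintro ⟨h1, h2, h3⟩
      simp only at h1 h2 h3
      subst h2
      exact ⟨t, ⟨h1, h3⟩, rfl⟩
    · rintro ⟨t, ⟨h1, h2⟩, h⟩
      obtain ⟨rfl, rfl⟩ := Prod.ext_iff.1 h
      exact ⟨h1, rfl, h2⟩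
  rw [this, tsum_image f (g := fun t => (t, g t)) fun t _ t' _ h => congrArg Prod.fst h,
    tsum_subtype A.pts ({t | 0 < g t}.indicator (fun t => f (t, g t))), indicator_indicator,
    tsum_subtype (A.pts ∩ {t | 0 < g t}) (fun t => f (t, g t))]

lemma measurable_ofScores {α : Type*} [MeasurableSpace α] {A : α → PointSet d} (hA : Measurable A)
    {g : α → Pos d → ℝ} (hg : Measurable (Function.uncurry g)) :
    Measurable fun a => ofScores (A a) (g a) := by
  rw [measurable_markedConfig_iff]
  intro B hB
  simp_rw [← lintegral_indicator_one hB, lintegral_ofScores]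
  refine measurable_lintegral_pointSet ?_ hA
  refine Measurable.indicator (s := {q : α × Pos d | 0 < g q.1 q.2})
    (f := fun q => B.indicator 1 (q.2, g q.1 q.2)) ?_ (measurableSet_lt measurable_const hg)
  exact (measurable_one.indicator hB).comp (measurable_snd.prodMk hg)

lemma ofScores_congr {A : PointSet d} {g g' : Pos d → ℝ} (h : ∀ t ∈ A.pts, g t = g' t) :
    ofScores A g = ofScores A g' := by
  refine Subtype.ext (Config.ext ?_)
  ext p
  change p.1 ∈ A.pts ∧ p.2 = g p.1 ∧ 0 < p.2 ↔ p.1 ∈ A.pts ∧ p.2 = g' p.1 ∧ 0 < p.2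
  refine and_congr_right fun hp => ?_
  rw [h _ hp]

lemma score_ofScores {A : PointSet d} {g : Pos d → ℝ} {t : Pos d} (ht : t ∈ A.pts)
    (hg : 0 ≤ g t) : (ofScores A g).1.score t = g t := by
  rcases hg.eq_or_lt with h | h
  · rw [← h]
    refine Config.score_eq_zero fun s hs => ?_
    have h1 : s = g t := hs.2.1
    have h2 : 0 < s := hs.2.2
    linarith
  · exact Config.score_eq ⟨ht, rfl, h⟩

lemma mem_scale_one {u : ℝ} (hu : 0 < u) {μ : Config d} {p : Pos d × ℝ} :
    p ∈ (μ.scale 1 u).atoms ↔ (p.1, u * p.2) ∈ μ.atoms := by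
  change 0 < (1 : ℝ) ∧ 0 < u ∧ _ ↔ _
  simp [hu]

lemma lintegral_scale_one (u : ℝ) (μ : Config d) (f : Pos d × ℝ → ℝ≥0∞) :
    ∫⁻ q, f q ∂(μ.scale 1 u).toMeasure =
      (Ioi 0).indicator (fun u => ∫⁻ q, f (q.1, q.2 / u) ∂μ.toMeasure) u := by
  by_cases hu : 0 < u
  · rw [indicator_of_mem (show u ∈ Ioi 0 from hu), Config.lintegral_toMeasure,
      Config.lintegral_toMeasure]
    have : (μ.scale 1 u).atoms = (fun q : Pos d × ℝ => (q.1, q.2 / u)) '' μ.atoms := by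
      ext p
      rw [mem_scale_one hu]
      constructor
      · exact fun h => ⟨_, h, by simp [hu.ne']⟩
      · rintro ⟨q, hq, rfl⟩
        simpa [mul_div_cancel₀, hu.ne'] using hq
    rw [this, tsum_image f (g := fun q : Pos d × ℝ => (q.1, q.2 / u))]
    intro p _ q _ h
    have h1 : p.1 = q.1 := (Prod.ext_iff.1 h).1
    have h2 : p.2 / u = q.2 / u := (Prod.ext_iff.1 h).2
    exact Prod.ext h1 (by field_simp at h2; exact h2)
  · rw [indicator_of_notMem (show u ∉ Ioi 0 from hu), Config.lintegral_eq_zero]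
    rintro p ⟨_, h, _⟩
    exact absurd h hu

lemma measurable_scale_one : Measurable fun q : ℝ × Config d => q.2.scale 1 q.1 := by
  rw [measurable_config_iff]
  intro B hB
  simp_rw [← lintegral_indicator_one hB, lintegral_scale_one]
  refine Measurable.indicator (s := {q : ℝ × Config d | 0 < q.1})
    (f := fun q => ∫⁻ p, B.indicator 1 (p.1, p.2 / q.1) ∂q.2.toMeasure) ?_
    (measurableSet_lt measurable_const measurable_fst)
  refine measurable_lintegral_config ?_ measurable_snd
  exact (measurable_one.indicator hB).comp (by fun_prop)

lemma spectral_zero (μ : Config d) : spectral 0 μ = μ.scale 1 (μ.score 0) := by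
  rw [spectral, Real.rpow_zero]

lemma measurable_spectral_zero : Measurable (spectral (d := d) 0) := by
  simp_rw [funext spectral_zero]
  exact measurable_scale_one.comp
    ((measurable_score.comp (measurable_id.prodMk measurable_const)).prodMk measurable_id)

lemma scale_one_ofScores {u : ℝ} (hu : 0 < u) (A : PointSet d) (g : Pos d → ℝ) :
    (ofScores A g).1.scale 1 u = (ofScores A fun t => g t / u).1 := by
  refine Config.ext ?_
  ext p
  rw [mem_scale_one hu]
  change p.1 ∈ A.pts ∧ u * p.2 = g p.1 ∧ 0 < u * p.2 ↔ p.1 ∈ A.pts ∧ p.2 = g p.1 / u ∧ 0 < p.2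
  rw [eq_div_iff hu.ne', mul_comm u, mul_pos_iff_of_pos_right hu]

end TailConf

namespace TailConf

variable {d : ℕ} {Φ : Pos d × PointSet d → PointSet d} {w : Pos d → ℝ}

/-! ### Moving maxima -/

lemma measurableSet_mem_neighborhood (hΦ : IsNeighborhood Φ) {α : Type*} [MeasurableSpace α]
    {x t : α → Pos d} {A : α → PointSet d} (hx : Measurable x) (ht : Measurable t)
    (hA : Measurable A) : MeasurableSet {a | x a ∈ (Φ (t a, A a)).pts} :=
  measurableSet_mem_pts hx (hΦ.measurable.comp (ht.prodMk hA))

lemma movingMaxScore_nonneg (hw : ∀ t, 0 ≤ w t) (μ : MarkedConfig d) (t : Pos d) :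
    0 ≤ movingMaxScore Φ w μ t := by
  refine Real.sSup_nonneg ?_
  rintro _ ⟨x, -, rfl⟩
  exact mul_nonneg (hw _) (Config.score_nonneg _ _)

/-- The supremum is a maximum over a finite nonempty set. In this form it can be compared atom by
atom, which serves for measurability, for equivariance and for separating one point from the others.
-/
lemma lt_movingMaxScore_iff (hΦ : IsNeighborhood Φ) {μ : MarkedConfig d} {t : Pos d}
    (ht : t ∈ μ.ground.pts) (c : ℝ) :
    c < movingMaxScore Φ w μ t ↔
      ∃ p ∈ μ.1.atoms, p.1 ∈ (Φ (t, μ.ground)).pts ∧ c < w (p.1 - t) * p.2 := by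
  rw [movingMaxScore, lt_csSup_iff ((hΦ.finite _ t ht).image _).bddAbove
    ⟨_, _, hΦ.self_mem _ t ht, rfl⟩]
  constructor
  · rintro ⟨_, ⟨x, hx, rfl⟩, hc⟩
    obtain ⟨s, hs⟩ := mem_ground.1 (hΦ.subset _ t ht hx)
    simp only [Config.score_eq hs] at hc
    exact ⟨_, hs, hx, hc⟩
  · rintro ⟨p, hp, hpΦ, hc⟩
    refine ⟨_, ⟨p.1, hpΦ, rfl⟩, ?_⟩
    simp only
    rwa [Config.score_eq (show (p.1, p.2) ∈ μ.1.atoms from hp)]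

lemma movingMaxScore_pos (hΦ : IsNeighborhood Φ) (hw0 : 0 < w 0) {μ : MarkedConfig d} {t : Pos d}
    (ht : t ∈ μ.ground.pts) : 0 < movingMaxScore Φ w μ t := by
  obtain ⟨s, hs⟩ := mem_ground.1 ht
  refine (lt_movingMaxScore_iff hΦ ht 0).2 ⟨_, hs, hΦ.self_mem _ t ht, ?_⟩
  simpa using mul_pos hw0 (μ.1.pos _ hs)

/-- The indicator is needed because `Φ (t, A)` is unconstrained for `t ∉ A`: it may be infinite, and
the supremum is then not a maximum. -/
lemma measurable_indicator_movingMaxScore (hΦ : IsNeighborhood Φ) (hwm : Measurable w)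
    (hw : ∀ t, 0 ≤ w t) :
    Measurable fun q : MarkedConfig d × Pos d =>
      {t | t ∈ q.1.ground.pts}.indicator (movingMaxScore Φ w q.1) q.2 := by
  refine measurable_of_Ioi fun c => ?_
  rcases lt_or_ge c 0 with hc | hc
  · convert MeasurableSet.univ
    refine eq_univ_of_forall fun q => ?_
    exact hc.trans_le (indicator_nonneg (fun t _ => movingMaxScore_nonneg hw _ _) _)
  · have h1 : MeasurableSet {q : MarkedConfig d × Pos d | q.2 ∈ q.1.ground.pts} :=
      measurableSet_mem_pts measurable_snd (measurable_ground.comp measurable_fst)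
    have h2 := measurableSet_exists_atom (α := MarkedConfig d × Pos d)
      (E := {r | r.2.1 ∈ (Φ (r.1.2, r.1.1.ground)).pts} ∩ {r | c < w (r.2.1 - r.1.2) * r.2.2})
      ((measurableSet_mem_neighborhood hΦ (by fun_prop) (by fun_prop)
        (measurable_ground.comp (by fun_prop))).inter
        (measurableSet_lt measurable_const (by fun_prop)))
      (g := fun q => q.1.1) (measurable_subtype_coe.comp measurable_fst)
    convert h1.inter h2 using 1
    ext q
    simp only [mem_preimage, mem_Ioi, mem_inter_iff, mem_ofPred_eq]
    by_cases hq : q.2 ∈ q.1.ground.pts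
    · rw [indicator_of_mem (show q.2 ∈ {t | t ∈ q.1.ground.pts} from hq),
        lt_movingMaxScore_iff hΦ hq]
      simp [hq]
    · rw [indicator_of_notMem (show q.2 ∉ {t | t ∈ q.1.ground.pts} from hq)]
      simp [hq, hc]

lemma measurable_movingMaxima (hΦ : IsNeighborhood Φ) (hwm : Measurable w) (hw : ∀ t, 0 ≤ w t) :
    Measurable (movingMaxima Φ w) := by
  have : movingMaxima Φ w = fun μ => ofScores μ.ground fun t =>
      {t | t ∈ μ.ground.pts}.indicator (movingMaxScore Φ w μ) t := by
    funext μ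
    refine ofScores_congr fun t ht => ?_
    rw [indicator_of_mem (show t ∈ {t | t ∈ μ.ground.pts} from ht)]
  rw [this]
  exact measurable_ofScores measurable_ground (measurable_indicator_movingMaxScore hΦ hwm hw)

/-- As `t ∈ Φ(t)` and `w(0) > 0`, every point keeps a positive score and none is dropped. Sums over
locations of the moving maxima process are thus sums over the Poisson points. -/
lemma ground_movingMaxima (hΦ : IsNeighborhood Φ) (hw0 : 0 < w 0) (μ : MarkedConfig d) :
    (movingMaxima Φ w μ).ground = μ.ground := by
  refine PointSet.ext ?_
  ext t
  rw [mem_ground]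
  exact ⟨fun ⟨s, hs⟩ => hs.1, fun ht => ⟨_, ht, rfl, movingMaxScore_pos hΦ hw0 ht⟩⟩

lemma lintegral_movingMaxima (hΦ : IsNeighborhood Φ) (hw0 : 0 < w 0) (μ : MarkedConfig d)
    (f : Pos d → ℝ≥0∞) :
    ∫⁻ p, f p.1 ∂(movingMaxima Φ w μ).1.toMeasure = ∫⁻ p, f p.1 ∂μ.1.toMeasure := by
  rw [← lintegral_ground, ← lintegral_ground, ground_movingMaxima hΦ hw0]

lemma score_movingMaxima (hw : ∀ t, 0 ≤ w t) {μ : MarkedConfig d} {t : Pos d}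
    (ht : t ∈ μ.ground.pts) :
    (movingMaxima Φ w μ).1.score t = movingMaxScore Φ w μ t :=
  score_ofScores ht (movingMaxScore_nonneg hw _ _)

lemma movingMaxima_shift (hΦ : IsNeighborhood Φ) (z : Pos d) (μ : MarkedConfig d) :
    movingMaxima Φ w (μ.shift z) = (movingMaxima Φ w μ).shift z := by
  have h : ∀ t, t + z ∈ μ.ground.pts →
      movingMaxScore Φ w (μ.shift z) t = movingMaxScore Φ w μ (t + z) := by
    intro t ht
    have ht' : t ∈ (μ.shift z).ground.pts := by rwa [ground_shift, PointSet.mem_shift]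
    refine eq_of_forall_lt_iff fun c => ?_
    rw [lt_movingMaxScore_iff hΦ ht', lt_movingMaxScore_iff hΦ ht, ground_shift]
    have he : Φ (t, μ.ground.shift z) = (Φ (t + z, μ.ground)).shift z := by
      rw [← hΦ.equivariant _ _ ht, add_sub_cancel_right]
    rw [he]
    simp only [PointSet.mem_shift, mem_shift]
    constructor
    · rintro ⟨p, h1, h2, h3⟩
      refine ⟨_, h1, h2, ?_⟩
      rwa [show p.1 + z - (t + z) = p.1 - t by abel]
    · rintro ⟨p, h1, h2, h3⟩
      refine ⟨(p.1 - z, p.2), by simpa using h1, by simpa using h2, ?_⟩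
      rwa [show p.1 - z - t = p.1 - (t + z) by abel]
  refine Subtype.ext (Config.ext ?_)
  ext p
  rw [mem_shift]
  change p.1 ∈ (μ.shift z).ground.pts ∧ p.2 = movingMaxScore Φ w (μ.shift z) p.1 ∧ 0 < p.2 ↔
    p.1 + z ∈ μ.ground.pts ∧ p.2 = movingMaxScore Φ w μ (p.1 + z) ∧ 0 < p.2
  rw [ground_shift, PointSet.mem_shift]
  refine and_congr_right fun hp => ?_
  rw [h _ hp]

/-- The weight with which the score of `x` contributes to the moving maximum at `t`. -/
noncomputable def clusterWeight (Φ : Pos d × PointSet d → PointSet d) (w : Pos d → ℝ)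
    (A : PointSet d) (x t : Pos d) : ℝ :=
  {t | x ∈ (Φ (t, A)).pts}.indicator (fun t => w (x - t)) t

lemma clusterWeight_nonneg (hw : ∀ t, 0 ≤ w t) (A : PointSet d) (x t : Pos d) :
    0 ≤ clusterWeight Φ w A x t := indicator_nonneg (fun _ _ => hw _) _

/-- The condition `x ∈ Φ(t)` is moved from the set of locations into the weight. With all of `A` as
set of locations, `tendsto_ofScores` becomes applicable. -/
lemma spectralCluster_eq (A : PointSet d) (x : Pos d) :
    spectralCluster Φ w A x = (ofScores A fun t => clusterWeight Φ w A x t / w x).1 := by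
  refine Config.ext ?_
  ext p
  change (p.1 ∈ A.pts ∧ x ∈ (Φ (p.1, A)).pts) ∧ p.2 = w (x - p.1) / w x ∧ 0 < p.2 ↔
    p.1 ∈ A.pts ∧ p.2 = clusterWeight Φ w A x p.1 / w x ∧ 0 < p.2
  by_cases h : x ∈ (Φ (p.1, A)).pts
  · rw [clusterWeight, indicator_of_mem (show p.1 ∈ {t | x ∈ (Φ (t, A)).pts} from h)]
    simp [h]
  · rw [clusterWeight, indicator_of_notMem (show p.1 ∉ {t | x ∈ (Φ (t, A)).pts} from h)]
    simp only [h, and_false, false_and, zero_div, false_iff, not_and, not_lt]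
    exact fun _ h => h.le

lemma measurable_spectralCluster (hΦ : IsNeighborhood Φ) (hwm : Measurable w) :
    Measurable fun q : Pos d × PointSet d => spectralCluster Φ w q.2 q.1 := by
  simp_rw [spectralCluster_eq]
  refine measurable_subtype_coe.comp (measurable_ofScores measurable_snd ?_)
  refine Measurable.div ?_ (by fun_prop)
  refine Measurable.indicator (s := {q : (Pos d × PointSet d) × Pos d |
    q.1.1 ∈ (Φ (q.2, q.1.2)).pts}) (f := fun q => w (q.1.1 - q.2)) (by fun_prop) ?_
  exact measurableSet_mem_neighborhood hΦ (by fun_prop) (by fun_prop) (by fun_prop)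

/-- The largest contribution of points other than `x` to the moving maximum at `t`. -/
noncomputable def restScore (Φ : Pos d × PointSet d → PointSet d) (w : Pos d → ℝ)
    (A : PointSet d) (μ : MarkedConfig d) (x t : Pos d) : ℝ :=
  sSup ((fun y => w (y - t) * μ.1.score y) '' ((Φ (t, A)).pts \ {x}))

/-- The set `A` of locations, hence every neighborhood, is unaffected by the value of `s`. Therefore
`s` enters the score at `t` only through one linear term under a maximum. -/
lemma movingMaxScore_addPoint (hΦ : IsNeighborhood Φ) (hw : ∀ t, 0 ≤ w t) {x t : Pos d} {s : ℝ}
    (hs : 0 < s) {μ : MarkedConfig d} {A : PointSet d} (hA : (addPoint (x, s) μ).ground = A)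
    (ht : t ∈ A.pts) :
    movingMaxScore Φ w (addPoint (x, s) μ) t =
      max (clusterWeight Φ w A x t * s) (restScore Φ w A μ x t) := by
  have hb0 : 0 ≤ restScore Φ w A μ x t := by
    refine Real.sSup_nonneg ?_
    rintro _ ⟨x, -, rfl⟩
    exact mul_nonneg (hw _) (Config.score_nonneg _ _)
  have hmem : ∀ y, y ∈ A.pts → y ≠ x → ∃ r, (y, r) ∈ μ.1.atoms := by
    intro y hy hyx
    rw [← hA, mem_ground_addPoint hs, mem_ground] at hy
    exact hy.resolve_right hyx
  -- If `x` is the only neighbor, the supremum of the empty set is `0`, so the equivalence needs `c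
  -- ≥ 0`. Negative `c` are trivial, since both scores are nonnegative.
  have hb : ∀ c, 0 ≤ c → (c < restScore Φ w A μ x t ↔
      ∃ p ∈ μ.1.atoms, p.1 ≠ x ∧ p.1 ∈ (Φ (t, A)).pts ∧ c < w (p.1 - t) * p.2) := by
    intro c hc
    by_cases hne : ((Φ (t, A)).pts \ {x}).Nonempty
    · rw [restScore, lt_csSup_iff (((hΦ.finite _ t ht).subset Set.sdiff_subset).image _).bddAbove
        (hne.image _)]
      constructor
      · rintro ⟨_, ⟨y, hy, rfl⟩, h⟩
        obtain ⟨r, hr⟩ := hmem y (hΦ.subset _ t ht hy.1) hy.2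
        simp only [Config.score_eq hr] at h
        exact ⟨_, hr, hy.2, hy.1, h⟩
      · rintro ⟨p, h1, h2, h3, h4⟩
        refine ⟨_, ⟨p.1, ⟨h3, h2⟩, rfl⟩, ?_⟩
        simp only
        rwa [Config.score_eq (show (p.1, p.2) ∈ μ.1.atoms from h1)]
    · rw [restScore, not_nonempty_iff_eq_empty.1 hne]
      simp only [image_empty, Real.sSup_empty, hc.not_gt, false_iff]
      rintro ⟨p, h1, h2, h3, h4⟩
      exact hne ⟨p.1, h3, h2⟩
  refine eq_of_forall_lt_iff fun c => ?_
  rw [lt_max_iff]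
  rcases lt_or_ge c 0 with hc | hc
  · simp only [hc.trans_le hb0, or_true, iff_true]
    exact hc.trans_le (movingMaxScore_nonneg hw _ _)
  · rw [lt_movingMaxScore_iff hΦ (by rwa [hA]), hb c hc, hA]
    have hcw : c < clusterWeight Φ w A x t * s ↔ x ∈ (Φ (t, A)).pts ∧ c < w (x - t) * s := by
      by_cases h : x ∈ (Φ (t, A)).pts
      · rw [clusterWeight, indicator_of_mem (show t ∈ {t | x ∈ (Φ (t, A)).pts} from h)]
        simp [h]
      · rw [clusterWeight, indicator_of_notMem (show t ∉ {t | x ∈ (Φ (t, A)).pts} from h)]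
        simp [h, hc]
    rw [hcw]
    simp only [mem_addPoint]
    constructor
    · rintro ⟨p, ⟨h1, h2⟩ | ⟨rfl, -⟩, h3, h4⟩
      · exact Or.inr ⟨p, h1, h2, h3, h4⟩
      · exact Or.inl ⟨h3, h4⟩
    · rintro (⟨h1, h2⟩ | ⟨p, h1, h2, h3, h4⟩)
      · exact ⟨(x, s), Or.inr ⟨rfl, hs⟩, h1, h2⟩
      · exact ⟨p, Or.inl ⟨h1, h2⟩, h3, h4⟩

end TailConf

namespace TailConf

variable {d : ℕ}

/-! ### Poisson processes -/

lemma lintegral_natCast_poissonMeasure (r : ℝ≥0) :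
    ∑' k : ℕ, (k : ℝ≥0∞) * poissonMeasure r {k} = r := by
  rw [tsum_eq_zero_add' ENNReal.summable]
  have : ∀ k : ℕ, ((k + 1 : ℕ) : ℝ≥0∞) * poissonMeasure r {k + 1} = r * poissonMeasure r {k} := by
    intro k
    rw [poissonMeasure_singleton, poissonMeasure_singleton, ← ENNReal.ofReal_natCast,
      ← ENNReal.ofReal_coe_nnreal, ← ENNReal.ofReal_mul (by positivity),
      ← ENNReal.ofReal_mul (by positivity)]
    congr 1
    rw [Nat.factorial_succ]
    push_cast
    field_simp
    ring
  simp_rw [this, ENNReal.tsum_mul_left]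
  have h1 : ∑' k : ℕ, poissonMeasure r {k} = 1 := by
    have := measure_univ (μ := poissonMeasure r)
    rwa [← lintegral_one, lintegral_countable', tsum_congr fun k => one_mul _] at this
  rw [h1]
  simp

section Poisson

variable {Ω : Type*} [MeasurableSpace Ω] {Pr : Measure Ω}
  {P : Ω → MarkedConfig d} {m : Measure ℝ} [IsProbabilityMeasure m]

lemma IsPoissonProcess.measurable_count {Λ : Measure (Pos d × ℝ)} (hP : IsPoissonProcess Pr P Λ)
    {B : Set (Pos d × ℝ)} (hB : MeasurableSet B) : Measurable fun ω => (P ω).1.toMeasure B :=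
  measurable_markedConfig_iff.1 hP.measurable B hB

/-- Over a one-point space a simple configuration has at most one atom, whereas a Poisson variable
with positive mean equals `2` with positive probability. In positive dimension Lebesgue measure has
no atoms, which is used to see that a given location carries no Poisson point. -/
lemma IsPoissonProcess.dim_ne_zero
    (hP : IsPoissonProcess Pr P ((volume : Measure (Pos d)).prod m)) : d ≠ 0 := by
  rintro rfl
  have huniv : (univ : Set (Pos 0)) = Metric.closedBall 0 1 := by
    refine (eq_univ_of_forall fun t => ?_).symm
    simp [Subsingleton.elim t 0]
  have hfin : (volume : Measure (Pos 0)) univ ≠ ∞ := by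
    rw [huniv]
    exact measure_closedBall_lt_top.ne
  have hpos : (volume : Measure (Pos 0)) univ ≠ 0 := isOpen_univ.measure_ne_zero _ univ_nonempty
  have hΛ : ((volume : Measure (Pos 0)).prod m) univ = (volume : Measure (Pos 0)) univ := by
    rw [← univ_prod_univ, Measure.prod_prod, measure_univ (μ := m), mul_one]
  have h := hP.poisson univ .univ (by rw [hΛ]; exact hfin) 2
  have hempty : {ω | (P ω).1.toMeasure univ = (2 : ℕ)} = ∅ := by
    refine eq_empty_of_forall_notMem fun ω (hω : _ = _) => ?_
    rw [(P ω).1.toMeasure_apply .univ, inter_univ] at hω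
    have hle : (P ω).1.atoms.encard ≤ 1 :=
      encard_le_one_iff.2 fun p q hp hq => (P ω).1.simple p hp q hq (Subsingleton.elim _ _)
    have : (P ω).1.atoms.encard = 2 := by exact_mod_cast hω
    rw [this] at hle
    exact absurd hle (by decide)
  rw [hempty, measure_empty, poissonMeasure_singleton] at h
  have hr : 0 < (((volume : Measure (Pos 0)).prod m) univ).toNNReal :=
    ENNReal.toNNReal_pos (by rw [hΛ]; exact hpos) (by rw [hΛ]; exact hfin)
  have := h.symm
  rw [ENNReal.ofReal_eq_zero] at this
  have : 0 < Real.exp (-(((volume : Measure (Pos 0)).prod m) univ).toNNReal) *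
    (((volume : Measure (Pos 0)).prod m) univ).toNNReal ^ 2 / (Nat.factorial 2 : ℕ) := by
    have hr' : (0 : ℝ) < (((volume : Measure (Pos 0)).prod m) univ).toNNReal := hr
    positivity
  linarith

variable [IsProbabilityMeasure Pr]

lemma IsPoissonProcess.lintegral_count {Λ : Measure (Pos d × ℝ)} (hP : IsPoissonProcess Pr P Λ)
    {B : Set (Pos d × ℝ)} (hB : MeasurableSet B) (hΛ : Λ B ≠ ∞) :
    ∫⁻ ω, (P ω).1.toMeasure B ∂Pr = Λ B := by
  set r := (Λ B).toNNReal with hr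
  have hN := hP.measurable_count hB
  have hk : ∀ k : ℕ, MeasurableSet {ω | (P ω).1.toMeasure B = k} :=
    fun k => hN (measurableSet_singleton _)
  -- The count might be infinite a priori; the Poisson weights add up to one, which leaves no mass
  -- for that.
  have hae : ∀ᵐ ω ∂Pr, ∃ k : ℕ, (P ω).1.toMeasure B = k := by
    have h1 : Pr (⋃ k : ℕ, {ω | (P ω).1.toMeasure B = k}) = 1 := by
      rw [measure_iUnion _ hk]
      · simp_rw [hP.poisson B hB hΛ]
        have := measure_univ (μ := poissonMeasure r)
        rwa [← lintegral_one, lintegral_countable', tsum_congr fun k => one_mul _] at this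
      · intro i j hij
        refine disjoint_left.2 fun ω (h : _ = _) (h' : _ = _) => hij ?_
        rw [h] at h'
        exact_mod_cast h'
    have h2 := (prob_compl_eq_zero_iff (MeasurableSet.iUnion hk)).2 h1
    filter_upwards [measure_eq_zero_iff_ae_notMem.1 h2] with ω hω
    simpa using hω
  have heq : ∀ᵐ ω ∂Pr, (P ω).1.toMeasure B =
      ∑' k : ℕ, {ω | (P ω).1.toMeasure B = k}.indicator (fun _ => (k : ℝ≥0∞)) ω := by
    filter_upwards [hae] with ω ⟨k, hω⟩
    rw [tsum_eq_single k]
    · rw [indicator_of_mem (show ω ∈ {ω | (P ω).1.toMeasure B = k} from hω), hω]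
    · intro j hj
      refine indicator_of_notMem (s := {ω | (P ω).1.toMeasure B = j}) (fun h : _ = _ => hj ?_) _
      rw [hω] at h
      exact_mod_cast h.symm
  rw [lintegral_congr_ae heq, lintegral_tsum fun k => (measurable_const.indicator (hk k)).aemeasurable]
  simp_rw [lintegral_indicator_const (hk _), hP.poisson B hB hΛ]
  rw [lintegral_natCast_poissonMeasure, ENNReal.coe_toNNReal hΛ]

lemma nullSingletonClass_volume (hd : d ≠ 0) : NullSingletonClass (volume : Measure (Pos d)) := by
  have : NeZero d := ⟨hd⟩
  infer_instance

lemma intensity_cover (hm : m (Iic 0) = 0) (n : ℕ) :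
    ((volume : Measure (Pos d)).prod m) (cover d n) ≠ ∞ := by
  have h1 : cover d n ⊆ Metric.ball 0 (n + 1) ×ˢ univ ∪ univ ×ˢ Iic 0 := by
    rintro p (hp | hp)
    · exact Or.inl ⟨by simpa using hp.1, mem_univ _⟩
    · exact Or.inr ⟨mem_univ _, hp⟩
  refine ne_top_of_le_ne_top ?_ ((measure_mono h1).trans (measure_union_le _ _))
  rw [Measure.prod_prod, Measure.prod_prod, hm, measure_univ]
  simpa using (measure_ball_lt_top (μ := (volume : Measure (Pos d)))).ne

lemma ae_intensity_pos (hm : m (Iic 0) = 0) :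
    ∀ᵐ p ∂((volume : Measure (Pos d)).prod m), 0 < p.2 := by
  have : ((volume : Measure (Pos d)).prod m) (univ ×ˢ Iic 0) = 0 := by
    rw [Measure.prod_prod, hm, mul_zero]
  filter_upwards [measure_eq_zero_iff_ae_notMem.1 this] with p hp
  simpa using hp

/-- Almost surely there is no point over a given location. -/
lemma IsPoissonProcess.ae_notMem_ground
    (hP : IsPoissonProcess Pr P ((volume : Measure (Pos d)).prod m)) (t : Pos d) :
    ∀ᵐ ω ∂Pr, t ∉ (P ω).ground.pts := by
  have := nullSingletonClass_volume hP.dim_ne_zero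
  have hB : MeasurableSet ({t} ×ˢ univ : Set (Pos d × ℝ)) :=
    (measurableSet_singleton t).prod .univ
  have h0 : ((volume : Measure (Pos d)).prod m) ({t} ×ˢ univ) = 0 := by
    rw [Measure.prod_prod, measure_singleton, zero_mul]
  have h := hP.lintegral_count hB (by rw [h0]; exact ENNReal.zero_ne_top)
  rw [h0, lintegral_eq_zero_iff (hP.measurable_count hB)] at h
  filter_upwards [h] with ω hω ht
  obtain ⟨s, hs⟩ := mem_ground.1 ht
  exact ((P ω).1.toMeasure_eq_zero hB).1 hω _ hs (by simp)

/-- The counting measures of marked configurations as a kernel. -/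
noncomputable def markedKernel (d : ℕ) : Kernel (MarkedConfig d) (Pos d × ℝ) :=
  (atomKernel d).comap Subtype.val measurable_subtype_coe

instance : IsSFiniteKernel (markedKernel d) := by
  unfold markedKernel; infer_instance

/-- The void events of marked configurations. -/
def markedVoidEvents (d : ℕ) : Set (Set (MarkedConfig d)) :=
  preimage Subtype.val '' voidEvents d

lemma generateFrom_markedVoidEvents : MeasurableSpace.generateFrom (markedVoidEvents d) =
    (inferInstance : MeasurableSpace (MarkedConfig d)) := by
  rw [markedVoidEvents, ← MeasurableSpace.comap_generateFrom, generateFrom_voidEvents]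
  rfl

lemma isPiSystem_markedVoidEvents : IsPiSystem (markedVoidEvents d) := by
  rintro _ ⟨V, hV, rfl⟩ _ ⟨V', hV', rfl⟩ hne
  rw [← preimage_inter] at hne ⊢
  exact ⟨_, isPiSystem_voidEvents _ hV _ hV' (let ⟨μ, hμ⟩ := hne; ⟨μ.1, hμ⟩), rfl⟩

lemma mem_markedVoidEvents {V : Set (MarkedConfig d)} (hV : V ∈ markedVoidEvents d) :
    ∃ U, IsOpen U ∧ (∃ n, U ⊆ window d n) ∧ V = {μ | μ.1.toMeasure U = 0} := by
  obtain ⟨_, ⟨U, h1, h2, rfl⟩, rfl⟩ := hV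
  exact ⟨U, h1, h2, rfl⟩

/-- Measurable sets contained in some set of the cover. -/
def smallSets (d : ℕ) : Set (Set (Pos d × ℝ)) := {C | MeasurableSet C ∧ ∃ n, C ⊆ cover d n}

lemma cover_mem_smallSets (n : ℕ) : cover d n ∈ smallSets d :=
  ⟨measurableSet_cover n, n, subset_rfl⟩

lemma generateFrom_smallSets : MeasurableSpace.generateFrom (smallSets d) =
    (inferInstance : MeasurableSpace (Pos d × ℝ)) := by
  apply le_antisymm
  · exact MeasurableSpace.generateFrom_le fun C hC => hC.1
  · intro B hB
    have : B = ⋃ n, B ∩ cover d n := by rw [← inter_iUnion, iUnion_cover, inter_univ]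
    rw [this]
    exact MeasurableSet.iUnion fun n => MeasurableSpace.measurableSet_generateFrom
      ⟨MeasurableSet.inter hB (measurableSet_cover n), n, inter_subset_right⟩

lemma isPiSystem_smallSets : IsPiSystem (smallSets d) := by
  rintro C ⟨hC, n, hn⟩ C' ⟨hC', -⟩ -
  exact ⟨hC.inter hC', n, inter_subset_left.trans hn⟩

lemma toMeasure_addPoint_eq_zero {p : Pos d × ℝ} (hp : 0 < p.2) {μ : MarkedConfig d}
    (hμ : p.1 ∉ μ.ground.pts) {U : Set (Pos d × ℝ)} (hU : MeasurableSet U) :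
    (addPoint p μ).1.toMeasure U = 0 ↔ p ∉ U ∧ μ.1.toMeasure U = 0 := by
  rw [Config.toMeasure_eq_zero _ hU, Config.toMeasure_eq_zero _ hU]
  simp only [mem_addPoint]
  constructor
  · refine fun h => ⟨h p (Or.inr ⟨rfl, hp⟩), fun q hq => h q (Or.inl ⟨hq, fun hqp => hμ ?_⟩)⟩
    rw [← hqp]
    exact mem_ground.2 ⟨q.2, hq⟩
  · rintro ⟨h1, h2⟩ q (⟨hq, -⟩ | ⟨rfl, -⟩)
    · exact h2 q hq
    · exact h1

/-- The Mecke equation, on the level of measures. -/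
lemma IsPoissonProcess.compProd_eq
    (hP : IsPoissonProcess Pr P ((volume : Measure (Pos d)).prod m)) (hm : m (Iic 0) = 0) :
    (Pr.map P) ⊗ₘ markedKernel d =
      (((volume : Measure (Pos d)).prod m).prod (Pr.map P)).map
        (fun q : (Pos d × ℝ) × MarkedConfig d => (addPoint q.1 q.2, q.1)) := by
  set Λ := (volume : Measure (Pos d)).prod m with hΛ
  have hprob : IsProbabilityMeasure (Pr.map P) :=
    Measure.isProbabilityMeasure_map hP.measurable.aemeasurable
  -- It suffices to compare both sides on products of a void event with a small set, and these are
  -- accessible through Poisson counts alone.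
  have hgen : (inferInstance : MeasurableSpace (MarkedConfig d × (Pos d × ℝ))) =
      MeasurableSpace.generateFrom (image2 (· ×ˢ ·) (markedVoidEvents d) (smallSets d)) := by
    refine (generateFrom_eq_prod generateFrom_markedVoidEvents generateFrom_smallSets ?_ ?_).symm
    · exact ⟨fun _ => univ, fun _ => ⟨_, univ_mem_voidEvents, rfl⟩, iUnion_const _⟩
    · exact ⟨cover d, cover_mem_smallSets, iUnion_cover⟩
  have hrect1 : ∀ V : Set (MarkedConfig d), MeasurableSet V → ∀ C, MeasurableSet C →
      ((Pr.map P) ⊗ₘ markedKernel d) (V ×ˢ C) =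
        ∫⁻ ω in P ⁻¹' V, (P ω).1.toMeasure C ∂Pr := by
    intro V hV C hC
    rw [Measure.compProd_apply_prod hV hC,
      setLIntegral_map hV ((markedKernel d).measurable_coe hC) hP.measurable]
    rfl
  refine Measure.ext_of_generateFrom_of_iUnion _ (fun n => univ ×ˢ cover d n) hgen
    (isPiSystem_markedVoidEvents.prod isPiSystem_smallSets) ?_ ?_ ?_ ?_
  · rw [← prod_iUnion, iUnion_cover, univ_prod_univ]
  · exact fun n => ⟨univ, ⟨_, univ_mem_voidEvents, rfl⟩, _, cover_mem_smallSets n, rfl⟩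
  · intro n
    rw [hrect1 _ .univ _ (measurableSet_cover n), preimage_univ, Measure.restrict_univ,
      hP.lintegral_count (measurableSet_cover n) (intensity_cover hm n)]
    exact intensity_cover hm n
  · rintro _ ⟨V, hV, C, ⟨hC, n, hn⟩, rfl⟩
    obtain ⟨U, hU, -, rfl⟩ := mem_markedVoidEvents hV
    have hVm : MeasurableSet {μ : MarkedConfig d | μ.1.toMeasure U = 0} :=
      measurable_markedConfig_iff.1 measurable_id U hU.measurableSet (measurableSet_singleton 0)
    have hCU : MeasurableSet (C \ U) := hC.diff hU.measurableSet
    have hφ : Measurable (({0} : Set ℝ≥0∞).indicator (fun _ => (1 : ℝ≥0∞))) :=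
      measurable_const.indicator (measurableSet_singleton 0)
    have hind : IndepFun (fun ω => (P ω).1.toMeasure U) (fun ω => (P ω).1.toMeasure (C \ U)) Pr := by
      have := hP.indep 2 ![U, C \ U] (by
        intro i
        fin_cases i
        · exact hU.measurableSet
        · exact hCU) (by
        intro i j hij
        fin_cases i <;> fin_cases j
        · exact absurd rfl hij
        · exact disjoint_sdiff_right
        · exact disjoint_sdiff_left
        · exact absurd rfl hij)
      exact this.indepFun (i := 0) (j := 1) (by decide)
    -- If `U` is void, the points in `C` are those in `C \ U`, and their number is independent of
    -- the count in `U`.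
    have hL : ((Pr.map P) ⊗ₘ markedKernel d) ({μ | μ.1.toMeasure U = 0} ×ˢ C) =
        Pr {ω | (P ω).1.toMeasure U = 0} * Λ (C \ U) := by
      have hU0 : MeasurableSet {ω | (P ω).1.toMeasure U = 0} :=
        hP.measurable_count hU.measurableSet (measurableSet_singleton 0)
      rw [hrect1 _ hVm _ hC]
      change ∫⁻ ω in {ω | (P ω).1.toMeasure U = 0}, _ ∂Pr = _
      rw [← lintegral_indicator hU0]
      have : ∀ ω, {ω | (P ω).1.toMeasure U = 0}.indicator (fun ω => (P ω).1.toMeasure C) ω =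
          (((({0} : Set ℝ≥0∞).indicator (fun _ => (1 : ℝ≥0∞))) ∘
            (fun ω => (P ω).1.toMeasure U)) * fun ω => (P ω).1.toMeasure (C \ U)) ω := by
        intro ω
        by_cases h : (P ω).1.toMeasure U = 0
        · rw [indicator_of_mem (show ω ∈ {ω | (P ω).1.toMeasure U = 0} from h)]
          simp [h, measure_sdiff_null]
        · rw [indicator_of_notMem (show ω ∉ {ω | (P ω).1.toMeasure U = 0} from h)]
          simp [h]
      simp_rw [this]
      rw [lintegral_mul_eq_lintegral_mul_lintegral_of_indepFun
        (hφ.comp (hP.measurable_count hU.measurableSet)) (hP.measurable_count hCU)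
        (hind.comp hφ measurable_id)]
      rw [hP.lintegral_count hCU (ne_top_of_le_ne_top (intensity_cover hm n)
        (measure_mono (Set.sdiff_subset.trans hn)))]
      congr 1
      rw [← lintegral_indicator_one hU0]
      rfl
    rw [hL, Measure.map_apply (measurable_addPoint.prodMk measurable_fst) (hVm.prod hC),
      Measure.prod_apply ((measurable_addPoint.prodMk measurable_fst) (hVm.prod hC))]
    -- On the other side, `U` is void after adding `p` iff it was void before and `p ∉ U`. Almost
    -- surely there is no point over the location of `p`, so nothing is removed by `addPoint`.
    have : ∀ᵐ p ∂Λ, Pr.map P (Prod.mk p ⁻¹' ((fun q : (Pos d × ℝ) × MarkedConfig d =>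
        (addPoint q.1 q.2, q.1)) ⁻¹' ({μ | μ.1.toMeasure U = 0} ×ˢ C))) =
        (C \ U).indicator (fun _ => Pr {ω | (P ω).1.toMeasure U = 0}) p := by
      filter_upwards [ae_intensity_pos hm] with p hp
      rw [Measure.map_apply hP.measurable (measurable_prodMk_left
        ((measurable_addPoint.prodMk measurable_fst) (hVm.prod hC)))]
      by_cases hpC : p ∈ C \ U
      · rw [indicator_of_mem hpC]
        refine measure_congr ?_
        filter_upwards [hP.ae_notMem_ground p.1] with ω hω
        refine propext ?_
        change ((addPoint p (P ω)).1.toMeasure U = 0 ∧ p ∈ C) ↔ (P ω).1.toMeasure U = 0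
        rw [toMeasure_addPoint_eq_zero hp hω hU.measurableSet]
        simp [hpC.1, hpC.2]
      · rw [indicator_of_notMem hpC, measure_eq_zero_iff_ae_notMem]
        filter_upwards [hP.ae_notMem_ground p.1] with ω hω h
        change ((addPoint p (P ω)).1.toMeasure U = 0 ∧ p ∈ C) at h
        rw [toMeasure_addPoint_eq_zero hp hω hU.measurableSet] at h
        exact hpC ⟨h.2, h.1.1⟩
    rw [lintegral_congr_ae this, lintegral_indicator_const hCU]

/-- The Mecke equation. -/
theorem IsPoissonProcess.mecke
    (hP : IsPoissonProcess Pr P ((volume : Measure (Pos d)).prod m)) (hm : m (Iic 0) = 0)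
    {h : (Pos d × ℝ) × MarkedConfig d → ℝ≥0∞} (hh : Measurable h) :
    ∫⁻ μ, ∫⁻ p, h (p, μ) ∂μ.1.toMeasure ∂(Pr.map P) =
      ∫⁻ p, ∫⁻ μ, h (p, addPoint p μ) ∂(Pr.map P) ∂((volume : Measure (Pos d)).prod m) := by
  have hprob : IsProbabilityMeasure (Pr.map P) :=
    Measure.isProbabilityMeasure_map hP.measurable.aemeasurable
  have h1 := congrArg (fun M => ∫⁻ q, h (q.2, q.1) ∂M) (hP.compProd_eq hm)
  beta_reduce at h1
  rw [Measure.lintegral_compProd (by fun_prop), lintegral_map (by fun_prop)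
    (measurable_addPoint.prodMk measurable_fst), lintegral_prod] at h1
  · exact h1
  · exact (hh.comp (measurable_fst.prodMk measurable_addPoint)).aemeasurable

/-- Stationarity of a marked Poisson process. -/
theorem IsPoissonProcess.map_shift
    (hP : IsPoissonProcess Pr P ((volume : Measure (Pos d)).prod m)) (hm : m (Iic 0) = 0)
    (z : Pos d) : (Pr.map P).map (MarkedConfig.shift z) = Pr.map P := by
  have hprob : IsProbabilityMeasure (Pr.map P) :=
    Measure.isProbabilityMeasure_map hP.measurable.aemeasurable
  have hs : Measurable (MarkedConfig.shift (d := d) z) :=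
    measurable_shift.comp (measurable_const.prodMk measurable_id)
  have := Measure.isProbabilityMeasure_map hs.aemeasurable (μ := Pr.map P)
  -- Void events determine the law, and the probability that `U` is void depends only on its
  -- intensity, which is invariant under shifts of the location.
  refine ext_of_generate_finite _ generateFrom_markedVoidEvents.symm
    isPiSystem_markedVoidEvents (fun V hV => ?_) (by simp)
  obtain ⟨U, hU, ⟨n, hn⟩, rfl⟩ := mem_markedVoidEvents hV
  have hVm : MeasurableSet {μ : MarkedConfig d | μ.1.toMeasure U = 0} :=
    measurable_markedConfig_iff.1 measurable_id U hU.measurableSet (measurableSet_singleton 0)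
  have hT : MeasurePreserving (fun p : Pos d × ℝ => (p.1 - z, p.2))
      ((volume : Measure (Pos d)).prod m) ((volume : Measure (Pos d)).prod m) :=
    (measurePreserving_sub_right volume z).prod (MeasurePreserving.id m)
  set U' := (fun p : Pos d × ℝ => (p.1 - z, p.2)) ⁻¹' U with hU'
  have hU'm : MeasurableSet U' := hT.measurable hU.measurableSet
  have hU'Λ : ((volume : Measure (Pos d)).prod m) U' = ((volume : Measure (Pos d)).prod m) U :=
    hT.measure_preimage hU.measurableSet.nullMeasurableSet
  have hfin : ((volume : Measure (Pos d)).prod m) U ≠ ∞ :=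
    ne_top_of_le_ne_top (intensity_cover hm n) (measure_mono (hn.trans subset_union_left))
  rw [Measure.map_apply hs hVm, Measure.map_apply hP.measurable (hs hVm),
    Measure.map_apply hP.measurable hVm]
  have h1 : P ⁻¹' (MarkedConfig.shift z ⁻¹' {μ | μ.1.toMeasure U = 0}) =
      {ω | (P ω).1.toMeasure U' = (0 : ℕ)} := by
    ext ω
    change ((P ω).shift z).1.toMeasure U = 0 ↔ (P ω).1.toMeasure U' = (0 : ℕ)
    rw [← lintegral_indicator_one hU.measurableSet, lintegral_shift, Nat.cast_zero,
      ← lintegral_indicator_one hU'm]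
    rfl
  have h2 : P ⁻¹' {μ | μ.1.toMeasure U = 0} = {ω | (P ω).1.toMeasure U = (0 : ℕ)} := by
    simp only [Nat.cast_zero]; rfl
  rw [h1, h2, hP.poisson U' hU'm (by rwa [hU'Λ]), hP.poisson U hU.measurableSet hfin, hU'Λ]

end Poisson

end TailConf

namespace TailConf

variable {d : ℕ} {Ω : Type*} [MeasurableSpace Ω] {Pr : Measure Ω}
  {P : Ω → MarkedConfig d} {m : Measure ℝ} {ζ₀ : Ω → ℝ}
  {Φ : Pos d × PointSet d → PointSet d} {w : Pos d → ℝ}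

/-! ### The Poisson process with an additional point at the origin -/

lemma aemeasurable_addPoint_zero (hP : Measurable P) (hζ₀ : HasLaw ζ₀ m Pr) :
    AEMeasurable (fun ω => addPoint (0, ζ₀ ω) (P ω)) Pr :=
  measurable_addPoint.comp_aemeasurable
    ((aemeasurable_const.prodMk hζ₀.aemeasurable).prodMk hP.aemeasurable)

variable [IsProbabilityMeasure Pr]

lemma lintegral_addPoint_zero (hP : Measurable P) (hζ₀ : HasLaw ζ₀ m Pr)
    (hindep : IndepFun ζ₀ P Pr) {F : MarkedConfig d → ℝ≥0∞} (hF : Measurable F) :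
    ∫⁻ ω, F (addPoint (0, ζ₀ ω) (P ω)) ∂Pr =
      ∫⁻ z, ∫⁻ μ, F (addPoint (0, z) μ) ∂(Pr.map P) ∂m := by
  have hprob : IsProbabilityMeasure (Pr.map P) := Measure.isProbabilityMeasure_map hP.aemeasurable
  have h1 := (indepFun_iff_map_prod_eq_prod_map_map hζ₀.aemeasurable hP.aemeasurable).1 hindep
  rw [hζ₀.map_eq] at h1
  have hG : Measurable fun q : ℝ × MarkedConfig d => F (addPoint (0, q.1) q.2) :=
    hF.comp (measurable_addPoint.comp
      ((measurable_const.prodMk measurable_fst).prodMk measurable_snd))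
  have h2 := lintegral_map' (μ := Pr) hG.aemeasurable
    (hζ₀.aemeasurable.prodMk hP.aemeasurable)
  rw [h1, lintegral_prod _ hG.aemeasurable] at h2
  exact h2.symm

variable [IsProbabilityMeasure m]

/-- The law of `(0, P)` plus the law of `(x, P̃)` with `x` distributed according to Lebesgue
measure: it describes `P̃` seen from one of its points, with that point removed. -/
noncomputable def reducedCampbell {Ω : Type*} [MeasurableSpace Ω] (Pr : Measure Ω)
    (P : Ω → MarkedConfig d) (ζ₀ : Ω → ℝ) :
    Measure (Pos d × MarkedConfig d) :=
  (Measure.dirac 0).prod (Pr.map P) +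
    (volume : Measure (Pos d)).prod (Pr.map fun ω => addPoint (0, ζ₀ ω) (P ω))

lemma measurable_addPoint_zero :
    Measurable fun q : ℝ × MarkedConfig d => addPoint (0, q.1) q.2 :=
  measurable_addPoint.comp ((measurable_const.prodMk measurable_fst).prodMk measurable_snd)

/-- This is the Mecke equation for `P` with the point at the origin as a spectator. Points over the
origin are null for the intensity, so the indicator disappears and the two insertions commute. -/
lemma lintegral_sum_ne_zero
    (hP : IsPoissonProcess Pr P ((volume : Measure (Pos d)).prod m)) (hm : m (Iic 0) = 0)
    {F : (Pos d × ℝ) × MarkedConfig d → ℝ≥0∞} (hF : Measurable F) (z : ℝ) :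
    ∫⁻ μ, ∫⁻ p, {p : Pos d × ℝ | p.1 ≠ 0}.indicator
        (fun p => F (p, addPoint (0, z) μ)) p ∂μ.1.toMeasure ∂(Pr.map P) =
      ∫⁻ p, ∫⁻ μ, F (p, addPoint p (addPoint (0, z) μ)) ∂(Pr.map P)
        ∂((volume : Measure (Pos d)).prod m) := by
  have hns := nullSingletonClass_volume hP.dim_ne_zero
  have hne : ∀ᵐ p ∂((volume : Measure (Pos d)).prod m), p.1 ≠ 0 := by
    have : ((volume : Measure (Pos d)).prod m) ({0} ×ˢ univ) = 0 := by
      rw [Measure.prod_prod, measure_singleton, zero_mul]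
    filter_upwards [measure_eq_zero_iff_ae_notMem.1 this] with p hp
    simpa using hp
  have hH : Measurable fun q : (Pos d × ℝ) × MarkedConfig d =>
      {p : Pos d × ℝ | p.1 ≠ 0}.indicator (fun p => F (p, addPoint (0, z) q.2)) q.1 := by
    refine Measurable.indicator (s := {q : (Pos d × ℝ) × MarkedConfig d | q.1.1 ≠ 0})
      (f := fun q => F (q.1, addPoint (0, z) q.2)) ?_
      (measurableSet_eq_fun (by fun_prop) (by fun_prop)).compl
    exact hF.comp (measurable_fst.prodMk
      (measurable_addPoint_zero.comp (measurable_const.prodMk measurable_snd)))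
  rw [hP.mecke hm hH]
  refine lintegral_congr_ae ?_
  filter_upwards [hne] with p hp
  refine lintegral_congr fun μ => ?_
  rw [indicator_of_mem (show p ∈ {p : Pos d × ℝ | p.1 ≠ 0} from hp), addPoint_comm (Ne.symm hp)]

/-- The integrals are reordered so that `P` and the origin point merge into `P̃`, while the score of
the selected point becomes the innermost variable. -/
lemma lintegral_lintegral_addPoint_addPoint
    (hP : IsPoissonProcess Pr P ((volume : Measure (Pos d)).prod m))
    (hζ₀ : HasLaw ζ₀ m Pr) (hindep : IndepFun ζ₀ P Pr)
    {F : (Pos d × ℝ) × MarkedConfig d → ℝ≥0∞} (hF : Measurable F) :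
    ∫⁻ z, ∫⁻ p, ∫⁻ μ, F (p, addPoint p (addPoint (0, z) μ)) ∂(Pr.map P)
        ∂((volume : Measure (Pos d)).prod m) ∂m =
      ∫⁻ x, ∫⁻ Q, ∫⁻ s, F ((x, s), addPoint (x, s) Q) ∂m
        ∂(Pr.map fun ω => addPoint (0, ζ₀ ω) (P ω)) := by
  have hprob : IsProbabilityMeasure (Pr.map P) :=
    Measure.isProbabilityMeasure_map hP.measurable.aemeasurable
  have hprob' : IsProbabilityMeasure (Pr.map fun ω => addPoint (0, ζ₀ ω) (P ω)) :=
    Measure.isProbabilityMeasure_map (aemeasurable_addPoint_zero hP.measurable hζ₀)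
  have h3 : Measurable fun q : (Pos d × ℝ) × MarkedConfig d => F (q.1, addPoint q.1 q.2) :=
    hF.comp (measurable_fst.prodMk measurable_addPoint)
  have h4 : Measurable fun q : (ℝ × (Pos d × ℝ)) × MarkedConfig d =>
      F (q.1.2, addPoint q.1.2 (addPoint (0, q.1.1) q.2)) :=
    h3.comp ((measurable_snd.comp measurable_fst).prodMk (measurable_addPoint_zero.comp
      ((measurable_fst.comp measurable_fst).prodMk measurable_snd)))
  rw [lintegral_lintegral_swap h4.lintegral_prod_right'.aemeasurable]
  have h2 : ∀ p, ∫⁻ z, ∫⁻ μ, F (p, addPoint p (addPoint (0, z) μ)) ∂(Pr.map P) ∂m =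
      ∫⁻ Q, F (p, addPoint p Q) ∂(Pr.map fun ω => addPoint (0, ζ₀ ω) (P ω)) := by
    intro p
    have hp : Measurable fun μ => F (p, addPoint p μ) := h3.comp measurable_prodMk_left
    rw [lintegral_map' hp.aemeasurable (aemeasurable_addPoint_zero hP.measurable hζ₀)]
    exact (lintegral_addPoint_zero hP.measurable hζ₀ hindep hp).symm
  rw [lintegral_congr h2, lintegral_prod _ h3.lintegral_prod_right'.aemeasurable]
  refine lintegral_congr fun x => lintegral_lintegral_swap ?_
  exact (h3.comp (Measurable.prodMk (measurable_const.prodMk measurable_fst)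
    measurable_snd)).aemeasurable

/-- The Mecke equation for `P̃`. Removing the origin leaves `P`, and removing another point leaves a
copy of `P̃`: these are the two parts of `reducedCampbell`. The point of this form is that the score
`s` of the removed point is integrated with law `m`, whatever `q` is. -/
theorem lintegral_sum_addPoint_zero
    (hP : IsPoissonProcess Pr P ((volume : Measure (Pos d)).prod m)) (hm : m (Iic 0) = 0)
    (hζ₀ : HasLaw ζ₀ m Pr) (hindep : IndepFun ζ₀ P Pr)
    {F : (Pos d × ℝ) × MarkedConfig d → ℝ≥0∞} (hF : Measurable F) :
    ∫⁻ ω, ∫⁻ p, F (p, addPoint (0, ζ₀ ω) (P ω)) ∂(addPoint (0, ζ₀ ω) (P ω)).1.toMeasure ∂Pr =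
      ∫⁻ q, ∫⁻ s, F ((q.1, s), addPoint (q.1, s) q.2) ∂m ∂(reducedCampbell Pr P ζ₀) := by
  have hprob : IsProbabilityMeasure (Pr.map P) :=
    Measure.isProbabilityMeasure_map hP.measurable.aemeasurable
  have hprob' : IsProbabilityMeasure (Pr.map fun ω => addPoint (0, ζ₀ ω) (P ω)) :=
    Measure.isProbabilityMeasure_map (aemeasurable_addPoint_zero hP.measurable hζ₀)
  have hm0 : ∀ᵐ z ∂m, 0 < z := by
    filter_upwards [measure_eq_zero_iff_ae_notMem.1 hm] with z hz
    simpa using hz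
  have hG1 : Measurable fun μ : MarkedConfig d => ∫⁻ p, F (p, μ) ∂μ.1.toMeasure :=
    measurable_lintegral_config (f := fun μ p => F (p, μ)) (hF.comp measurable_swap)
      measurable_subtype_coe
  have hG2 : Measurable fun q : (Pos d × MarkedConfig d) × ℝ =>
      F ((q.1.1, q.2), addPoint (q.1.1, q.2) q.1.2) :=
    hF.comp (Measurable.prodMk (by fun_prop) (measurable_addPoint.comp
      (Measurable.prodMk (by fun_prop) (by fun_prop))))
  have hG3 : Measurable fun q : Pos d × MarkedConfig d =>
      ∫⁻ s, F ((q.1, s), addPoint (q.1, s) q.2) ∂m := hG2.lintegral_prod_right'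
  have hsecond : Measurable fun q : ℝ × MarkedConfig d =>
      (Ioi (0 : ℝ)).indicator (fun _ => F ((0, q.1), addPoint (0, q.1) q.2)) q.1 := by
    refine Measurable.indicator (s := {q : ℝ × MarkedConfig d | q.1 ∈ Ioi 0})
      (f := fun q => F ((0, q.1), addPoint (0, q.1) q.2)) ?_ (measurable_fst measurableSet_Ioi)
    exact hF.comp (Measurable.prodMk (by fun_prop) measurable_addPoint_zero)
  have hsplit : ∀ z, ∫⁻ μ, ∫⁻ p, F (p, addPoint (0, z) μ) ∂(addPoint (0, z) μ).1.toMeasure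
        ∂(Pr.map P) =
      ∫⁻ p, ∫⁻ μ, F (p, addPoint p (addPoint (0, z) μ)) ∂(Pr.map P)
        ∂((volume : Measure (Pos d)).prod m) +
      ∫⁻ μ, (Ioi (0 : ℝ)).indicator (fun _ => F ((0, z), addPoint (0, z) μ)) z ∂(Pr.map P) := by
    intro z
    simp_rw [lintegral_addPoint]
    have hz : Measurable fun μ : MarkedConfig d =>
        (Ioi (0 : ℝ)).indicator (fun _ => F ((0, z), addPoint (0, z) μ)) z :=
      hsecond.comp measurable_prodMk_left
    rw [lintegral_add_right _ hz]
    congr 1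
    exact lintegral_sum_ne_zero hP hm hF z
  rw [lintegral_addPoint_zero hP.measurable hζ₀ hindep hG1, lintegral_congr hsplit,
    lintegral_add_right _ hsecond.lintegral_prod_right',
    lintegral_lintegral_addPoint_addPoint hP hζ₀ hindep hF, reducedCampbell,
    lintegral_add_measure, add_comm, lintegral_prod _ hG3.aemeasurable,
    lintegral_prod _ hG3.aemeasurable, lintegral_dirac' _ hG3.lintegral_prod_right',
    lintegral_lintegral_swap hsecond.aemeasurable]
  congr 1
  refine lintegral_congr fun μ => lintegral_congr_ae ?_
  filter_upwards [hm0] with z hz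
  exact indicator_of_mem hz _

/-! ### Stationarity and Palm version of the moving maxima process -/

lemma isStationary_movingMaxima
    (hP : IsPoissonProcess Pr P ((volume : Measure (Pos d)).prod m)) (hm : m (Iic 0) = 0)
    (hΦ : IsNeighborhood Φ) (hwm : Measurable w) (hw : ∀ t, 0 ≤ w t) :
    IsStationary Pr fun ω => movingMaxima Φ w (P ω) := by
  intro z
  have hs : Measurable (MarkedConfig.shift (d := d) z) :=
    measurable_shift.comp (measurable_const.prodMk measurable_id)
  have hΨ := measurable_movingMaxima hΦ hwm hw
  simp_rw [← movingMaxima_shift hΦ]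
  refine ⟨(hΨ.comp (hs.comp hP.measurable)).aemeasurable,
    (hΨ.comp hP.measurable).aemeasurable, ?_⟩
  change Pr.map (movingMaxima Φ w ∘ MarkedConfig.shift z ∘ P) = Pr.map (movingMaxima Φ w ∘ P)
  rw [← Measure.map_map hΨ (hs.comp hP.measurable), ← Measure.map_map hs hP.measurable,
    hP.map_shift hm, Measure.map_map hΨ hP.measurable]

/-- The map `Ψ` preserves locations and commutes with shifts, so the sum over the moving maxima is a
sum over `P`. The Mecke equation inserts a point at `x`, the shift moves it to the origin, and
stationarity removes the shift of `P`. The intensity is `1`. -/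
lemma isPalmVersion_movingMaxima
    (hP : IsPoissonProcess Pr P ((volume : Measure (Pos d)).prod m)) (hm : m (Iic 0) = 0)
    (hζ₀ : HasLaw ζ₀ m Pr) (hindep : IndepFun ζ₀ P Pr)
    (hΦ : IsNeighborhood Φ) (hwm : Measurable w) (hw : ∀ t, 0 ≤ w t) (hw0 : 0 < w 0) :
    IsPalmVersion Pr (fun ω => movingMaxima Φ w (P ω))
      Pr (fun ω => movingMaxima Φ w (addPoint (0, ζ₀ ω) (P ω))) := by
  have hprob : IsProbabilityMeasure (Pr.map P) :=
    Measure.isProbabilityMeasure_map hP.measurable.aemeasurable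
  have hΨ := measurable_movingMaxima hΦ hwm hw
  refine ⟨(hΨ.comp hP.measurable).aemeasurable,
    hΨ.comp_aemeasurable (aemeasurable_addPoint_zero hP.measurable hζ₀), 1, one_pos, ?_, ?_⟩
  · intro A hA
    have h1 : ∀ ω, (movingMaxima Φ w (P ω)).1.toMeasure (A ×ˢ Ioi 0) =
        ∫⁻ p, A.indicator 1 p.1 ∂(P ω).1.toMeasure := by
      intro ω
      rw [← lintegral_movingMaxima hΦ hw0, ← lintegral_indicator_one (hA.prod measurableSet_Ioi),
        Config.lintegral_toMeasure, Config.lintegral_toMeasure]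
      refine tsum_congr fun p => ?_
      have : (0 : ℝ) < p.1.2 := (movingMaxima Φ w (P ω)).1.pos _ p.2
      by_cases hp : p.1.1 ∈ A
      · rw [indicator_of_mem (show p.1 ∈ A ×ˢ Ioi 0 from ⟨hp, this⟩), indicator_of_mem hp]
        rfl
      · rw [indicator_of_notMem (fun h => hp h.1), indicator_of_notMem hp]
    have hg : Measurable fun q : (Pos d × ℝ) × MarkedConfig d =>
        A.indicator (1 : Pos d → ℝ≥0∞) q.1.1 :=
      (measurable_one.indicator hA).comp (by fun_prop)
    have h2 := hP.mecke hm hg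
    rw [lintegral_map (measurable_lintegral_config (f := fun _ p => A.indicator 1 p.1)
      (hg.comp measurable_swap) measurable_subtype_coe) hP.measurable] at h2
    simp_rw [h1, h2]
    have h3 : ∫⁻ p, A.indicator 1 p.1 ∂((volume : Measure (Pos d)).prod m) = volume A := by
      have : ∀ p : Pos d × ℝ, A.indicator (1 : Pos d → ℝ≥0∞) p.1 =
          (A ×ˢ univ).indicator 1 p := by
        intro p
        by_cases hp : p.1 ∈ A <;> simp [hp, indicator]
      simp_rw [this]
      rw [lintegral_indicator_one (hA.prod .univ), Measure.prod_prod, measure_univ, mul_one]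
    simpa using h3
  · intro h hh
    have hg : Measurable fun q : (Pos d × ℝ) × MarkedConfig d =>
        h (q.1.1, movingMaxima Φ w (q.2.shift q.1.1)) :=
      hh.comp (Measurable.prodMk (by fun_prop)
        (hΨ.comp (measurable_shift.comp (Measurable.prodMk (by fun_prop) measurable_snd))))
    have h1 : ∀ ω, ∑' p : (movingMaxima Φ w (P ω)).1.atoms,
        h (p.1.1, (movingMaxima Φ w (P ω)).shift p.1.1) =
        ∫⁻ p, h (p.1, movingMaxima Φ w ((P ω).shift p.1)) ∂(P ω).1.toMeasure := by
      intro ω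
      rw [← lintegral_movingMaxima hΦ hw0 (P ω)
        (fun t => h (t, movingMaxima Φ w ((P ω).shift t))), Config.lintegral_toMeasure]
      refine tsum_congr fun p => ?_
      rw [movingMaxima_shift hΦ]
    have h2 := hP.mecke hm hg
    rw [lintegral_map (measurable_lintegral_config
      (f := fun (μ : MarkedConfig d) p => h (p.1, movingMaxima Φ w (μ.shift p.1)))
      (hg.comp measurable_swap) measurable_subtype_coe) hP.measurable] at h2
    simp_rw [h1]
    rw [h2, ENNReal.coe_one, one_mul]
    have h3 : ∀ p : Pos d × ℝ, ∫⁻ μ, h (p.1, movingMaxima Φ w ((addPoint p μ).shift p.1))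
        ∂(Pr.map P) = ∫⁻ μ, h (p.1, movingMaxima Φ w (addPoint (0, p.2) μ)) ∂(Pr.map P) := by
      intro p
      have hs : Measurable (MarkedConfig.shift (d := d) p.1) :=
        measurable_shift.comp (measurable_const.prodMk measurable_id)
      conv_rhs => rw [← hP.map_shift hm p.1]
      rw [lintegral_map _ hs]
      · simp_rw [addPoint_shift, sub_self]
      · exact hh.comp (measurable_const.prodMk (hΨ.comp
          (measurable_addPoint.comp (measurable_const.prodMk measurable_id))))
    simp_rw [h3]
    rw [lintegral_prod]
    · refine lintegral_congr fun x => ?_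
      exact (lintegral_addPoint_zero hP.measurable hζ₀ hindep (F := fun μ =>
        h (x, movingMaxima Φ w μ)) (hh.comp (measurable_const.prodMk hΨ))).symm
    · refine Measurable.aemeasurable ?_
      refine Measurable.lintegral_prod_right' (f := fun q : (Pos d × ℝ) × MarkedConfig d =>
        h (q.1.1, movingMaxima Φ w (addPoint (0, q.1.2) q.2))) ?_
      exact hh.comp (Measurable.prodMk (by fun_prop) (hΨ.comp (measurable_addPoint.comp
        (Measurable.prodMk (Measurable.prodMk measurable_const (by fun_prop)) measurable_snd))))

end TailConf

namespace TailConf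

/-! ### Regular variation -/

lemma paretoMeasure_real_Ioi {α : ℝ} (hα : 0 < α) (a : ℝ) :
    (paretoMeasure 1 α).real (Ioi a) = max 1 a ^ (-α) := by
  have hp : IsProbabilityMeasure (paretoMeasure 1 α) :=
    isProbabilityMeasure_paretoMeasure one_pos hα
  have h1 : ∀ a : ℝ, 1 ≤ a → (paretoMeasure 1 α).real (Ioi a) = a ^ (-α) := by
    intro a ha
    have ha0 : 0 < a := by linarith
    rw [measureReal_def, paretoMeasure, withDensity_apply _ measurableSet_Ioi,
      setLIntegral_congr_fun (g := fun x => ENNReal.ofReal (α * x ^ (-(α + 1)))) measurableSet_Ioi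
        (fun x hx => by
          rw [paretoPDF_of_le (ha.trans (le_of_lt hx)), Real.one_rpow, mul_one]),
      ← integral_eq_lintegral_of_nonneg_ae]
    · rw [integral_const_mul, integral_Ioi_rpow_of_lt (by linarith) ha0]
      rw [show -(α + 1) + 1 = -α by ring]
      field_simp
    · rw [EventuallyLE, ae_restrict_iff' measurableSet_Ioi]
      filter_upwards with x hx
      have : 0 < x := ha0.trans hx
      simp only [Pi.zero_apply]
      positivity
    · exact (by fun_prop : Measurable fun x : ℝ => α * x ^ (-(α + 1))).aestronglyMeasurable
  rcases le_total 1 a with ha | ha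
  · rw [h1 a ha, max_eq_right ha]
  · rw [max_eq_left ha, Real.one_rpow]
    refine le_antisymm measureReal_le_one ?_
    have := h1 1 le_rfl
    rw [Real.one_rpow] at this
    exact this.ge.trans (measureReal_mono (Ioi_subset_Ioi ha))

lemma ae_paretoMeasure {α : ℝ} (hα : 0 < α) : ∀ᵐ y ∂(paretoMeasure 1 α), 1 < y := by
  have hp : IsProbabilityMeasure (paretoMeasure 1 α) :=
    isProbabilityMeasure_paretoMeasure one_pos hα
  have h := paretoMeasure_real_Ioi hα 1
  rw [max_self, Real.one_rpow, measureReal_def, ENNReal.toReal_eq_one_iff] at h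
  have h2 := (prob_compl_eq_zero_iff measurableSet_Ioi).2 h
  filter_upwards [measure_eq_zero_iff_ae_notMem.1 h2] with y hy
  simpa using hy

/-- The Pareto distribution with scale `1` as a probability measure. -/
noncomputable def paretoLaw {α : ℝ} (hα : 0 < α) : ProbabilityMeasure ℝ :=
  ⟨paretoMeasure 1 α, isProbabilityMeasure_paretoMeasure one_pos hα⟩

lemma coe_paretoLaw {α : ℝ} (hα : 0 < α) : (paretoLaw hα : Measure ℝ) = paretoMeasure 1 α := rfl

section RegVar

variable {m : Measure ℝ} [IsProbabilityMeasure m] {α : ℝ}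

lemma tail_pos (hreg : IsRegularlyVarying (fun u => m.real (Ioi u)) (-α)) (u : ℝ) :
    0 < m.real (Ioi u) := by
  obtain ⟨v, hv, huv⟩ := (hreg.2.1.and (eventually_ge_atTop u)).exists
  exact hv.trans_le (measureReal_mono (Ioi_subset_Ioi huv))

lemma tail_ne_zero (hreg : IsRegularlyVarying (fun u => m.real (Ioi u)) (-α)) (u : ℝ) :
    m (Ioi u) ≠ 0 := fun h => (tail_pos hreg u).ne' (by rw [measureReal_def, h]; rfl)

/-- The law of `s / u`, conditionally on `s > u`. -/
noncomputable def excessLaw (m : Measure ℝ) [IsProbabilityMeasure m] {α : ℝ}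
    (hreg : IsRegularlyVarying (fun u => m.real (Ioi u)) (-α)) (u : ℝ) : ProbabilityMeasure ℝ :=
  ⟨(cond m (Ioi u)).map fun s => s / u,
    have := cond_isProbabilityMeasure (tail_ne_zero hreg u)
    Measure.isProbabilityMeasure_map (by fun_prop)⟩

lemma lintegral_excessLaw (hreg : IsRegularlyVarying (fun u => m.real (Ioi u)) (-α)) (u : ℝ)
    {f : ℝ → ℝ≥0∞} (hf : Measurable f) :
    ∫⁻ y, f y ∂(excessLaw m hreg u : Measure ℝ) =
      (m (Ioi u))⁻¹ * ∫⁻ s in Ioi u, f (s / u) ∂m := by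
  change ∫⁻ y, f y ∂(cond m (Ioi u)).map (fun s => s / u) = _
  rw [lintegral_map hf (by fun_prop), ProbabilityTheory.cond, lintegral_smul_measure, smul_eq_mul]

lemma excessLaw_real_Ioi (hreg : IsRegularlyVarying (fun u => m.real (Ioi u)) (-α)) {u : ℝ}
    (hu : 0 < u) (a : ℝ) : (excessLaw m hreg u : Measure ℝ).real (Ioi a) =
      m.real (Ioi (u * max 1 a)) / m.real (Ioi u) := by
  rw [measureReal_def, ← lintegral_indicator_one measurableSet_Ioi,
    lintegral_excessLaw hreg u (measurable_one.indicator measurableSet_Ioi)]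
  have : ∀ s, (Ioi a).indicator (1 : ℝ → ℝ≥0∞) (s / u) = (Ioi (u * a)).indicator 1 s := by
    intro s
    have : s / u ∈ Ioi a ↔ s ∈ Ioi (u * a) := by
      simp only [mem_Ioi, lt_div_iff₀ hu, mul_comm]
    by_cases h : s ∈ Ioi (u * a)
    · rw [indicator_of_mem h, indicator_of_mem (this.2 h)]; rfl
    · rw [indicator_of_notMem h, indicator_of_notMem (mt this.1 h)]
  simp_rw [this]
  rw [lintegral_indicator_one measurableSet_Ioi, Measure.restrict_apply measurableSet_Ioi,
    Ioi_inter_Ioi, ENNReal.toReal_mul, ENNReal.toReal_inv, mul_comm, ← div_eq_mul_inv]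
  rw [mul_max_of_nonneg _ _ hu.le, mul_one, sup_comm]
  rfl

/-- The intervals `(a, b]` form a π-system containing small neighborhoods of every point, so
convergence of their masses is enough. These are differences of tails, where regular variation
applies directly. -/
lemma tendsto_excessLaw (hα : 0 < α) (hreg : IsRegularlyVarying (fun u => m.real (Ioi u)) (-α)) :
    Tendsto (excessLaw m hreg) atTop (𝓝 (paretoLaw hα)) := by
  have hp : IsProbabilityMeasure (paretoMeasure 1 α) :=
    isProbabilityMeasure_paretoMeasure one_pos hα
  refine IsPiSystem.tendsto_probabilityMeasure_of_tendsto_of_mem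
    (S := {S | ∃ a b : ℝ, a < b ∧ Ioc a b = S}) (isPiSystem_Ioc id id) ?_ ?_ ?_
  · rintro _ ⟨a, b, -, rfl⟩
    exact measurableSet_Ioc
  · intro u hu x hx
    obtain ⟨ε, hε, hsub⟩ := Metric.isOpen_iff.1 hu x hx
    refine ⟨_, ⟨x - ε / 2, x + ε / 2, by linarith, rfl⟩, Ioc_mem_nhds (by linarith)
      (by linarith), fun y hy => hsub ?_⟩
    rw [Real.ball_eq_Ioo]
    exact ⟨by linarith [hy.1], by linarith [hy.2]⟩
  · rintro _ ⟨a, b, hab, rfl⟩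
    have hIoi : ∀ a : ℝ, Tendsto (fun u => (excessLaw m hreg u : Measure ℝ).real (Ioi a)) atTop
        (𝓝 ((paretoMeasure 1 α).real (Ioi a))) := by
      intro a
      rw [paretoMeasure_real_Ioi hα]
      refine (hreg.2.2 (max 1 a) (by positivity)).congr' ?_
      filter_upwards [eventually_gt_atTop 0] with u hu
      rw [excessLaw_real_Ioi hreg hu]
    have hIoc : ∀ μ : ProbabilityMeasure ℝ, ((μ (Ioc a b) : ℝ≥0) : ℝ) =
        (μ : Measure ℝ).real (Ioi a) - (μ : Measure ℝ).real (Ioi b) := by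
      intro μ
      rw [← ProbabilityMeasure.measureReal_eq_coe_coeFn, ← Ioi_sdiff_Ioi,
        measureReal_sdiff (Ioi_subset_Ioi hab.le) measurableSet_Ioi]
    rw [← NNReal.tendsto_coe, hIoc, coe_paretoLaw]
    simp_rw [hIoc]
    exact (hIoi a).sub (hIoi b)

/-- The integrand may depend on `u` through `1/u`, the factor by which the bounded remaining scores
are shrunk. Taking the product with the Dirac mass at `1/u` reduces this to weak convergence of
product laws. -/
lemma tendsto_lintegral_excessLaw (hα : 0 < α)
    (hreg : IsRegularlyVarying (fun u => m.real (Ioi u)) (-α)) (G : ℝ × ℝ →ᵇ ℝ≥0) :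
    Tendsto (fun u => ∫⁻ y, G (y, 1 / u) ∂(excessLaw m hreg u : Measure ℝ)) atTop
      (𝓝 (∫⁻ y, G (y, 0) ∂(paretoMeasure 1 α))) := by
  have hp : IsProbabilityMeasure (paretoMeasure 1 α) :=
    isProbabilityMeasure_paretoMeasure one_pos hα
  have h1 : Tendsto (fun u : ℝ => diracProba (1 / u)) atTop (𝓝 (diracProba 0)) :=
    (continuous_diracProba.tendsto _).comp (tendsto_const_nhds.div_atTop tendsto_id)
  have h2 := (ProbabilityMeasure.continuous_prod.tendsto _).comp
    ((tendsto_excessLaw hα hreg).prodMk_nhds h1)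
  have h3 := ProbabilityMeasure.tendsto_iff_forall_lintegral_tendsto.1 h2 G
  have hG : Measurable fun q : ℝ × ℝ => (G q : ℝ≥0∞) :=
    G.continuous.measurable.coe_nnreal_ennreal
  have h4 : ∀ (μ : ProbabilityMeasure ℝ) (x : ℝ),
      ∫⁻ q, G q ∂((μ.prod (diracProba x) : ProbabilityMeasure (ℝ × ℝ)) : Measure (ℝ × ℝ)) =
        ∫⁻ y, G (y, x) ∂(μ : Measure ℝ) := by
    intro μ x
    rw [ProbabilityMeasure.toMeasure_prod, lintegral_prod _ hG.aemeasurable]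
    refine lintegral_congr fun y => ?_
    exact lintegral_dirac' x (hG.comp measurable_prodMk_left)
  simp only [Function.comp_def, h4] at h3
  exact h3

/-- Karamata-type convergence of integrals over the tail of a regularly varying law. -/
theorem tendsto_lintegral_tail (hα : 0 < α)
    (hreg : IsRegularlyVarying (fun u => m.real (Ioi u)) (-α)) (G : ℝ × ℝ →ᵇ ℝ≥0) {c : ℝ}
    (hc : 0 < c) :
    Tendsto (fun u => (m (Ioi u))⁻¹ * ∫⁻ s in Ioi (u * c), G (s / u, 1 / u) ∂m) atTop
      (𝓝 (ENNReal.ofReal (c ^ (-α)) * ∫⁻ y, G (c * y, 0) ∂(paretoMeasure 1 α))) := by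
  -- The level `u * c` is used in place of `u`: `s/u = c · s/(uc)` and `1/u = c · 1/(uc)`. Passing
  -- from the tail at `u` to that at `u * c` contributes `c ^ (-α)`.
  let G' : ℝ × ℝ →ᵇ ℝ≥0 := G.compContinuous ⟨fun q => (c * q.1, c * q.2), by fun_prop⟩
  have hG : Measurable fun q : ℝ × ℝ => (G q : ℝ≥0∞) :=
    G.continuous.measurable.coe_nnreal_ennreal
  have h1 := (tendsto_lintegral_excessLaw hα hreg G').comp
    (tendsto_id.atTop_mul_const hc)
  have h2 : Tendsto (fun u => ENNReal.ofReal (m.real (Ioi (u * c)) / m.real (Ioi u))) atTop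
      (𝓝 (ENNReal.ofReal (c ^ (-α)))) :=
    (ENNReal.continuous_ofReal.tendsto _).comp (hreg.2.2 c hc)
  have hfin : ∫⁻ y, G' (y, 0) ∂(paretoMeasure 1 α) ≠ ∞ := by
    have hp : IsProbabilityMeasure (paretoMeasure 1 α) :=
      isProbabilityMeasure_paretoMeasure one_pos hα
    exact (BoundedContinuousFunction.lintegral_lt_top_of_nnreal (paretoMeasure 1 α)
      (G'.compContinuous ⟨fun y : ℝ => (y, (0 : ℝ)), by fun_prop⟩)).ne
  have h3 := ENNReal.Tendsto.mul h2 (Or.inr hfin) h1 (Or.inr ENNReal.ofReal_ne_top)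
  simp only [G', BoundedContinuousFunction.compContinuous_apply, ContinuousMap.coe_mk,
    mul_zero] at h3
  refine h3.congr' ?_
  filter_upwards [eventually_gt_atTop 0] with u hu
  simp only [Function.comp_def, id_eq]
  rw [lintegral_excessLaw hreg (u * c) (f := fun y => (G (c * y, c * (1 / (u * c))) : ℝ≥0∞))
    (hG.comp (by fun_prop)), ENNReal.ofReal_div_of_pos (tail_pos hreg u),
    measureReal_def, measureReal_def, ENNReal.ofReal_toReal (measure_ne_top _ _),
    ENNReal.ofReal_toReal (measure_ne_top _ _), ENNReal.div_eq_inv_mul, mul_assoc,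
    ← mul_assoc (m (Ioi (u * c))), ENNReal.mul_inv_cancel (tail_ne_zero hreg _)
    (measure_ne_top _ _), one_mul]
  congr 1
  refine lintegral_congr fun s => ?_
  congr 3 <;> field_simp

end RegVar

end TailConf

namespace TailConf

variable {d : ℕ} {Ω : Type*} [MeasurableSpace Ω] {Pr : Measure Ω}
  {P : Ω → MarkedConfig d} {m : Measure ℝ} {ζ₀ : Ω → ℝ}
  {Φ : Pos d × PointSet d → PointSet d} {w : Pos d → ℝ}

/-! ### The neighborhood of the origin -/

/-- The locations of `μ` together with `x`. -/
def locs (q : Pos d × MarkedConfig d) : PointSet d := (addPoint (q.1, 1) q.2).ground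

lemma ground_addPoint {x : Pos d} {s : ℝ} {μ : MarkedConfig d} (hs : 0 < s) :
    (addPoint (x, s) μ).ground = locs (x, μ) := ground_addPoint_eq hs one_pos

lemma mem_locs {q : Pos d × MarkedConfig d} {t : Pos d} :
    t ∈ (locs q).pts ↔ t ∈ q.2.ground.pts ∨ t = q.1 :=
  mem_ground_addPoint (p := (q.1, 1)) one_pos

lemma measurable_locs : Measurable (locs (d := d)) :=
  measurable_ground.comp (measurable_addPoint.comp
    (Measurable.prodMk (by fun_prop) measurable_snd))

lemma ae_pos_of_hasLaw (hm : m (Iic 0) = 0) (hζ₀ : HasLaw ζ₀ m Pr) : ∀ᵐ ω ∂Pr, 0 < ζ₀ ω := by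
  have h : Pr (ζ₀ ⁻¹' Iic 0) = 0 := by
    rw [← Measure.map_apply_of_aemeasurable hζ₀.aemeasurable measurableSet_Iic, hζ₀.map_eq, hm]
  filter_upwards [measure_eq_zero_iff_ae_notMem.1 h] with ω hω
  simpa using hω

lemma ae_zero_mem_ground (hm : m (Iic 0) = 0) (hζ₀ : HasLaw ζ₀ m Pr) :
    ∀ᵐ ω ∂Pr, (0 : Pos d) ∈ (addPoint (0, ζ₀ ω) (P ω)).ground.pts := by
  filter_upwards [ae_pos_of_hasLaw hm hζ₀] with ω hω
  exact (mem_ground_addPoint (p := (0, ζ₀ ω)) hω).2 (Or.inr rfl)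

lemma ae_reducedCampbell [IsProbabilityMeasure Pr] (hP : Measurable P) (hm : m (Iic 0) = 0)
    (hζ₀ : HasLaw ζ₀ m Pr) :
    ∀ᵐ q ∂(reducedCampbell Pr P ζ₀), (0 : Pos d) ∈ (locs q).pts := by
  have hprob : IsProbabilityMeasure (Pr.map P) := Measure.isProbabilityMeasure_map hP.aemeasurable
  have hprob' : IsProbabilityMeasure (Pr.map fun ω => addPoint (0, ζ₀ ω) (P ω)) :=
    Measure.isProbabilityMeasure_map (aemeasurable_addPoint_zero hP hζ₀)
  rw [reducedCampbell, ae_add_measure_iff]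
  constructor
  · rw [Measure.dirac_prod, ae_map_iff measurable_prodMk_left.aemeasurable
      (measurableSet_mem_pts measurable_const measurable_locs)]
    exact ae_of_all _ fun Q => mem_locs.2 (Or.inr rfl)
  · have h : ∀ᵐ Q ∂(Pr.map fun ω => addPoint (0, ζ₀ ω) (P ω)), (0 : Pos d) ∈ Q.ground.pts := by
      rw [ae_map_iff (aemeasurable_addPoint_zero hP hζ₀)
        (measurableSet_mem_pts measurable_const measurable_ground)]
      exact ae_zero_mem_ground hm hζ₀
    filter_upwards [Measure.quasiMeasurePreserving_snd.ae h] with q hq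
    exact mem_locs.2 (Or.inl hq)

lemma tsum_neighborhood (hΦ : IsNeighborhood Φ) {μ : MarkedConfig d}
    (h0 : (0 : Pos d) ∈ μ.ground.pts) (K : Pos d → ℝ≥0∞) :
    ∑' x : (Φ (0, μ.ground)).pts, K x =
      ∫⁻ p, (Φ (0, μ.ground)).pts.indicator K p.1 ∂μ.1.toMeasure := by
  rw [← lintegral_ground, PointSet.lintegral_toMeasure,
    tsum_subtype μ.ground.pts ((Φ (0, μ.ground)).pts.indicator K), indicator_indicator,
    inter_eq_self_of_subset_right (hΦ.subset _ _ h0),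
    tsum_subtype (Φ (0, μ.ground)).pts K]

lemma measurable_indicator_neighborhood (hΦ : IsNeighborhood Φ) {α : Type*} [MeasurableSpace α]
    {x : α → Pos d} {A : α → PointSet d} (hx : Measurable x) (hA : Measurable A)
    {K : Pos d × PointSet d → ℝ≥0∞} (hK : Measurable K) :
    Measurable fun a => (Φ (0, A a)).pts.indicator (fun x => K (x, A a)) (x a) := by
  refine Measurable.indicator (s := {a | x a ∈ (Φ (0, A a)).pts})
    (f := fun a => K (x a, A a)) (hK.comp (hx.prodMk hA)) ?_
  exact measurableSet_mem_neighborhood hΦ hx measurable_const hA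

/-- Sums over the neighborhood of the origin as integrals. -/
lemma lintegral_tsum_neighborhood [IsProbabilityMeasure Pr] [IsProbabilityMeasure m]
    (hP : IsPoissonProcess Pr P ((volume : Measure (Pos d)).prod m)) (hm : m (Iic 0) = 0)
    (hζ₀ : HasLaw ζ₀ m Pr) (hindep : IndepFun ζ₀ P Pr) (hΦ : IsNeighborhood Φ)
    {K : Pos d × PointSet d → ℝ≥0∞} (hK : Measurable K) :
    ∫⁻ ω, ∑' x : (Φ (0, (addPoint (0, ζ₀ ω) (P ω)).ground)).pts,
        K (x, (addPoint (0, ζ₀ ω) (P ω)).ground) ∂Pr =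
      ∫⁻ q, (Φ (0, locs q)).pts.indicator (fun x => K (x, locs q)) q.1
        ∂(reducedCampbell Pr P ζ₀) := by
  have h1 : ∀ᵐ ω ∂Pr, ∑' x : (Φ (0, (addPoint (0, ζ₀ ω) (P ω)).ground)).pts,
        K (x, (addPoint (0, ζ₀ ω) (P ω)).ground) =
      ∫⁻ p, (Φ (0, (addPoint (0, ζ₀ ω) (P ω)).ground)).pts.indicator
        (fun x => K (x, (addPoint (0, ζ₀ ω) (P ω)).ground)) p.1
        ∂(addPoint (0, ζ₀ ω) (P ω)).1.toMeasure := by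
    filter_upwards [ae_zero_mem_ground (P := P) hm hζ₀] with ω hω
    exact tsum_neighborhood hΦ hω (fun x => K (x, (addPoint (0, ζ₀ ω) (P ω)).ground))
  have hF : Measurable fun r : (Pos d × ℝ) × MarkedConfig d =>
      (Φ (0, r.2.ground)).pts.indicator (fun x => K (x, r.2.ground)) r.1.1 :=
    measurable_indicator_neighborhood hΦ (by fun_prop) (measurable_ground.comp measurable_snd) hK
  rw [lintegral_congr_ae h1, lintegral_sum_addPoint_zero hP hm hζ₀ hindep hF]
  refine lintegral_congr fun q => ?_
  -- The set of locations is the same for all positive `s`, so the integral over `s` has no effect.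
  have h2 : ∀ᵐ s ∂m, (Φ (0, (addPoint (q.1, s) q.2).ground)).pts.indicator
      (fun x => K (x, (addPoint (q.1, s) q.2).ground)) q.1 =
      (Φ (0, locs q)).pts.indicator (fun x => K (x, locs q)) q.1 := by
    filter_upwards [measure_eq_zero_iff_ae_notMem.1 hm] with s hs
    rw [ground_addPoint (by simpa using hs)]
  rw [lintegral_congr_ae h2, lintegral_const, measure_univ, mul_one]

/-! ### Large scores in the neighborhood of the origin -/

/-- The points in the neighborhood of the origin whose weighted score exceeds `u`. -/
def largePoints (Φ : Pos d × PointSet d → PointSet d) (w : Pos d → ℝ) (u : ℝ)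
    (μ : MarkedConfig d) : Set (Pos d × ℝ) :=
  {p | p.1 ∈ (Φ (0, μ.ground)).pts ∧ u < w p.1 * p.2}

lemma measurableSet_largePoints (hΦ : IsNeighborhood Φ) (hwm : Measurable w) (u : ℝ) :
    MeasurableSet {r : (Pos d × ℝ) × MarkedConfig d | r.1 ∈ largePoints Φ w u r.2} := by
  have h1 : MeasurableSet {r : (Pos d × ℝ) × MarkedConfig d | r.1.1 ∈ (Φ (0, r.2.ground)).pts} :=
    measurableSet_mem_neighborhood hΦ (by fun_prop) measurable_const
      (measurable_ground.comp measurable_snd)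
  have h2 : MeasurableSet {r : (Pos d × ℝ) × MarkedConfig d | u < w r.1.1 * r.1.2} :=
    measurableSet_lt measurable_const (by fun_prop)
  exact h1.inter h2

lemma toMeasure_largePoints_ne_top (hΦ : IsNeighborhood Φ) (u : ℝ) {μ : MarkedConfig d}
    (h0 : (0 : Pos d) ∈ μ.ground.pts) :
    ∫⁻ p, (largePoints Φ w u μ).indicator 1 p ∂μ.1.toMeasure ≠ ∞ := by
  have h1 : ∫⁻ p, (largePoints Φ w u μ).indicator 1 p ∂μ.1.toMeasure ≤
      ∫⁻ p, (Φ (0, μ.ground)).pts.indicator (fun _ => 1) p.1 ∂μ.1.toMeasure := by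
    refine lintegral_mono fun p => ?_
    by_cases hp : p ∈ largePoints Φ w u μ
    · rw [indicator_of_mem hp, indicator_of_mem hp.1]; rfl
    · rw [indicator_of_notMem hp]; exact zero_le
  refine ne_top_of_le_ne_top ?_ h1
  rw [← tsum_neighborhood hΦ h0 (fun _ => 1), ENNReal.tsum_set_one]
  simpa using hΦ.finite _ _ h0

lemma toMeasure_largePoints_ne_zero (hΦ : IsNeighborhood Φ) (u : ℝ) {μ : MarkedConfig d}
    (h0 : (0 : Pos d) ∈ μ.ground.pts) :
    ∫⁻ p, (largePoints Φ w u μ).indicator 1 p ∂μ.1.toMeasure ≠ 0 ↔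
      u < movingMaxScore Φ w μ 0 := by
  rw [ne_eq, Config.lintegral_eq_zero, lt_movingMaxScore_iff hΦ h0]
  simp [largePoints]

/-- The contribution of a large point to a functional on the event that the score at the origin
exceeds `u`; the event is split evenly among the large points. -/
noncomputable def share (Φ : Pos d × PointSet d → PointSet d) (w : Pos d → ℝ)
    (H : Config d → ℝ≥0∞) (u : ℝ) (r : (Pos d × ℝ) × MarkedConfig d) : ℝ≥0∞ :=
  (largePoints Φ w u r.2).indicator (fun _ => H ((movingMaxima Φ w r.2).1.scale 1 u) /
    ∫⁻ p, (largePoints Φ w u r.2).indicator 1 p ∂r.2.1.toMeasure) r.1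

lemma measurable_share (hΦ : IsNeighborhood Φ) (hwm : Measurable w) (hw : ∀ t, 0 ≤ w t)
    {H : Config d → ℝ≥0∞} (hH : Measurable H) (u : ℝ) : Measurable (share Φ w H u) := by
  refine Measurable.indicator (s := {r : (Pos d × ℝ) × MarkedConfig d |
    r.1 ∈ largePoints Φ w u r.2}) (f := fun r => H ((movingMaxima Φ w r.2).1.scale 1 u) /
    ∫⁻ p, (largePoints Φ w u r.2).indicator 1 p ∂r.2.1.toMeasure) ?_
    (measurableSet_largePoints hΦ hwm u)
  refine Measurable.div ?_ ?_
  · exact hH.comp (measurable_scale_one.comp (measurable_const.prodMk (measurable_subtype_coe.comp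
      ((measurable_movingMaxima hΦ hwm hw).comp measurable_snd))))
  · have : Measurable fun μ : MarkedConfig d =>
        ∫⁻ p, (largePoints Φ w u μ).indicator 1 p ∂μ.1.toMeasure := by
      refine measurable_lintegral_config ?_ measurable_subtype_coe
      exact Measurable.indicator (s := {r : MarkedConfig d × (Pos d × ℝ) |
        r.2 ∈ largePoints Φ w u r.1}) (f := 1) measurable_one
        (measurable_swap (measurableSet_largePoints hΦ hwm u))
    exact this.comp measurable_snd

/-- The number of large points is finite, and it is nonzero exactly when the score at the origin
exceeds `u`, so the shares add up to the whole. This writes the event as a sum over points, as the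
Mecke equation requires. -/
lemma lintegral_share (hΦ : IsNeighborhood Φ) (H : Config d → ℝ≥0∞) (u : ℝ) {μ : MarkedConfig d}
    (h0 : (0 : Pos d) ∈ μ.ground.pts) :
    ∫⁻ p, share Φ w H u (p, μ) ∂μ.1.toMeasure =
      {μ | u < movingMaxScore Φ w μ 0}.indicator
        (fun μ => H ((movingMaxima Φ w μ).1.scale 1 u)) μ := by
  have h1 : ∀ p, share Φ w H u (p, μ) = H ((movingMaxima Φ w μ).1.scale 1 u) /
      (∫⁻ p, (largePoints Φ w u μ).indicator 1 p ∂μ.1.toMeasure) *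
        (largePoints Φ w u μ).indicator 1 p := by
    intro p
    by_cases hp : p ∈ largePoints Φ w u μ <;> simp [share, hp]
  simp_rw [h1, Config.lintegral_toMeasure μ.1
    (fun p => H ((movingMaxima Φ w μ).1.scale 1 u) /
      (∫⁻ p, (largePoints Φ w u μ).indicator 1 p ∂μ.1.toMeasure) *
        (largePoints Φ w u μ).indicator 1 p)]
  rw [ENNReal.tsum_mul_left, ← Config.lintegral_toMeasure μ.1]
  by_cases hu : u < movingMaxScore Φ w μ 0
  · rw [indicator_of_mem (show μ ∈ {μ | u < movingMaxScore Φ w μ 0} from hu),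
      ENNReal.div_mul_cancel ((toMeasure_largePoints_ne_zero hΦ u h0).2 hu)
        (toMeasure_largePoints_ne_top hΦ u h0)]
  · rw [indicator_of_notMem (show μ ∉ {μ | u < movingMaxScore Φ w μ 0} from hu),
      not_not.1 (mt (toMeasure_largePoints_ne_zero hΦ u h0).1 hu), mul_zero]

end TailConf

/-! ### Contribution of one large score: limit, domination and integration -/

namespace TailConf

variable {d : ℕ} {Ω : Type*} [MeasurableSpace Ω] {Pr : Measure Ω}
  {P : Ω → MarkedConfig d} {m : Measure ℝ} {ζ₀ : Ω → ℝ}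
  {Φ : Pos d × PointSet d → PointSet d} {w : Pos d → ℝ}

lemma mem_largePoints_addPoint {u : ℝ} {x : Pos d} {s : ℝ} {Q : MarkedConfig d} (hs : 0 < s)
    {p : Pos d × ℝ} : p ∈ largePoints Φ w u (addPoint (x, s) Q) ↔
      p.1 ∈ (Φ (0, locs (x, Q))).pts ∧ u < w p.1 * p.2 := by
  rw [← ground_addPoint hs]; rfl

lemma one_le_toMeasure_largePoints {u : ℝ} {x : Pos d} {s : ℝ} {Q : MarkedConfig d} (hs : 0 < s)
    (h : (x, s) ∈ largePoints Φ w u (addPoint (x, s) Q)) :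
    1 ≤ ∫⁻ p, (largePoints Φ w u (addPoint (x, s) Q)).indicator 1 p
      ∂(addPoint (x, s) Q).1.toMeasure := by
  rw [lintegral_addPoint, indicator_of_mem (show (x, s).2 ∈ Ioi 0 from hs), indicator_of_mem h]
  exact le_add_self

/-- Above the largest contribution of the other points only `x` can be responsible for the
exceedance, so it receives the whole share. -/
lemma toMeasure_largePoints_eq_one (hΦ : IsNeighborhood Φ) {u : ℝ} {x : Pos d} {s : ℝ}
    {Q : MarkedConfig d} (hs : 0 < s) (h0 : (0 : Pos d) ∈ (locs (x, Q)).pts)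
    (hr : restScore Φ w (locs (x, Q)) Q x 0 ≤ u)
    (h : (x, s) ∈ largePoints Φ w u (addPoint (x, s) Q)) :
    ∫⁻ p, (largePoints Φ w u (addPoint (x, s) Q)).indicator 1 p
      ∂(addPoint (x, s) Q).1.toMeasure = 1 := by
  rw [lintegral_addPoint, indicator_of_mem (show (x, s).2 ∈ Ioi 0 from hs), indicator_of_mem h,
    Pi.one_apply]
  convert zero_add (1 : ℝ≥0∞)
  rw [Config.lintegral_eq_zero]
  intro p hp
  by_cases hpx : p.1 ≠ x
  · rw [indicator_of_mem (show p ∈ {q | q.1 ≠ (x, s).1} from hpx), indicator_of_notMem]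
    rw [mem_largePoints_addPoint hs]
    rintro ⟨h1, h2⟩
    have h3 : w p.1 * p.2 ≤ restScore Φ w (locs (x, Q)) Q x 0 := by
      refine le_csSup (((hΦ.finite _ _ h0).subset sdiff_subset).image _).bddAbove
        ⟨p.1, ⟨h1, hpx⟩, ?_⟩
      simp [Config.score_eq (show (p.1, p.2) ∈ Q.1.atoms from hp)]
    linarith
  · rw [indicator_of_notMem (show p ∉ {q | q.1 ≠ (x, s).1} from hpx)]

/-- The dominating bound. A large point counts itself, so the divisor is at least `1`; and as `w ≤
c`, its score exceeds `u / c`. -/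
lemma share_le {H : Config d → ℝ≥0∞} {C : ℝ≥0∞} (hH : ∀ μ, H μ ≤ C) {c u : ℝ} (hc : 0 < c)
    (hwc : ∀ t, w t ≤ c) {x : Pos d} {s : ℝ} (hs : 0 < s) (Q : MarkedConfig d) :
    share Φ w H u ((x, s), addPoint (x, s) Q) ≤
      (Φ (0, locs (x, Q))).pts.indicator (fun _ => C) x * (Ioi (u * c⁻¹)).indicator 1 s := by
  by_cases h : (x, s) ∈ largePoints Φ w u (addPoint (x, s) Q)
  · have h' := (mem_largePoints_addPoint hs).1 h
    have hsu : s ∈ Ioi (u * c⁻¹) := by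
      rw [mem_Ioi, ← div_eq_mul_inv, div_lt_iff₀ hc]
      have h1 := h'.2
      have h2 := mul_le_mul_of_nonneg_right (hwc x) hs.le
      simp only at h1
      linarith
    rw [share, indicator_of_mem h, indicator_of_mem h'.1, indicator_of_mem hsu, Pi.one_apply,
      mul_one]
    refine (ENNReal.div_le_of_le_mul ?_)
    calc _ ≤ C := hH _
      _ = C * 1 := (mul_one C).symm
      _ ≤ _ := by gcongr; exact one_le_toMeasure_largePoints hs h
  · rw [share, indicator_of_notMem h]
    exact zero_le

/-- For large `u` the share has the shape handled by `tendsto_lintegral_tail`: a function of `(s/u,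
1/u)` on the event `s > u / w(x)`. -/
lemma share_addPoint (hΦ : IsNeighborhood Φ) (hw : ∀ t, 0 ≤ w t) (H : Config d → ℝ≥0∞)
    {u : ℝ} (hu : 0 < u) {x : Pos d} {s : ℝ} {Q : MarkedConfig d} (hs : 0 < s)
    (h0 : (0 : Pos d) ∈ (locs (x, Q)).pts) (hr : restScore Φ w (locs (x, Q)) Q x 0 ≤ u)
    (hx : x ∈ (Φ (0, locs (x, Q))).pts) (hwx : 0 < w x) :
    share Φ w H u ((x, s), addPoint (x, s) Q) = (Ioi (u * (w x)⁻¹)).indicator (fun s =>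
      H (ofScores (locs (x, Q)) fun t => max (clusterWeight Φ w (locs (x, Q)) x t * (s / u))
        (restScore Φ w (locs (x, Q)) Q x t * (1 / u))).1) s := by
  have hiff : (x, s) ∈ largePoints Φ w u (addPoint (x, s) Q) ↔ s ∈ Ioi (u * (w x)⁻¹) := by
    rw [mem_largePoints_addPoint hs, mem_Ioi, ← div_eq_mul_inv, div_lt_iff₀ hwx, mul_comm s]
    exact and_iff_right hx
  by_cases h : (x, s) ∈ largePoints Φ w u (addPoint (x, s) Q)
  · rw [share, indicator_of_mem h, indicator_of_mem (hiff.1 h),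
      toMeasure_largePoints_eq_one hΦ hs h0 hr h, div_one, movingMaxima, scale_one_ofScores hu,
      ground_addPoint hs]
    congr 2
    refine ofScores_congr fun t ht => ?_
    rw [movingMaxScore_addPoint hΦ hw hs (ground_addPoint hs) ht, ← max_div_div_right hu.le,
      mul_div_assoc, mul_one_div]
  · rw [share, indicator_of_notMem h, indicator_of_notMem (mt hiff.2 h)]

lemma share_addPoint_eq_zero (H : Config d → ℝ≥0∞) {u : ℝ} (hu : 0 < u) {x : Pos d} {s : ℝ}
    {Q : MarkedConfig d} (hs : 0 < s) (h : x ∉ (Φ (0, locs (x, Q))).pts ∨ w x = 0) :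
    share Φ w H u ((x, s), addPoint (x, s) Q) = 0 := by
  rw [share, indicator_of_notMem]
  rw [mem_largePoints_addPoint hs]
  rintro ⟨h1, h2⟩
  rcases h with h | h
  · exact h h1
  · simp only [h, zero_mul] at h2
    linarith

/-- The density of the law of the location of the large score. -/
noncomputable def largeDensity (Φ : Pos d × PointSet d → PointSet d) (w : Pos d → ℝ) (α : ℝ)
    (q : Pos d × MarkedConfig d) : ℝ≥0∞ :=
  (Φ (0, locs q)).pts.indicator (fun x => ENNReal.ofReal (w x ^ α)) q.1

lemma measurable_largeDensity (hΦ : IsNeighborhood Φ) (hwm : Measurable w) (α : ℝ) :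
    Measurable (largeDensity Φ w α) :=
  measurable_indicator_neighborhood hΦ measurable_fst measurable_locs
    (K := fun r => ENNReal.ofReal (w r.1 ^ α)) (by fun_prop)

/-- The spectral cluster with the score `y` at the origin. -/
noncomputable def limitCluster (Φ : Pos d × PointSet d → PointSet d) (w : Pos d → ℝ)
    (r : (Pos d × MarkedConfig d) × ℝ) : Config d :=
  (spectralCluster Φ w (locs r.1) r.1.1).scale 1 (1 / r.2)

lemma measurable_limitCluster (hΦ : IsNeighborhood Φ) (hwm : Measurable w) :
    Measurable (limitCluster Φ w) := by
  refine measurable_scale_one.comp (Measurable.prodMk (by fun_prop) ?_)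
  refine (measurable_spectralCluster hΦ hwm).comp
    (Measurable.prodMk (by fun_prop) (measurable_locs.comp measurable_fst))

/-- The remaining configuration is fixed, so its scores disappear under the factor `1/u`, and the
limit cluster is driven by `s` alone. If `x` is not a neighbor of the origin or `w x = 0`, the share
vanishes for every `u > 0`. -/
lemma tendsto_lintegral_share [IsProbabilityMeasure m] (hm : m (Iic 0) = 0) {α : ℝ} (hα : 0 < α)
    (hreg : IsRegularlyVarying (fun u => m.real (Ioi u)) (-α)) (hΦ : IsNeighborhood Φ)
    (hw : ∀ t, 0 ≤ w t) (H : Config d →ᵇ ℝ≥0) {q : Pos d × MarkedConfig d}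
    (h0 : (0 : Pos d) ∈ (locs q).pts) :
    Tendsto (fun u => (m (Ioi u))⁻¹ *
        ∫⁻ s, share Φ w (fun μ => H μ) u ((q.1, s), addPoint (q.1, s) q.2) ∂m) atTop
      (𝓝 (largeDensity Φ w α q * ∫⁻ y, H (limitCluster Φ w (q, y)) ∂(paretoMeasure 1 α))) := by
  obtain ⟨x, Q⟩ := q
  have hpos : ∀ᵐ s ∂m, 0 < s := by
    filter_upwards [measure_eq_zero_iff_ae_notMem.1 hm] with s hs
    simpa using hs
  by_cases h : x ∉ (Φ (0, locs (x, Q))).pts ∨ w x = 0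
  · have hd : largeDensity Φ w α (x, Q) = 0 := by
      rcases h with h | h
      · rw [largeDensity, indicator_of_notMem h]
      · refine indicator_apply_eq_zero.2 fun _ => ?_
        simp [h, Real.zero_rpow hα.ne']
    rw [hd, zero_mul]
    refine tendsto_const_nhds.congr' ?_
    filter_upwards [eventually_gt_atTop 0] with u hu
    rw [lintegral_congr_ae (g := fun _ => 0), lintegral_zero, mul_zero]
    filter_upwards [hpos] with s hs
    exact share_addPoint_eq_zero _ hu hs h
  · push Not at h
    obtain ⟨hx, hwx⟩ := h
    have hwx : 0 < w x := lt_of_le_of_ne (hw x) hwx.symm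
    set A := locs (x, Q) with hA
    let f : ℝ × ℝ → Config d := fun r => (ofScores A fun t =>
      max (clusterWeight Φ w A x t * r.1) (restScore Φ w A Q x t * r.2)).1
    have hf : Continuous f := by
      refine continuous_iff_continuousAt.2 fun r => ?_
      refine tendsto_ofScores A fun t _ => ?_
      exact Continuous.tendsto (by fun_prop) r
    -- The threshold is `c = 1 / w(x)`. It turns `c ^ (-α)` into the weight `w(x)^α`, and the factor
    -- `c` in front of `y` normalizes the cluster to score `y` at the origin.
    have key := tendsto_lintegral_tail hα hreg (H.compContinuous ⟨f, hf⟩) (inv_pos.2 hwx)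
    have hlim : ENNReal.ofReal ((w x)⁻¹ ^ (-α)) *
        ∫⁻ y, (H.compContinuous ⟨f, hf⟩) ((w x)⁻¹ * y, 0) ∂(paretoMeasure 1 α) =
        largeDensity Φ w α (x, Q) *
          ∫⁻ y, H (limitCluster Φ w ((x, Q), y)) ∂(paretoMeasure 1 α) := by
      congr 1
      · rw [largeDensity, indicator_of_mem hx, Real.inv_rpow (hw x), Real.rpow_neg (hw x), inv_inv]
      · refine lintegral_congr_ae ?_
        filter_upwards [ae_paretoMeasure hα] with y hy
        have hy0 : 0 < y := by linarith
        change (H (f _) : ℝ≥0∞) = _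
        congr 2
        rw [limitCluster, spectralCluster_eq, scale_one_ofScores (by positivity)]
        refine congrArg Subtype.val (ofScores_congr fun t _ => ?_)
        have : 0 ≤ clusterWeight Φ w A x t * ((w x)⁻¹ * y) :=
          mul_nonneg (clusterWeight_nonneg hw _ _ _) (by positivity)
        rw [mul_zero, max_eq_left this]
        field_simp
        rfl
    rw [hlim] at key
    refine key.congr' ?_
    filter_upwards [eventually_gt_atTop 0, eventually_ge_atTop (restScore Φ w A Q x 0)]
      with u hu hr
    rw [← lintegral_indicator measurableSet_Ioi]
    congr 1
    refine lintegral_congr_ae ?_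
    filter_upwards [hpos] with s hs
    rw [share_addPoint hΦ hw _ hu hs h0 hr hx hwx]
    rfl

/-- As `w` is bounded, a single threshold `c` serves for all points, and convergence of one tail
ratio gives a bound uniform in `(x, Q)`. -/
lemma eventually_tail_le [IsProbabilityMeasure m] {α : ℝ}
    (hreg : IsRegularlyVarying (fun u => m.real (Ioi u)) (-α)) {c : ℝ} (hc : 0 < c) :
    ∃ K : ℝ≥0, ∀ᶠ u in atTop, (m (Ioi u))⁻¹ * m (Ioi (u * c)) ≤ K := by
  have h := hreg.2.2 c hc
  refine ⟨(c ^ (-α) + 1).toNNReal, ?_⟩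
  filter_upwards [h.eventually_le_const (lt_add_one _)] with u hu
  have h1 : m (Ioi u) = ENNReal.ofReal (m.real (Ioi u)) := by simp
  have h2 : m (Ioi (u * c)) = ENNReal.ofReal (m.real (Ioi (u * c))) := by simp
  rw [mul_comm, ← div_eq_mul_inv, h1, h2, ← ENNReal.ofReal_div_of_pos (tail_pos hreg u)]
  exact ENNReal.ofReal_le_ofReal hu

lemma lintegral_card_neighborhood [IsProbabilityMeasure Pr] [IsProbabilityMeasure m]
    (hP : IsPoissonProcess Pr P ((volume : Measure (Pos d)).prod m)) (hm : m (Iic 0) = 0)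
    (hζ₀ : HasLaw ζ₀ m Pr) (hindep : IndepFun ζ₀ P Pr) (hΦ : IsNeighborhood Φ) :
    ∫⁻ q, (Φ (0, locs q)).pts.indicator (fun _ => (1 : ℝ≥0∞)) q.1 ∂(reducedCampbell Pr P ζ₀) =
      ∫⁻ ω, (Φ (0, (addPoint (0, ζ₀ ω) (P ω)).ground)).toMeasure univ ∂Pr := by
  rw [← lintegral_tsum_neighborhood hP hm hζ₀ hindep hΦ (K := fun _ => 1) measurable_const]
  refine lintegral_congr fun ω => ?_
  rw [← lintegral_one, PointSet.lintegral_toMeasure]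

/-- The limit of functionals of the rescaled moving maxima process on the event of a large score at
the origin. -/
theorem tendsto_lintegral_movingMaxima [IsProbabilityMeasure Pr] [IsProbabilityMeasure m]
    (hP : IsPoissonProcess Pr P ((volume : Measure (Pos d)).prod m)) (hm : m (Iic 0) = 0)
    {α : ℝ} (hα : 0 < α) (hreg : IsRegularlyVarying (fun u => m.real (Ioi u)) (-α))
    (hζ₀ : HasLaw ζ₀ m Pr) (hindep : IndepFun ζ₀ P Pr) (hΦ : IsNeighborhood Φ)
    (hwm : Measurable w) (hw : ∀ t, 0 ≤ w t) (hwb : ∃ C : ℝ, ∀ t, w t ≤ C)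
    (hN : ∫⁻ ω, (Φ (0, (addPoint (0, ζ₀ ω) (P ω)).ground)).toMeasure univ ∂Pr < ∞)
    (H : Config d →ᵇ ℝ≥0) :
    Tendsto (fun u => (m (Ioi u))⁻¹ * ∫⁻ ω, {μ | u < movingMaxScore Φ w μ 0}.indicator
        (fun μ => (H ((movingMaxima Φ w μ).1.scale 1 u) : ℝ≥0∞)) (addPoint (0, ζ₀ ω) (P ω)) ∂Pr)
      atTop (𝓝 (∫⁻ q, largeDensity Φ w α q *
        ∫⁻ y, H (limitCluster Φ w (q, y)) ∂(paretoMeasure 1 α) ∂(reducedCampbell Pr P ζ₀))) := by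
  have hHm : Measurable fun μ : Config d => (H μ : ℝ≥0∞) :=
    H.continuous.measurable.coe_nnreal_ennreal
  have hmeas : ∀ u, Measurable fun q : Pos d × MarkedConfig d =>
      ∫⁻ s, share Φ w (fun μ => H μ) u ((q.1, s), addPoint (q.1, s) q.2) ∂m := by
    intro u
    refine Measurable.lintegral_prod_right' (f := fun r : (Pos d × MarkedConfig d) × ℝ =>
      share Φ w (fun μ => H μ) u ((r.1.1, r.2), addPoint (r.1.1, r.2) r.1.2)) ?_
    refine (measurable_share hΦ hwm hw hHm u).comp ?_
    exact Measurable.prodMk (by fun_prop) (measurable_addPoint.comp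
      (Measurable.prodMk (by fun_prop) (by fun_prop)))
  have hrepr : ∀ u, ∫⁻ ω, {μ | u < movingMaxScore Φ w μ 0}.indicator
        (fun μ => (H ((movingMaxima Φ w μ).1.scale 1 u) : ℝ≥0∞)) (addPoint (0, ζ₀ ω) (P ω)) ∂Pr =
      ∫⁻ q, ∫⁻ s, share Φ w (fun μ => H μ) u ((q.1, s), addPoint (q.1, s) q.2) ∂m
        ∂(reducedCampbell Pr P ζ₀) := by
    intro u
    rw [← lintegral_sum_addPoint_zero hP hm hζ₀ hindep (measurable_share hΦ hwm hw hHm u)]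
    refine lintegral_congr_ae ?_
    filter_upwards [ae_zero_mem_ground (P := P) hm hζ₀] with ω hω
    exact (lintegral_share hΦ (fun μ => H μ) u hω).symm
  obtain ⟨C, hC⟩ := hwb
  have hc : 0 < max C 1 := by positivity
  have hwc : ∀ t, w t ≤ max C 1 := fun t => (hC t).trans (le_max_left _ _)
  obtain ⟨K, hK⟩ := eventually_tail_le hreg (inv_pos.2 hc)
  simp_rw [hrepr, ← lintegral_const_mul _ (hmeas _)]
  have hpos : ∀ᵐ s ∂m, 0 < s := by
    filter_upwards [measure_eq_zero_iff_ae_notMem.1 hm] with s hs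
    simpa using hs
  have hH : ∀ μ, (H μ : ℝ≥0∞) ≤ (nndist H 0 : ℝ≥0∞) := fun μ => by
    have := H.nndist_coe_le_nndist (g := 0) (x := μ)
    rw [BoundedContinuousFunction.coe_zero, Pi.zero_apply, NNReal.nndist_zero_eq_val'] at this
    exact_mod_cast this
  refine tendsto_lintegral_filter_of_dominated_convergence
    (fun q => K * nndist H 0 * (Φ (0, locs q)).pts.indicator (fun _ => (1 : ℝ≥0∞)) q.1)
    (.of_forall fun u => (hmeas u).const_mul _) ?_ ?_ ?_
  · filter_upwards [hK] with u hu
    refine ae_of_all _ fun q => ?_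
    calc (m (Ioi u))⁻¹ *
          ∫⁻ s, share Φ w (fun μ => H μ) u ((q.1, s), addPoint (q.1, s) q.2) ∂m
        ≤ (m (Ioi u))⁻¹ * ∫⁻ s, (Φ (0, locs q)).pts.indicator (fun _ => (nndist H 0 : ℝ≥0∞)) q.1 *
            (Ioi (u * (max C 1)⁻¹)).indicator 1 s ∂m := by
          refine mul_le_mul_right ?_ _
          refine lintegral_mono_ae ?_
          filter_upwards [hpos] with s hs
          exact share_le hH hc hwc hs q.2
      _ = (m (Ioi u))⁻¹ * m (Ioi (u * (max C 1)⁻¹)) *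
            (Φ (0, locs q)).pts.indicator (fun _ => (nndist H 0 : ℝ≥0∞)) q.1 := by
          rw [lintegral_const_mul _ (measurable_one.indicator measurableSet_Ioi),
            lintegral_indicator_one measurableSet_Ioi]
          ring
      _ ≤ K * (Φ (0, locs q)).pts.indicator (fun _ => (nndist H 0 : ℝ≥0∞)) q.1 := by gcongr
      _ = _ := by
          by_cases hq : q.1 ∈ (Φ (0, locs q)).pts <;> simp [hq]
  · rw [lintegral_const_mul _ (measurable_indicator_neighborhood hΦ measurable_fst measurable_locs
      (K := fun _ => 1) measurable_const), lintegral_card_neighborhood hP hm hζ₀ hindep hΦ]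
    exact ENNReal.mul_ne_top (by finiteness) hN.ne
  · filter_upwards [ae_reducedCampbell hP.measurable hm hζ₀] with q hq
    exact tendsto_lintegral_share hm hα hreg hΦ hw H hq

end TailConf

namespace TailConf

variable {d : ℕ} {Ω : Type*} [MeasurableSpace Ω] {Pr : Measure Ω}
  {P : Ω → MarkedConfig d} {m : Measure ℝ} {ζ₀ : Ω → ℝ}
  {Φ : Pos d × PointSet d → PointSet d} {w : Pos d → ℝ} {α : ℝ}

/-! ### The limit law -/

lemma lintegral_largeDensity_mul [IsProbabilityMeasure Pr] [IsProbabilityMeasure m]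
    (hP : IsPoissonProcess Pr P ((volume : Measure (Pos d)).prod m)) (hm : m (Iic 0) = 0)
    (hζ₀ : HasLaw ζ₀ m Pr) (hindep : IndepFun ζ₀ P Pr) (hΦ : IsNeighborhood Φ)
    (hwm : Measurable w) {g : Pos d × PointSet d → ℝ≥0∞} (hg : Measurable g) :
    ∫⁻ q, largeDensity Φ w α q * g (q.1, locs q) ∂(reducedCampbell Pr P ζ₀) =
      ∫⁻ ω, ∑' x : (Φ (0, (addPoint (0, ζ₀ ω) (P ω)).ground)).pts,
        g (x, (addPoint (0, ζ₀ ω) (P ω)).ground) * ENNReal.ofReal (w x ^ α) ∂Pr := by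
  rw [lintegral_tsum_neighborhood hP hm hζ₀ hindep hΦ
    (K := fun r => g r * ENNReal.ofReal (w r.1 ^ α)) (by fun_prop)]
  refine lintegral_congr fun q => ?_
  by_cases hq : q.1 ∈ (Φ (0, locs q)).pts <;> simp [largeDensity, hq, mul_comm]

lemma lintegral_largeDensity [IsProbabilityMeasure Pr] [IsProbabilityMeasure m]
    (hP : IsPoissonProcess Pr P ((volume : Measure (Pos d)).prod m)) (hm : m (Iic 0) = 0)
    (hζ₀ : HasLaw ζ₀ m Pr) (hindep : IndepFun ζ₀ P Pr) (hΦ : IsNeighborhood Φ)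
    (hwm : Measurable w) :
    ∫⁻ q, largeDensity Φ w α q ∂(reducedCampbell Pr P ζ₀) =
      ∫⁻ ω, ∑' x : (Φ (0, (addPoint (0, ζ₀ ω) (P ω)).ground)).pts,
        ENNReal.ofReal (w x ^ α) ∂Pr := by
  simpa using lintegral_largeDensity_mul (α := α) hP hm hζ₀ hindep hΦ hwm
    (g := fun _ => 1) measurable_const

lemma lintegral_largeDensity_ne_zero [IsProbabilityMeasure Pr] [IsProbabilityMeasure m]
    (hP : IsPoissonProcess Pr P ((volume : Measure (Pos d)).prod m)) (hm : m (Iic 0) = 0)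
    (hζ₀ : HasLaw ζ₀ m Pr) (hindep : IndepFun ζ₀ P Pr) (hΦ : IsNeighborhood Φ)
    (hwm : Measurable w) (hw0 : 0 < w 0) :
    ∫⁻ q, largeDensity Φ w α q ∂(reducedCampbell Pr P ζ₀) ≠ 0 := by
  rw [lintegral_largeDensity hP hm hζ₀ hindep hΦ hwm]
  have h : ENNReal.ofReal (w 0 ^ α) ≤
      ∫⁻ ω, ∑' x : (Φ (0, (addPoint (0, ζ₀ ω) (P ω)).ground)).pts,
        ENNReal.ofReal (w x ^ α) ∂Pr := by
    calc ENNReal.ofReal (w 0 ^ α) = ∫⁻ _, ENNReal.ofReal (w 0 ^ α) ∂Pr := by simp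
      _ ≤ _ := by
        refine lintegral_mono_ae ?_
        filter_upwards [ae_zero_mem_ground (P := P) hm hζ₀] with ω hω
        exact ENNReal.le_tsum (f := fun x : (Φ (0, (addPoint (0, ζ₀ ω) (P ω)).ground)).pts =>
          ENNReal.ofReal (w x ^ α)) ⟨0, hΦ.self_mem _ _ hω⟩
  have h' : 0 < ENNReal.ofReal (w 0 ^ α) := ENNReal.ofReal_pos.2 (Real.rpow_pos_of_pos hw0 α)
  exact (h'.trans_le h).ne'

lemma lintegral_largeDensity_ne_top [IsProbabilityMeasure Pr] [IsProbabilityMeasure m]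
    (hP : IsPoissonProcess Pr P ((volume : Measure (Pos d)).prod m)) (hm : m (Iic 0) = 0)
    (hζ₀ : HasLaw ζ₀ m Pr) (hindep : IndepFun ζ₀ P Pr) (hΦ : IsNeighborhood Φ)
    (hα : 0 < α) (hw : ∀ t, 0 ≤ w t) (hwb : ∃ C : ℝ, ∀ t, w t ≤ C)
    (hN : ∫⁻ ω, (Φ (0, (addPoint (0, ζ₀ ω) (P ω)).ground)).toMeasure univ ∂Pr < ∞) :
    ∫⁻ q, largeDensity Φ w α q ∂(reducedCampbell Pr P ζ₀) ≠ ∞ := by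
  obtain ⟨C, hC⟩ := hwb
  have h : ∫⁻ q, largeDensity Φ w α q ∂(reducedCampbell Pr P ζ₀) ≤
      ∫⁻ q, ENNReal.ofReal (C ^ α) * (Φ (0, locs q)).pts.indicator (fun _ => (1 : ℝ≥0∞)) q.1
        ∂(reducedCampbell Pr P ζ₀) := by
    refine lintegral_mono fun q => ?_
    by_cases hq : q.1 ∈ (Φ (0, locs q)).pts
    · simp only [largeDensity, hq, indicator_of_mem, mul_one]
      exact ENNReal.ofReal_le_ofReal (Real.rpow_le_rpow (hw _) (hC _) hα.le)
    · simp [largeDensity, hq]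
  refine ne_top_of_le_ne_top ?_ h
  rw [lintegral_const_mul _ (measurable_indicator_neighborhood hΦ measurable_fst measurable_locs
    (K := fun _ => 1) measurable_const), lintegral_card_neighborhood hP hm hζ₀ hindep hΦ]
  exact ENNReal.mul_ne_top ENNReal.ofReal_ne_top hN.ne

/-- The law of the tail configuration of the moving maxima process. -/
noncomputable def limitLaw {Ω : Type*} [MeasurableSpace Ω] (Pr : Measure Ω)
    (P : Ω → MarkedConfig d) (ζ₀ : Ω → ℝ) (Φ : Pos d × PointSet d → PointSet d) (w : Pos d → ℝ)
    (α : ℝ) : Measure (Config d) :=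
  (∫⁻ q, largeDensity Φ w α q ∂(reducedCampbell Pr P ζ₀))⁻¹ •
    (((reducedCampbell Pr P ζ₀).withDensity (largeDensity Φ w α)).prod
      (paretoMeasure 1 α)).map (limitCluster Φ w)

lemma lintegral_limitLaw (hΦ : IsNeighborhood Φ) (hwm : Measurable w) (hα : 0 < α)
    {h : Config d → ℝ≥0∞} (hh : Measurable h) :
    ∫⁻ μ, h μ ∂(limitLaw Pr P ζ₀ Φ w α) =
      (∫⁻ q, largeDensity Φ w α q ∂(reducedCampbell Pr P ζ₀))⁻¹ *
        ∫⁻ q, largeDensity Φ w α q * ∫⁻ y, h (limitCluster Φ w (q, y)) ∂(paretoMeasure 1 α)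
          ∂(reducedCampbell Pr P ζ₀) := by
  have := isProbabilityMeasure_paretoMeasure one_pos hα
  have hc : Measurable fun r => h (limitCluster Φ w r) :=
    hh.comp (measurable_limitCluster hΦ hwm)
  rw [limitLaw, lintegral_smul_measure, lintegral_map hh (measurable_limitCluster hΦ hwm),
    lintegral_prod _ hc.aemeasurable,
    lintegral_withDensity_eq_lintegral_mul _ (measurable_largeDensity hΦ hwm α)
      (hc.lintegral_prod_right')]
  rfl

lemma isProbabilityMeasure_limitLaw [IsProbabilityMeasure Pr] [IsProbabilityMeasure m]
    (hP : IsPoissonProcess Pr P ((volume : Measure (Pos d)).prod m)) (hm : m (Iic 0) = 0)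
    (hζ₀ : HasLaw ζ₀ m Pr) (hindep : IndepFun ζ₀ P Pr) (hΦ : IsNeighborhood Φ)
    (hα : 0 < α) (hwm : Measurable w) (hw : ∀ t, 0 ≤ w t) (hw0 : 0 < w 0)
    (hwb : ∃ C : ℝ, ∀ t, w t ≤ C)
    (hN : ∫⁻ ω, (Φ (0, (addPoint (0, ζ₀ ω) (P ω)).ground)).toMeasure univ ∂Pr < ∞) :
    IsProbabilityMeasure (limitLaw Pr P ζ₀ Φ w α) := by
  have := isProbabilityMeasure_paretoMeasure one_pos hα
  constructor
  rw [← lintegral_one, lintegral_limitLaw hΦ hwm hα measurable_const]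
  simp only [lintegral_const, measure_univ, mul_one]
  exact ENNReal.inv_mul_cancel (lintegral_largeDensity_ne_zero hP hm hζ₀ hindep hΦ hwm hw0)
    (lintegral_largeDensity_ne_top hP hm hζ₀ hindep hΦ hα hw hwb hN)

/-- The limit law only charges clusters for which the origin is a location with `x` in its
neighborhood, `w(x) > 0` and `y > 1`. A functional which does not see `y` there loses the Pareto
integral. -/
lemma lintegral_limitLaw_congr [IsProbabilityMeasure Pr]
    (hP : IsPoissonProcess Pr P ((volume : Measure (Pos d)).prod m)) (hm : m (Iic 0) = 0)
    (hζ₀ : HasLaw ζ₀ m Pr) (hΦ : IsNeighborhood Φ)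
    (hα : 0 < α) (hwm : Measurable w) (hw : ∀ t, 0 ≤ w t)
    {h : Config d → ℝ≥0∞} (hh : Measurable h) {g : Pos d × MarkedConfig d → ℝ≥0∞}
    (hg : ∀ q, (0 : Pos d) ∈ (locs q).pts → q.1 ∈ (Φ (0, locs q)).pts → 0 < w q.1 →
      ∀ y, 1 < y → h (limitCluster Φ w (q, y)) = g q) :
    ∫⁻ μ, h μ ∂(limitLaw Pr P ζ₀ Φ w α) =
      (∫⁻ q, largeDensity Φ w α q ∂(reducedCampbell Pr P ζ₀))⁻¹ *
        ∫⁻ q, largeDensity Φ w α q * g q ∂(reducedCampbell Pr P ζ₀) := by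
  have := isProbabilityMeasure_paretoMeasure one_pos hα
  rw [lintegral_limitLaw hΦ hwm hα hh]
  congr 1
  refine lintegral_congr_ae ?_
  filter_upwards [ae_reducedCampbell hP.measurable hm hζ₀] with q hq
  by_cases h1 : q.1 ∈ (Φ (0, locs q)).pts
  · rcases (hw q.1).eq_or_lt with h2 | h2
    · simp [largeDensity, h1, ← h2, Real.zero_rpow hα.ne']
    · congr 1
      have h3 : ∀ᵐ y ∂(paretoMeasure 1 α), h (limitCluster Φ w (q, y)) = g q := by
        filter_upwards [ae_paretoMeasure hα] with y hy
        exact hg q hq h1 h2 y hy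
      rw [lintegral_congr_ae h3, lintegral_const, measure_univ, mul_one]
  · simp [largeDensity, h1]

lemma limitCluster_eq {q : Pos d × MarkedConfig d} {y : ℝ} (hy : 1 < y) :
    limitCluster Φ w (q, y) =
      (ofScores (locs q) fun t => clusterWeight Φ w (locs q) q.1 t / w q.1 * y).1 := by
  rw [limitCluster, spectralCluster_eq, scale_one_ofScores (by positivity)]
  simp only [div_div_eq_mul_div, div_one]

lemma mem_limitCluster {q : Pos d × MarkedConfig d} (h0 : (0 : Pos d) ∈ (locs q).pts)
    (h1 : q.1 ∈ (Φ (0, locs q)).pts) (h2 : 0 < w q.1) {y : ℝ} (hy : 1 < y) :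
    (0, y) ∈ (limitCluster Φ w (q, y)).atoms := by
  rw [limitCluster_eq hy]
  refine ⟨h0, ?_, by change 0 < y; linarith⟩
  simp [clusterWeight, h1, h2.ne']

/-- At the origin the cluster has score `w(x)/w(x) = 1`, hence `y` after scaling; dividing by the
score at the origin undoes the scaling. -/
lemma spectral_limitCluster {q : Pos d × MarkedConfig d} (h0 : (0 : Pos d) ∈ (locs q).pts)
    (h1 : q.1 ∈ (Φ (0, locs q)).pts) (h2 : 0 < w q.1) {y : ℝ} (hy : 1 < y) :
    spectral 0 (limitCluster Φ w (q, y)) = spectralCluster Φ w (locs q) q.1 := by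
  have hy0 : 0 < y := by linarith
  rw [spectral_zero, Config.score_eq (mem_limitCluster h0 h1 h2 hy), limitCluster_eq hy,
    scale_one_ofScores hy0, spectralCluster_eq]
  simp only [mul_div_cancel_right₀ _ hy0.ne']

lemma Config.toMeasure_origin {μ : Config d} {y : ℝ} (h : (0, y) ∈ μ.atoms) (hy : 1 < y) :
    μ.toMeasure ({(0 : Pos d)} ×ˢ Ioi (1 : ℝ)) = 1 := by
  have : μ.atoms ∩ ({(0 : Pos d)} ×ˢ Ioi (1 : ℝ)) = {(0, y)} := by
    ext p
    constructor
    · rintro ⟨hp, hp0, -⟩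
      exact μ.simple _ hp _ h hp0
    · rintro rfl
      exact ⟨h, rfl, hy⟩
  rw [Config.toMeasure_apply _ ((measurableSet_singleton _).prod measurableSet_Ioi), this]
  simp

lemma ae_limitLaw_origin [IsProbabilityMeasure Pr]
    (hP : IsPoissonProcess Pr P ((volume : Measure (Pos d)).prod m)) (hm : m (Iic 0) = 0)
    (hζ₀ : HasLaw ζ₀ m Pr) (hΦ : IsNeighborhood Φ)
    (hα : 0 < α) (hwm : Measurable w) (hw : ∀ t, 0 ≤ w t) :
    ∀ᵐ μ ∂(limitLaw Pr P ζ₀ Φ w α), μ.toMeasure ({(0 : Pos d)} ×ˢ Ioi (1 : ℝ)) = 1 := by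
  have hmeas : MeasurableSet {μ : Config d | μ.toMeasure ({(0 : Pos d)} ×ˢ Ioi (1 : ℝ)) = 1} := by
    refine measurableSet_eq_fun (g := fun _ => 1) ?_ measurable_const
    exact measurable_config_iff.1 measurable_id _
      ((measurableSet_singleton _).prod measurableSet_Ioi)
  rw [ae_iff, ← compl_ofPred, ← lintegral_indicator_one hmeas.compl,
    lintegral_limitLaw_congr hP hm hζ₀ hΦ hα hwm hw (measurable_one.indicator hmeas.compl)
      (g := fun _ => 0)]
  · simp
  · intro q h0 h1 h2 y hy
    refine indicator_of_notMem ?_ _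
    rw [notMem_compl_iff]
    exact Config.toMeasure_origin (mem_limitCluster h0 h1 h2 hy) hy

lemma lintegral_spectral_limitLaw [IsProbabilityMeasure Pr] [IsProbabilityMeasure m]
    (hP : IsPoissonProcess Pr P ((volume : Measure (Pos d)).prod m)) (hm : m (Iic 0) = 0)
    (hζ₀ : HasLaw ζ₀ m Pr) (hindep : IndepFun ζ₀ P Pr) (hΦ : IsNeighborhood Φ)
    (hα : 0 < α) (hwm : Measurable w) (hw : ∀ t, 0 ≤ w t)
    {h : Config d → ℝ≥0∞} (hh : Measurable h) :
    ∫⁻ μ, h (spectral 0 μ) ∂(limitLaw Pr P ζ₀ Φ w α) =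
      (∫⁻ q, largeDensity Φ w α q ∂(reducedCampbell Pr P ζ₀))⁻¹ *
        ∫⁻ ω, ∑' x : (Φ (0, (addPoint (0, ζ₀ ω) (P ω)).ground)).pts,
          h (spectralCluster Φ w (addPoint (0, ζ₀ ω) (P ω)).ground x) *
            ENNReal.ofReal (w x ^ α) ∂Pr := by
  rw [lintegral_limitLaw_congr (h := fun μ => h (spectral 0 μ)) hP hm hζ₀ hΦ hα hwm hw
    (hh.comp measurable_spectral_zero) (g := fun q => h (spectralCluster Φ w (locs q) q.1))
    fun q h0 h1 h2 y hy => by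
      rw [spectral_limitCluster h0 h1 h2 hy]]
  rw [← lintegral_largeDensity_mul hP hm hζ₀ hindep hΦ hwm
    (g := fun r => h (spectralCluster Φ w r.2 r.1)) (hh.comp (measurable_spectralCluster hΦ hwm))]

end TailConf

namespace TailConf

variable {d : ℕ}

/-! ### Laws of configurations are determined by continuous functionals -/

/-- A test function which is positive exactly on the given open set. -/
noncomputable def bump (U : Set (Pos d × ℝ)) (p : Pos d × ℝ) : ℝ := min 1 (Metric.infDist p Uᶜ)

lemma bump_nonneg (U : Set (Pos d × ℝ)) (p : Pos d × ℝ) : 0 ≤ bump U p :=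
  le_min zero_le_one Metric.infDist_nonneg

lemma bump_pos_iff {U : Set (Pos d × ℝ)} (hU : IsOpen U) {n : ℕ} (hn : U ⊆ window d n)
    (p : Pos d × ℝ) : 0 < bump U p ↔ p ∈ U := by
  -- The distance to the empty set is `0` by convention, so the complement must contain a point;
  -- `(0, 0)` lies in no window.
  have hne : Uᶜ.Nonempty := ⟨(0, 0), fun h => lt_irrefl _ (pos_of_mem_window (hn h))⟩
  rw [bump, lt_min_iff, ← not_iff_not, ← mem_compl_iff, hU.isClosed_compl.mem_iff_infDist_zero hne]
  simp only [zero_lt_one, true_and, not_lt]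
  exact ⟨fun h => le_antisymm h Metric.infDist_nonneg, fun h => h.le⟩

lemma isTestFunction_bump {U : Set (Pos d × ℝ)} (hU : IsOpen U) {n : ℕ} (hn : U ⊆ window d n) :
    IsTestFunction (bump U) := by
  refine ⟨by unfold bump; fun_prop, ⟨1, fun p => ?_⟩, n + 1, 1 / ((n : ℝ) + 1), by positivity,
    fun p hp => ?_⟩
  · rw [abs_of_nonneg (bump_nonneg U p)]
    exact min_le_left _ _
  · have := hn ((bump_pos_iff hU hn p).1 (lt_of_le_of_ne (bump_nonneg U p) hp.symm))
    exact ⟨this.1.le, this.2⟩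

lemma tsum_bump_nonneg (U : Set (Pos d × ℝ)) (μ : Config d) : 0 ≤ ∑' p : μ.atoms, bump U p :=
  tsum_nonneg fun _ => bump_nonneg _ _

lemma tsum_bump_eq_zero_iff {U : Set (Pos d × ℝ)} (hU : IsOpen U) {n : ℕ} (hn : U ⊆ window d n)
    (μ : Config d) : ∑' p : μ.atoms, bump U p = 0 ↔ μ.toMeasure U = 0 := by
  have hs : Summable fun p : μ.atoms => bump U p := by
    refine summable_of_hasFiniteSupport ?_
    have : (Function.support fun p : μ.atoms => bump U p) ⊆
        Subtype.val ⁻¹' (μ.atoms ∩ window d n) := fun p hp =>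
      ⟨p.2, hn ((bump_pos_iff hU hn p).1 (lt_of_le_of_ne (bump_nonneg U p) (Ne.symm hp)))⟩
    exact ((μ.finite_window n).preimage Subtype.val_injective.injOn).subset this
  rw [← hs.hasSum_iff, hasSum_zero_iff_of_nonneg fun _ => bump_nonneg _ _,
    μ.toMeasure_eq_zero hU.measurableSet, funext_iff]
  simp only [Subtype.forall, Pi.zero_apply]
  refine forall₂_congr fun p _ => ?_
  rw [← bump_pos_iff hU hn p, (bump_nonneg U p).lt_iff_ne', not_not]

/-- The exponential functionals of the vague topology. -/
noncomputable def laplace {U : Set (Pos d × ℝ)} (hU : IsOpen U) {n : ℕ} (hn : U ⊆ window d n)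
    (k : ℕ) : Config d →ᵇ ℝ :=
  BoundedContinuousFunction.ofNormedAddCommGroup
    (fun μ => Real.exp (-(k * ∑' p : μ.atoms, bump U p)))
    (by
      have := continuous_tsum_atoms (isTestFunction_bump hU hn)
      fun_prop) 1
    (fun μ => by
      rw [Real.norm_eq_abs, Real.abs_exp, Real.exp_le_one_iff, neg_nonpos]
      exact mul_nonneg k.cast_nonneg (tsum_bump_nonneg U μ))

/-- The sum of the bump function over the atoms is `0` if `U` is void and positive otherwise, so
multiplying it by `k → ∞` in the exponent produces the indicator of the void event. -/
lemma tendsto_laplace {U : Set (Pos d × ℝ)} (hU : IsOpen U) {n : ℕ} (hn : U ⊆ window d n)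
    (μ : Config d) : Tendsto (fun k => laplace hU hn k μ) atTop
      (𝓝 ({μ : Config d | μ.toMeasure U = 0}.indicator 1 μ)) := by
  change Tendsto (fun k : ℕ => Real.exp (-(k * ∑' p : μ.atoms, bump U p))) atTop _
  by_cases h : μ.toMeasure U = 0
  · rw [indicator_of_mem (show μ ∈ {μ : Config d | μ.toMeasure U = 0} from h),
      (tsum_bump_eq_zero_iff hU hn μ).2 h]
    simp
  · rw [indicator_of_notMem (show μ ∉ {μ : Config d | μ.toMeasure U = 0} from h)]
    have hpos : 0 < ∑' p : μ.atoms, bump U p :=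
      lt_of_le_of_ne (tsum_bump_nonneg U μ) fun h' => h ((tsum_bump_eq_zero_iff hU hn μ).1 h'.symm)
    exact Real.tendsto_exp_neg_atTop_nhds_zero.comp
      (tendsto_natCast_atTop_atTop.atTop_mul_const hpos)

/-- Probabilities of void events are limits of expectations of bounded continuous functionals, and
void events form a generating π-system. No metrizability of the vague topology is involved. -/
theorem Config.ext_of_forall_integral_eq {ν ν' : Measure (Config d)} [IsProbabilityMeasure ν]
    [IsProbabilityMeasure ν'] (h : ∀ H : Config d →ᵇ ℝ, ∫ μ, H μ ∂ν = ∫ μ, H μ ∂ν') : ν = ν' := by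
  refine ext_of_generate_finite (voidEvents d) generateFrom_voidEvents.symm isPiSystem_voidEvents
    ?_ (by simp)
  rintro _ ⟨U, hU, ⟨n, hn⟩, rfl⟩
  have hmeas : MeasurableSet {μ : Config d | μ.toMeasure U = 0} :=
    (measurable_config_iff.1 measurable_id U hU.measurableSet) (measurableSet_singleton 0)
  have key : ∀ (ν : Measure (Config d)) [IsProbabilityMeasure ν],
      Tendsto (fun k => ∫ μ, laplace hU hn k μ ∂ν) atTop
        (𝓝 (ν.real {μ : Config d | μ.toMeasure U = 0})) := by
    intro ν _
    rw [← integral_indicator_one hmeas]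
    refine tendsto_integral_of_dominated_convergence (fun _ => 1)
      (fun k => (laplace hU hn k).continuous.measurable.aestronglyMeasurable)
      (integrable_const 1) (fun k => ae_of_all _ fun μ => ?_)
      (ae_of_all _ fun μ => tendsto_laplace hU hn μ)
    change ‖Real.exp (-(k * ∑' p : μ.atoms, bump U p))‖ ≤ 1
    rw [Real.norm_eq_abs, Real.abs_exp, Real.exp_le_one_iff, neg_nonpos]
    exact mul_nonneg k.cast_nonneg (tsum_bump_nonneg U μ)
  have h1 := key ν
  simp_rw [h] at h1
  exact (measureReal_eq_measureReal_iff).1 (tendsto_nhds_unique h1 (key ν'))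

end TailConf

namespace TailConf

variable {d : ℕ} {Ω : Type*} [MeasurableSpace Ω] {Pr : Measure Ω}
  {P : Ω → MarkedConfig d} {m : Measure ℝ} {ζ₀ : Ω → ℝ}
  {Φ : Pos d × PointSet d → PointSet d} {w : Pos d → ℝ} {α : ℝ}

/-! ### Conditioning on a large score at the origin -/

/-- A regularly varying tail asymptotics is inherited by tails asymptotically proportional to it. -/
lemma IsRegularlyVarying.of_tendsto_div {f g : ℝ → ℝ} {ρ k : ℝ} (hg : IsRegularlyVarying g ρ)
    (hf : Measurable f) (hk : 0 < k) (h : Tendsto (fun u => f u / g u) atTop (𝓝 k)) :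
    IsRegularlyVarying f ρ := by
  refine ⟨hf, ?_, fun y hy => ?_⟩
  · filter_upwards [hg.2.1, h.eventually_const_lt hk] with u h1 h2
    exact (div_pos_iff_of_pos_right h1).1 h2
  · have hy' : Tendsto (fun u : ℝ => u * y) atTop atTop := tendsto_id.atTop_mul_const hy
    have h1 := ((h.comp hy').mul (hg.2.2 y hy)).div h hk.ne'
    rw [mul_comm k, mul_div_cancel_right₀ _ hk.ne'] at h1
    refine h1.congr' ?_
    filter_upwards [hg.2.1, hy'.eventually hg.2.1] with u h2 h3
    simp only [Function.comp_apply, Pi.div_apply]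
    rw [div_mul_div_cancel₀ h3.ne', div_div_div_cancel_right₀ h2.ne']

lemma isRegularlyVarying_one : IsRegularlyVarying (fun _ => 1) 0 := by
  refine ⟨measurable_const, .of_forall fun _ => one_pos, fun y _ => ?_⟩
  simp

lemma aemeasurable_movingMaxima_addPoint
    (hP : Measurable P) (hζ₀ : HasLaw ζ₀ m Pr) (hΦ : IsNeighborhood Φ)
    (hwm : Measurable w) (hw : ∀ t, 0 ≤ w t) :
    AEMeasurable (fun ω => movingMaxima Φ w (addPoint (0, ζ₀ ω) (P ω))) Pr :=
  (measurable_movingMaxima hΦ hwm hw).comp_aemeasurable (aemeasurable_addPoint_zero hP hζ₀)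

/-- Only null measurability is available, since `ζ₀` is merely almost everywhere measurable. -/
lemma nullMeasurableSet_exceedance
    (hP : Measurable P) (hζ₀ : HasLaw ζ₀ m Pr) (hΦ : IsNeighborhood Φ)
    (hwm : Measurable w) (hw : ∀ t, 0 ≤ w t)
    (u : ℝ) : NullMeasurableSet
    {ω | u < (movingMaxima Φ w (addPoint (0, ζ₀ ω) (P ω))).1.score 0} Pr := by
  refine nullMeasurableSet_lt aemeasurable_const ?_
  exact (measurable_score.comp (measurable_subtype_coe.prodMk measurable_const)).comp_aemeasurable
    (aemeasurable_movingMaxima_addPoint hP hζ₀ hΦ hwm hw)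

lemma setLIntegral_exceedance
    (hP : Measurable P) (hζ₀ : HasLaw ζ₀ m Pr) (hΦ : IsNeighborhood Φ)
    (hwm : Measurable w) (hw : ∀ t, 0 ≤ w t)
    (hm : m (Iic 0) = 0) (u : ℝ) (F : MarkedConfig d → ℝ≥0∞) :
    ∫⁻ ω in {ω | u < (movingMaxima Φ w (addPoint (0, ζ₀ ω) (P ω))).1.score 0},
        F (addPoint (0, ζ₀ ω) (P ω)) ∂Pr =
      ∫⁻ ω, {μ | u < movingMaxScore Φ w μ 0}.indicator F (addPoint (0, ζ₀ ω) (P ω)) ∂Pr := by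
  rw [← lintegral_indicator₀ (nullMeasurableSet_exceedance hP hζ₀ hΦ hwm hw u)]
  refine lintegral_congr_ae ?_
  filter_upwards [ae_zero_mem_ground (P := P) hm hζ₀] with ω hω
  simp only [indicator, mem_ofPred_eq, score_movingMaxima hw hω]

section

variable [IsProbabilityMeasure Pr] [IsProbabilityMeasure m]

lemma tendsto_setLIntegral_exceedance
    (hP : IsPoissonProcess Pr P ((volume : Measure (Pos d)).prod m)) (hm : m (Iic 0) = 0)
    (hα : 0 < α) (hreg : IsRegularlyVarying (fun u => m.real (Ioi u)) (-α))
    (hζ₀ : HasLaw ζ₀ m Pr) (hindep : IndepFun ζ₀ P Pr) (hΦ : IsNeighborhood Φ)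
    (hwm : Measurable w) (hw : ∀ t, 0 ≤ w t) (hw0 : 0 < w 0) (hwb : ∃ C : ℝ, ∀ t, w t ≤ C)
    (hN : ∫⁻ ω, (Φ (0, (addPoint (0, ζ₀ ω) (P ω)).ground)).toMeasure univ ∂Pr < ∞)
    (H : Config d →ᵇ ℝ≥0) :
    Tendsto (fun u => (m (Ioi u))⁻¹ *
        ∫⁻ ω in {ω | u < (movingMaxima Φ w (addPoint (0, ζ₀ ω) (P ω))).1.score 0},
          H ((movingMaxima Φ w (addPoint (0, ζ₀ ω) (P ω))).1.scale 1 u) ∂Pr)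
      atTop (𝓝 ((∫⁻ q, largeDensity Φ w α q ∂(reducedCampbell Pr P ζ₀)) *
        ∫⁻ μ, H μ ∂(limitLaw Pr P ζ₀ Φ w α))) := by
  have h := tendsto_lintegral_movingMaxima hP hm hα hreg hζ₀ hindep hΦ hwm hw hwb hN H
  rw [lintegral_limitLaw hΦ hwm hα H.continuous.measurable.coe_nnreal_ennreal, ← mul_assoc,
    ENNReal.mul_inv_cancel (lintegral_largeDensity_ne_zero hP hm hζ₀ hindep hΦ hwm hw0)
      (lintegral_largeDensity_ne_top hP hm hζ₀ hindep hΦ hα hw hwb hN), one_mul]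
  refine h.congr fun u => ?_
  rw [setLIntegral_exceedance hP.measurable hζ₀ hΦ hwm hw hm u
    (fun μ => (H ((movingMaxima Φ w μ).1.scale 1 u) : ℝ≥0∞))]

lemma tendsto_exceedance
    (hP : IsPoissonProcess Pr P ((volume : Measure (Pos d)).prod m)) (hm : m (Iic 0) = 0)
    (hα : 0 < α) (hreg : IsRegularlyVarying (fun u => m.real (Ioi u)) (-α))
    (hζ₀ : HasLaw ζ₀ m Pr) (hindep : IndepFun ζ₀ P Pr) (hΦ : IsNeighborhood Φ)
    (hwm : Measurable w) (hw : ∀ t, 0 ≤ w t) (hw0 : 0 < w 0) (hwb : ∃ C : ℝ, ∀ t, w t ≤ C)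
    (hN : ∫⁻ ω, (Φ (0, (addPoint (0, ζ₀ ω) (P ω)).ground)).toMeasure univ ∂Pr < ∞) :
    Tendsto (fun u => (m (Ioi u))⁻¹ *
        Pr {ω | u < (movingMaxima Φ w (addPoint (0, ζ₀ ω) (P ω))).1.score 0})
      atTop (𝓝 (∫⁻ q, largeDensity Φ w α q ∂(reducedCampbell Pr P ζ₀))) := by
  have := isProbabilityMeasure_limitLaw hP hm hζ₀ hindep hΦ hα hwm hw hw0 hwb hN
  have h := tendsto_setLIntegral_exceedance hP hm hα hreg hζ₀ hindep hΦ hwm hw hw0 hwb hN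
    (BoundedContinuousFunction.const _ 1)
  simpa using h

/-- A conditional expectation is a quotient of two limits already known. The normalizations by `m
(Ioi u)` and the total mass of the density cancel. -/
lemma tendsto_lintegral_cond_exceedance
    (hP : IsPoissonProcess Pr P ((volume : Measure (Pos d)).prod m)) (hm : m (Iic 0) = 0)
    (hα : 0 < α) (hreg : IsRegularlyVarying (fun u => m.real (Ioi u)) (-α))
    (hζ₀ : HasLaw ζ₀ m Pr) (hindep : IndepFun ζ₀ P Pr) (hΦ : IsNeighborhood Φ)
    (hwm : Measurable w) (hw : ∀ t, 0 ≤ w t) (hw0 : 0 < w 0) (hwb : ∃ C : ℝ, ∀ t, w t ≤ C)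
    (hN : ∫⁻ ω, (Φ (0, (addPoint (0, ζ₀ ω) (P ω)).ground)).toMeasure univ ∂Pr < ∞)
    (H : Config d →ᵇ ℝ≥0) :
    Tendsto (fun u => ∫⁻ ω, H ((movingMaxima Φ w (addPoint (0, ζ₀ ω) (P ω))).1.scale 1 u)
        ∂(cond Pr {ω | u < (movingMaxima Φ w (addPoint (0, ζ₀ ω) (P ω))).1.score 0}))
      atTop (𝓝 (∫⁻ μ, H μ ∂(limitLaw Pr P ζ₀ Φ w α))) := by
  have := isProbabilityMeasure_limitLaw hP hm hζ₀ hindep hΦ hα hwm hw hw0 hwb hN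
  have hκ0 := lintegral_largeDensity_ne_zero (α := α) hP hm hζ₀ hindep hΦ hwm hw0
  have hκ1 := lintegral_largeDensity_ne_top hP hm hζ₀ hindep hΦ hα hw hwb hN
  have h := ENNReal.Tendsto.div
    (tendsto_setLIntegral_exceedance hP hm hα hreg hζ₀ hindep hΦ hwm hw hw0 hwb hN H)
    (Or.inr hκ0) (tendsto_exceedance hP hm hα hreg hζ₀ hindep hΦ hwm hw hw0 hwb hN) (Or.inl hκ1)
  rw [ENNReal.mul_div_right_comm, ENNReal.div_self hκ0 hκ1, one_mul] at h
  refine h.congr fun u => ?_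
  have hm0 : (m (Ioi u))⁻¹ ≠ 0 := ENNReal.inv_ne_zero.2 (measure_ne_top m _)
  have hm1 : (m (Ioi u))⁻¹ ≠ ∞ := ENNReal.inv_ne_top.2 (tail_ne_zero hreg u)
  rw [ENNReal.mul_div_mul_left _ _ hm0 hm1, ProbabilityTheory.cond, lintegral_smul_measure,
    smul_eq_mul, mul_comm, div_eq_mul_inv]

lemma tendsto_integral_cond_exceedance
    (hP : IsPoissonProcess Pr P ((volume : Measure (Pos d)).prod m)) (hm : m (Iic 0) = 0)
    (hα : 0 < α) (hreg : IsRegularlyVarying (fun u => m.real (Ioi u)) (-α))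
    (hζ₀ : HasLaw ζ₀ m Pr) (hindep : IndepFun ζ₀ P Pr) (hΦ : IsNeighborhood Φ)
    (hwm : Measurable w) (hw : ∀ t, 0 ≤ w t) (hw0 : 0 < w 0) (hwb : ∃ C : ℝ, ∀ t, w t ≤ C)
    (hN : ∫⁻ ω, (Φ (0, (addPoint (0, ζ₀ ω) (P ω)).ground)).toMeasure univ ∂Pr < ∞)
    (H : Config d →ᵇ ℝ) :
    Tendsto (fun u => ∫ ω, H ((movingMaxima Φ w (addPoint (0, ζ₀ ω) (P ω))).1.scale 1 u)
        ∂(cond Pr {ω | u < (movingMaxima Φ w (addPoint (0, ζ₀ ω) (P ω))).1.score 0}))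
      atTop (𝓝 (∫ μ, H μ ∂(limitLaw Pr P ζ₀ Φ w α))) := by
  have := isProbabilityMeasure_limitLaw hP hm hζ₀ hindep hΦ hα hwm hw hw0 hwb hN
  have hmeas : ∀ u, AEMeasurable
      (fun ω => (movingMaxima Φ w (addPoint (0, ζ₀ ω) (P ω))).1.scale 1 u)
      (cond Pr {ω | u < (movingMaxima Φ w (addPoint (0, ζ₀ ω) (P ω))).1.score 0}) := fun u =>
    ((measurable_scale_one.comp (measurable_const.prodMk measurable_subtype_coe)).comp_aemeasurable
      (aemeasurable_movingMaxima_addPoint hP.measurable hζ₀ hΦ hwm hw)).mono_ac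
      cond_absolutelyContinuous
  have key : ∀ G : Config d →ᵇ ℝ≥0, Tendsto (fun u => ∫ μ, (G μ : ℝ) ∂((cond Pr
        {ω | u < (movingMaxima Φ w (addPoint (0, ζ₀ ω) (P ω))).1.score 0}).map
          fun ω => (movingMaxima Φ w (addPoint (0, ζ₀ ω) (P ω))).1.scale 1 u)) atTop
      (𝓝 (∫ μ, (G μ : ℝ) ∂(limitLaw Pr P ζ₀ Φ w α))) := by
    intro G
    simp_rw [← BoundedContinuousFunction.toReal_lintegral_coe_eq_integral,
      lintegral_map' (G.continuous.measurable.coe_nnreal_ennreal).aemeasurable (hmeas _)]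
    exact (ENNReal.tendsto_toReal (G.lintegral_lt_top_of_nnreal _).ne).comp
      (tendsto_lintegral_cond_exceedance hP hm hα hreg hζ₀ hindep hΦ hwm hw hw0 hwb hN G)
  -- A real functional is the difference of its positive and negative parts, to which the
  -- nonnegative case applies.
  simp_rw [fun u => (integral_map (hmeas u)
    H.continuous.measurable.aestronglyMeasurable).symm,
    BoundedContinuousFunction.integral_eq_integral_nnrealPart_sub]
  exact (key _).sub (key _)

end

end TailConf

/-! ### The theorem -/

open TailConf
theorem mainTheorem7 {d : ℕ} {Ω : Type*} [MeasurableSpace Ω]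
    (Pr : Measure Ω) [IsProbabilityMeasure Pr]
    -- the law `m` of the typical mark `ζ`, with a regularly varying tail of index `α`
    (m : Measure ℝ) [IsProbabilityMeasure m] (hm : m (Set.Iic 0) = 0)
    (α : ℝ) (hα : 0 < α)
    (hreg : IsRegularlyVarying (fun u => m.real (Set.Ioi u)) (-α))
    -- the marked Poisson process and the independent mark at the origin
    (P : Ω → MarkedConfig d) (hP : IsPoissonProcess Pr P ((volume : Measure (Pos d)).prod m))
    (ζ₀ : Ω → ℝ) (hζ₀ : HasLaw ζ₀ m Pr) (hindep : IndepFun ζ₀ P Pr)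
    -- neighborhoods and the weight function
    (Φ : Pos d × PointSet d → PointSet d) (hΦ : IsNeighborhood Φ)
    (w : Pos d → ℝ) (hwm : Measurable w) (hw : ∀ t, 0 ≤ w t) (hw0 : 0 < w 0)
    (hwb : ∃ C : ℝ, ∀ t, w t ≤ C)
    -- `P̃ = P + δ_{(0,ζ₀)}`, `X = Ψ(P)`, `X̃ = Ψ(P̃)`, `ξ = X̃(0)`
    (Pt : Ω → MarkedConfig d) (hPt : ∀ ω, Pt ω = addOrigin (P ω) (ζ₀ ω))
    (X : Ω → MarkedConfig d) (hX : ∀ ω, X ω = movingMaxima Φ w (P ω))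
    (Xt : Ω → MarkedConfig d) (hXt : ∀ ω, Xt ω = movingMaxima Φ w (Pt ω))
    (ξ : Ω → ℝ) (hξ : ∀ ω, ξ ω = (Xt ω).1.score 0)
    -- the expected number of neighbors of the origin is finite
    (hN : ∫⁻ ω, (Φ (0, (Pt ω).ground)).toMeasure Set.univ ∂Pr < ∞)
    (κ : ℝ≥0∞)
    (hκ : κ = ∫⁻ ω, ∑' t : (Φ (0, (Pt ω).ground)).pts, ENNReal.ofReal (w t ^ α) ∂Pr) :
    -- (i)
    ((0 < κ ∧ κ < ∞) ∧
      Tendsto (fun u : ℝ => Pr.real {ω | u < ξ ω} / m.real (Set.Ioi u)) atTop (𝓝 κ.toReal) ∧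
      IsRegularlyVarying (fun u => Pr.real {ω | u < ξ ω}) (-α)) ∧
    -- (ii)
    ((∃ ν : Measure (Config d), IsTailConfiguration (fun _ => 1) 0 Pr X Pr Xt ν) ∧
      ∀ ν : Measure (Config d), IsTailConfiguration (fun _ => 1) 0 Pr X Pr Xt ν →
        ∀ h : Config d → ℝ≥0∞, Measurable h →
          ∫⁻ μ, h (spectral 0 μ) ∂ν =
            κ⁻¹ * ∫⁻ ω, ∑' x : (Φ (0, (Pt ω).ground)).pts,
              h (spectralCluster Φ w (Pt ω).ground x) * ENNReal.ofReal (w x ^ α) ∂Pr) := by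
  -- `addOrigin` agrees by definition with `addPoint` at a point over the origin.
  obtain rfl : Pt = fun ω => addPoint (0, ζ₀ ω) (P ω) := funext hPt
  obtain rfl : X = fun ω => movingMaxima Φ w (P ω) := funext hX
  obtain rfl : Xt = fun ω => movingMaxima Φ w (addPoint (0, ζ₀ ω) (P ω)) := funext hXt
  obtain rfl : ξ = fun ω => (movingMaxima Φ w (addPoint (0, ζ₀ ω) (P ω))).1.score 0 := funext hξ
  rw [← lintegral_largeDensity hP hm hζ₀ hindep hΦ hwm] at hκ
  have hκ0 : κ ≠ 0 := hκ ▸ lintegral_largeDensity_ne_zero hP hm hζ₀ hindep hΦ hwm hw0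
  have hκ1 : κ ≠ ∞ := hκ ▸ lintegral_largeDensity_ne_top hP hm hζ₀ hindep hΦ hα hw hwb hN
  have hratio : Tendsto (fun u : ℝ => Pr.real {ω | u <
      (movingMaxima Φ w (addPoint (0, ζ₀ ω) (P ω))).1.score 0} / m.real (Set.Ioi u)) atTop
      (𝓝 κ.toReal) := by
    have h := (ENNReal.tendsto_toReal hκ1).comp
      (hκ ▸ tendsto_exceedance hP hm hα hreg hζ₀ hindep hΦ hwm hw hw0 hwb hN)
    refine h.congr fun u => ?_
    rw [Function.comp_apply, ENNReal.toReal_mul, ENNReal.toReal_inv, mul_comm, ← div_eq_mul_inv]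
    rfl
  have htail : IsTailConfiguration (fun _ => 1) 0 Pr (fun ω => movingMaxima Φ w (P ω)) Pr
      (fun ω => movingMaxima Φ w (addPoint (0, ζ₀ ω) (P ω))) (limitLaw Pr P ζ₀ Φ w α) :=
    { scaling_pos := fun _ _ => one_pos
      scaling := isRegularlyVarying_one
      stationary := isStationary_movingMaxima hP hm hΦ hwm hw
      palm := isPalmVersion_movingMaxima hP hm hζ₀ hindep hΦ hwm hw hw0
      isProbabilityMeasure :=
        isProbabilityMeasure_limitLaw hP hm hζ₀ hindep hΦ hα hwm hw hw0 hwb hN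
      origin := ae_limitLaw_origin hP hm hζ₀ hΦ hα hwm hw
      tendsto := tendsto_integral_cond_exceedance hP hm hα hreg hζ₀ hindep hΦ hwm hw hw0 hwb hN }
  refine ⟨⟨⟨pos_iff_ne_zero.2 hκ0, hκ1.lt_top⟩, hratio, ?_⟩, ⟨_, htail⟩, fun ν hν h hh => ?_⟩
  -- The tail function is measurable because it is monotone, irrespective of the measurability of
  -- `ξ`.
  · refine hreg.of_tendsto_div (Antitone.measurable fun u v huv => ?_)
      (ENNReal.toReal_pos hκ0 hκ1) hratio
    exact measureReal_mono fun ω hω => lt_of_le_of_lt huv hω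
  · have := hν.isProbabilityMeasure
    have := htail.isProbabilityMeasure
    -- Both laws are weak limits of the same conditional laws, hence they integrate all bounded
    -- continuous functionals equally and coincide.
    rw [Config.ext_of_forall_integral_eq fun H =>
      tendsto_nhds_unique (hν.tendsto H) (htail.tendsto H), hκ]
    exact lintegral_spectral_limitLaw hP hm hζ₀ hindep hΦ hα hwm hw hh
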